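/- Let $G:\mathbb R\to\mathbb R_{\ge 0}$ be even, strictly increasing and convex on $[0,\infty)$, with $G(0)=0$ and, for some $C_G>0$, $G(y)/G(x)\le C_G (y/x)^2$ for all $0<x<y$. For weights $w\in\mathbb R^n_{\ge 0}$ and $y\in\mathbb R^n$ let $\|y\|_{G,w}=0$ if $\sum_i w_i|y_i|=0$, and otherwise let $\|y\|_{G,w}$ be the unique $\alpha>0$ with $\sum_i w_i\,G(|y_i|/\alpha)=1$; let $\|y\|_G=\|y\|_{G,(1,\dots,1)}$ be the Orlicz norm. Let $d\ge 1$, $A\in\mathbb R^{n\times d}$, $b\in\mathbb R^n$, let $\overline A=[A\;\,b]\in\mathbb R^{n\times(d+1)}$ have full column rank, let $0<\varepsilon\le 1/2$, and let an embedding matrix $\Pi\in\mathbb R^{s\times n}$ and $\kappa$ be given such that $\|\overline A x\|_G\le\|\Pi\overline A x\|_2\le\kappa\|\overline A x\|_G$ for all $x\in\mathbb R^{d+1}$. Consider the following algorithm, with a sufficiently large absolute constant $C$. 1. Compute $\Pi\overline A$ and a QR-decomposition $QR=\Pi\overline A/\kappa$. 2. Compute $u_1,\dots,u_n$ with $u_i=\Theta(G(\|(\overline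 A R^{-1})_i\|_2))$, where the subscript $i$ denotes the $i$-th row and the constants in $\Theta$ depend only on $C_G$ and $C$. 3. Choose probabilities $p_i\in[0,1]$ with $p_i\ge\min\{1,\;C\,d\,\varepsilon^{-2}\log(1/\varepsilon)\,G(\|(\overline A R^{-1})_i\|_2)\}$, and independently for each $i$ let $w_i=1/p_i$ with probability $p_i$ and $w_i=0$ otherwise. 4. Return a minimizer $x^*$ of $\|Ax-b\|_{G,w}$ over $x\in\mathbb R^d$. (a) Correctness: for every QR-decomposition in Step 1 and every fixed choice of probabilities $p_i$ as in Step 3, with probability at least $0.9$ over $w$, a minimizer in Step 4 exists and every such minimizer $x^*$ satisfies $$\|Ax^*-b\|_G\le(1+\varepsilon)\min_{x\in\mathbb R^d}\|Ax-b\|_G .$$ (b) Running time: on a randomized real RAM (unit-cost arithmetic, comparisons and square roots on reals, evaluations of $G$, and independent uniform random numbers from $[0,1]$; $\overline A$ given in sparse row format and $n,d,\kappa,\varepsilon,C_G$ given), there are programs for Steps 2, 3 and 4, independent of $G$ and of the input, such that, following any deterministic program that performs Step 1, with probability at least $0.9$ Steps 2 and 3 are carried out as described, Step 4 returns $x^*$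 with $\|Ax^*-b\|_{G,w}\le(1+\varepsilon/4)\min_x\|Ax-b\|_{G,w}$, the output satisfies $\|Ax^*-b\|_G\le(1+\varepsilon)\min_x\|Ax-b\|_G$, and the total running time is at most $$\mathcal T_{\mathrm{QR}}(\Pi\overline A)+\widetilde O(\mathrm{nnz}(A)+n)+\mathrm{poly}(C_G\,d\,\kappa/\varepsilon),$$ where $\mathcal T_{\mathrm{QR}}(\Pi\overline A)$ is the running time of Step 1, $\mathrm{nnz}(A)$ is the number of non-zero entries of $A$, $\widetilde O(f)=O(f\,\mathrm{polylog} f)$, and the hidden constants and exponents depend only on $C$. -/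

import Mathlib

open MeasureTheory
open scoped Matrix ENNReal

noncomputable section

/-! ## Orlicz norms -/

/-- The standing assumption on `G : ℝ → ℝ≥0`: strictly increasing and convex on `[0, ∞)`, even,
vanishing at `0`, and of at most quadratic growth with constant `CG`. -/
structure IsOrliczFunction (G : ℝ → ℝ) (CG : ℝ) : Prop where
  nonneg : ∀ x, 0 ≤ G x
  strictMonoOn : StrictMonoOn G (Set.Ici 0)
  convexOn : ConvexOn ℝ (Set.Ici 0) G
  map_zero : G 0 = 0
  even : ∀ x, G x = G (-x)
  const_pos : 0 < CG
  growth : ∀ x y, 0 < x → x < y → G y / G x ≤ CG * (y / x) ^ 2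

/-- The weighted Orlicz norm `‖y‖_{G,w}`. If `∑ wᵢ |yᵢ| ≠ 0`, the set below consists of the
unique `α > 0` with `∑ wᵢ G(|yᵢ| / α) = 1`; otherwise it is empty and its infimum is `0`. -/
def weightedOrliczNorm {n : ℕ} (G : ℝ → ℝ) (w y : Fin n → ℝ) : ℝ :=
  sInf {α : ℝ | 0 < α ∧ ∑ i, w i * G (|y i| / α) = 1}

/-- The Orlicz norm `‖y‖_G`. -/
def orliczNorm {n : ℕ} (G : ℝ → ℝ) (y : Fin n → ℝ) : ℝ :=
  weightedOrliczNorm G (fun _ => 1) y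

/-- The Euclidean norm of a vector given by its coordinates. -/
def l2 {m : ℕ} (v : Fin m → ℝ) : ℝ := ‖WithLp.toLp 2 v‖

/-! ## The regression problem and the ingredients of the algorithm -/

/-- The matrix `Ā` whose first `d` columns are `A` and whose last column is `b`. -/
def augment {n d : ℕ} (A : Matrix (Fin n) (Fin d) ℝ) (b : Fin n → ℝ) :
    Matrix (Fin n) (Fin (d + 1)) ℝ :=
  Matrix.of fun i => (Fin.snoc (A i) (b i) : Fin (d + 1) → ℝ)

/-- The number of non-zero entries of a matrix. -/
def nnz {n m : ℕ} (M : Matrix (Fin n) (Fin m) ℝ) : ℕ :=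
  {ij : Fin n × Fin m | M ij.1 ij.2 ≠ 0}.ncard

/-- `Q * R` is a (thin) QR-decomposition of `M`. -/
structure IsQR {s m : ℕ} (M : Matrix (Fin s) (Fin m) ℝ) (Q : Matrix (Fin s) (Fin m) ℝ)
    (R : Matrix (Fin m) (Fin m) ℝ) : Prop where
  orthonormal : Qᵀ * Q = 1
  upper : ∀ i j, j < i → R i j = 0
  mul_eq : Q * R = M

/-- What is given to the algorithm: the function `G` with growth constant `CG`, the data `A`, `b`
(with `Ā` of full column rank, so that `R` is invertible), the embedding matrix `S` with distortion
`κ`, the accuracy `ε`, and a QR-decomposition `Q * R` of `S Ā / κ`. -/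
structure IsInstance (G : ℝ → ℝ) (CG : ℝ) {n d s : ℕ} (A : Matrix (Fin n) (Fin d) ℝ)
    (b : Fin n → ℝ) (S : Matrix (Fin s) (Fin n) ℝ) (κ ε : ℝ)
    (Q : Matrix (Fin s) (Fin (d + 1)) ℝ) (R : Matrix (Fin (d + 1)) (Fin (d + 1)) ℝ) : Prop where
  orlicz : IsOrliczFunction G CG
  one_le_d : 1 ≤ d
  eps_pos : 0 < ε
  eps_le : ε ≤ 1 / 2
  fullRank : LinearIndependent ℝ (augment A b)ᵀ
  lower : ∀ x, orliczNorm G (augment A b *ᵥ x) ≤ l2 ((S * augment A b) *ᵥ x)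
  upper : ∀ x, l2 ((S * augment A b) *ᵥ x) ≤ κ * orliczNorm G (augment A b *ᵥ x)
  qr : IsQR (κ⁻¹ • (S * augment A b)) Q R

/-- The Orlicz norm leverage score `G(‖(Ā R⁻¹)ᵢ‖₂)` of the `i`-th row. -/
def leverage (G : ℝ → ℝ) {n d : ℕ} (A : Matrix (Fin n) (Fin d) ℝ) (b : Fin n → ℝ)
    (R : Matrix (Fin (d + 1)) (Fin (d + 1)) ℝ) (i : Fin n) : ℝ :=
  G (l2 ((augment A b * R⁻¹) i))

/-- `p` is an admissible family of sampling probabilities (with constant `C`) for the scores `l`. -/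
def Admissible (C : ℝ) {n : ℕ} (d : ℕ) (ε : ℝ) (l p : Fin n → ℝ) : Prop :=
  ∀ i, 0 ≤ p i ∧ p i ≤ 1 ∧ min 1 (C * d * (ε ^ 2)⁻¹ * Real.log (1 / ε) * l i) ≤ p i

/-- The law of the random weight vector: independently over `i`, `wᵢ = 1 / pᵢ` with probability
`pᵢ` and `wᵢ = 0` with probability `1 - pᵢ`. -/
def weightLaw {n : ℕ} (p : Fin n → ℝ) : Measure (Fin n → ℝ) :=
  Measure.pi fun i =>
    ENNReal.ofReal (p i) • Measure.dirac (1 / p i) + ENNReal.ofReal (1 - p i) • Measure.dirac 0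

/-- `x` minimizes `‖A x - b‖_{G,w}` up to the factor `c` (exactly, if `c = 1`). -/
def IsMinimizer (G : ℝ → ℝ) {n d : ℕ} (A : Matrix (Fin n) (Fin d) ℝ) (b w : Fin n → ℝ) (c : ℝ)
    (x : Fin d → ℝ) : Prop :=
  ∀ z : Fin d → ℝ,
    weightedOrliczNorm G w (A *ᵥ x - b) ≤ c * weightedOrliczNorm G w (A *ᵥ z - b)

/-- `x` is a `(1 + ε)`-approximate solution of `min_x ‖A x - b‖_G`. -/
def IsApproxSolution (G : ℝ → ℝ) {n d : ℕ} (A : Matrix (Fin n) (Fin d) ℝ) (b : Fin n → ℝ) (ε : ℝ)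
    (x : Fin d → ℝ) : Prop :=
  ∀ z : Fin d → ℝ, orliczNorm G (A *ᵥ x - b) ≤ (1 + ε) * orliczNorm G (A *ᵥ z - b)

/-! ## Randomized real RAM

A program works on finitely many two-dimensional integer and real arrays. Every node of an
expression and every assignment costs one step; indices can be added and subtracted, reals can be
added, subtracted, multiplied, divided, compared, square roots can be taken and `G` can be
evaluated. There is no rounding operation and no real constant. Random numbers are read, one after
the other, from a tape of independent uniform numbers in `[0,1]`. -/

namespace RealRAM

/-- Memory and the position of the random tape. -/
structure State where
  int : ℕ → ℕ → ℕ → ℕ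
  real : ℕ → ℕ → ℕ → ℝ
  pos : ℕ

/-- Integer (index) expressions. -/
inductive IExp where
  | lit (k : ℕ)
  | get (a : ℕ) (i j : IExp)
  | add (e f : IExp)
  | sub (e f : IExp)

/-- Real expressions. -/
inductive RExp where
  | ofInt (e : IExp)
  | get (a : ℕ) (i j : IExp)
  | add (e f : RExp)
  | sub (e f : RExp)
  | mul (e f : RExp)
  | div (e f : RExp)
  | sqrt (e : RExp)
  | evalG (e : RExp)

/-- Tests. -/
inductive BExp where
  | ilt (e f : IExp)
  | rlt (e f : RExp)
  | not (t : BExp)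
  | and (t u : BExp)

/-- Programs. -/
inductive Cmd where
  | skip
  | iset (a : ℕ) (i j : IExp) (e : IExp)
  | rset (a : ℕ) (i j : IExp) (e : RExp)
  | rand (a : ℕ) (i j : IExp)
  | seq (c c' : Cmd)
  | ite (t : BExp) (c c' : Cmd)
  | loop (t : BExp) (c : Cmd)

def IExp.eval (σ : State) : IExp → ℕ
  | .lit k => k
  | .get a i j => σ.int a (i.eval σ) (j.eval σ)
  | .add e f => e.eval σ + f.eval σ
  | .sub e f => e.eval σ - f.eval σ

def IExp.cost : IExp → ℕ
  | .lit _ => 1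
  | .get _ i j => i.cost + j.cost + 1
  | .add e f => e.cost + f.cost + 1
  | .sub e f => e.cost + f.cost + 1

def RExp.eval (G : ℝ → ℝ) (σ : State) : RExp → ℝ
  | .ofInt e => (e.eval σ : ℝ)
  | .get a i j => σ.real a (i.eval σ) (j.eval σ)
  | .add e f => e.eval G σ + f.eval G σ
  | .sub e f => e.eval G σ - f.eval G σ
  | .mul e f => e.eval G σ * f.eval G σ
  | .div e f => e.eval G σ / f.eval G σ
  | .sqrt e => Real.sqrt (e.eval G σ)
  | .evalG e => G (e.eval G σ)

def RExp.cost : RExp → ℕ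
  | .ofInt e => e.cost + 1
  | .get _ i j => i.cost + j.cost + 1
  | .add e f => e.cost + f.cost + 1
  | .sub e f => e.cost + f.cost + 1
  | .mul e f => e.cost + f.cost + 1
  | .div e f => e.cost + f.cost + 1
  | .sqrt e => e.cost + 1
  | .evalG e => e.cost + 1

def BExp.holds (G : ℝ → ℝ) (σ : State) : BExp → Prop
  | .ilt e f => e.eval σ < f.eval σ
  | .rlt e f => e.eval G σ < f.eval G σ
  | .not t => ¬ t.holds G σ
  | .and t u => t.holds G σ ∧ u.holds G σ

def BExp.cost : BExp → ℕ
  | .ilt e f => e.cost + f.cost + 1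
  | .rlt e f => e.cost + f.cost + 1
  | .not t => t.cost + 1
  | .and t u => t.cost + u.cost + 1

def State.setInt (σ : State) (a i j v : ℕ) : State :=
  { σ with int := fun a' i' j' => if a' = a ∧ i' = i ∧ j' = j then v else σ.int a' i' j' }

open Classical in
def State.setReal (σ : State) (a i j : ℕ) (v : ℝ) : State :=
  { σ with real := fun a' i' j' => if a' = a ∧ i' = i ∧ j' = j then v else σ.real a' i' j' }

/-- A random tape. -/
abbrev Tape : Type := ℕ → unitInterval

/-- The law of the random tape: independent uniform numbers in `[0,1]`. -/
def tapeLaw : Measure Tape := Measure.infinitePi fun _ : ℕ => (volume : Measure unitInterval)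

/-- `Exec G ω c σ σ' t`: with oracle `G` and random tape `ω`, the program `c` started in the state
`σ` halts in the state `σ'` after exactly `t` steps. -/
inductive Exec (G : ℝ → ℝ) (ω : Tape) : Cmd → State → State → ℕ → Prop
  | skip (σ : State) : Exec G ω .skip σ σ 1
  | iset (σ : State) (a : ℕ) (i j e : IExp) :
      Exec G ω (.iset a i j e) σ (σ.setInt a (i.eval σ) (j.eval σ) (e.eval σ))
        (i.cost + j.cost + e.cost + 1)
  | rset (σ : State) (a : ℕ) (i j : IExp) (e : RExp) :
      Exec G ω (.rset a i j e) σ (σ.setReal a (i.eval σ) (j.eval σ) (e.eval G σ))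
        (i.cost + j.cost + e.cost + 1)
  | rand (σ : State) (a : ℕ) (i j : IExp) :
      Exec G ω (.rand a i j) σ
        { σ.setReal a (i.eval σ) (j.eval σ) (ω σ.pos : ℝ) with pos := σ.pos + 1 }
        (i.cost + j.cost + 1)
  | seq {c c' : Cmd} {σ σ' σ'' : State} {t t' : ℕ} :
      Exec G ω c σ σ' t → Exec G ω c' σ' σ'' t' → Exec G ω (.seq c c') σ σ'' (t + t')
  | ite_true {u : BExp} {c c' : Cmd} {σ σ' : State} {t : ℕ} :
      u.holds G σ → Exec G ω c σ σ' t → Exec G ω (.ite u c c') σ σ' (u.cost + t)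
  | ite_false {u : BExp} {c c' : Cmd} {σ σ' : State} {t : ℕ} :
      ¬ u.holds G σ → Exec G ω c' σ σ' t → Exec G ω (.ite u c c') σ σ' (u.cost + t)
  | loop_done {u : BExp} {c : Cmd} {σ : State} :
      ¬ u.holds G σ → Exec G ω (.loop u c) σ σ u.cost
  | loop_step {u : BExp} {c : Cmd} {σ σ' σ'' : State} {t t' : ℕ} :
      u.holds G σ → Exec G ω c σ σ' t → Exec G ω (.loop u c) σ' σ'' t' →
      Exec G ω (.loop u c) σ σ'' (u.cost + t + t')

/-- The state stores the matrix `M` in compressed sparse row format: the non-zero entries of row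
`i` are `real 0 k 0`, in the columns `int 3 k 0`, for `int 2 i 0 ≤ k < int 2 (i + 1) 0`. -/
structure StoresSparse (σ : State) {n m : ℕ} (M : Matrix (Fin n) (Fin m) ℝ) : Prop where
  start : σ.int 2 0 0 = 0
  mono : ∀ i : Fin n, σ.int 2 i 0 ≤ σ.int 2 ((i : ℕ) + 1) 0
  cols : ∀ i : Fin n, Set.BijOn (fun k => σ.int 3 k 0)
    (Set.Ico (σ.int 2 i 0) (σ.int 2 ((i : ℕ) + 1) 0)) {c | ∃ j : Fin m, (j : ℕ) = c ∧ M i j ≠ 0}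
  vals : ∀ (i : Fin n) (j : Fin m), ∀ k ∈ Set.Ico (σ.int 2 i 0) (σ.int 2 ((i : ℕ) + 1) 0),
    σ.int 3 k 0 = j → σ.real 0 k 0 = M i j

/-- The state stores the input data `n`, `d`, `Ā`, `κ`, `ε`, `CG` and the matrix `R`; nothing is
said about the other cells. -/
structure Stores (σ : State) {n d : ℕ} (A : Matrix (Fin n) (Fin d) ℝ) (b : Fin n → ℝ)
    (κ ε CG : ℝ) (R : Matrix (Fin (d + 1)) (Fin (d + 1)) ℝ) : Prop where
  rows : σ.int 0 0 0 = n
  dim : σ.int 1 0 0 = d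
  data : StoresSparse σ (augment A b)
  kappa : σ.real 1 0 0 = κ
  eps : σ.real 2 0 0 = ε
  growth : σ.real 3 0 0 = CG
  factor : ∀ i j : Fin (d + 1), σ.real 4 i j = R i j

/-- The vectors `u`, `p`, `w`, `x` are read off from the real arrays `5`, `6`, `7`, `8`. -/
def State.vec (σ : State) (a n : ℕ) : Fin n → ℝ := fun i => σ.real a i 0

/-- The outcome of drawing the weights with probabilities `p` from the tape at position `q`: the
`i`-th fresh random number decides whether `wᵢ = 1 / pᵢ` or `wᵢ = 0`. -/
def drawWeights (ω : Tape) (q : ℕ) {n : ℕ} (p : Fin n → ℝ) : Fin n → ℝ :=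
  fun i => if (ω (q + i) : ℝ) < p i then 1 / p i else 0

/-- A successful run, on the tape `ω`, of the algorithm with program `qr` for Step 1 (leading from
`σ₀`, which may hold the embedding matrix in any format, to `σ₁` in time `T`), `lev` for Step 2, `samp` for Step 3 and `solve` for Step 4. -/
def SuccessfulRun (G : ℝ → ℝ) (CG : ℝ) {n d : ℕ} (A : Matrix (Fin n) (Fin d) ℝ) (b : Fin n → ℝ)
    (R : Matrix (Fin (d + 1)) (Fin (d + 1)) ℝ) (κ ε C K : ℝ) (k : ℕ)
    (qr lev samp solve : Cmd) (σ₀ σ₁ : State) (T : ℕ) (ω : Tape) : Prop :=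
  ∃ (σ₂ σ₃ σ₄ : State) (t₂ t₃ t₄ t : ℕ),
    Exec G ω (.seq qr (.seq lev (.seq samp solve))) σ₀ σ₄ t ∧
    -- Step 2: constant factor estimates `u` of the leverage scores, and sampling probabilities `p`
    Exec G ω lev σ₁ σ₂ t₂ ∧
    (∀ i, leverage G A b R i ≤ K * CG * σ₂.vec 5 n i ∧
      σ₂.vec 5 n i ≤ K * CG * leverage G A b R i) ∧
    Admissible C d ε (leverage G A b R) (σ₂.vec 6 n) ∧
    -- Step 3: sampling of the weights `w`
    Exec G ω samp σ₂ σ₃ t₃ ∧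
    σ₃.vec 7 n = drawWeights ω σ₂.pos (σ₂.vec 6 n) ∧
    -- Step 4: solving the weighted problem to relative accuracy `ε / 4`
    Exec G ω solve σ₃ σ₄ t₄ ∧
    IsMinimizer G A b (σ₃.vec 7 n) (1 + ε / 4) (σ₄.vec 8 d) ∧
    -- the output is a `(1 + ε)`-approximate solution, and the total running time is bounded
    IsApproxSolution G A b ε (σ₄.vec 8 d) ∧
    (t : ℝ) ≤ T + K * (nnz A + n : ℕ) * (1 + Real.log (nnz A + n : ℕ)) ^ k
      + K * (CG * d * κ / ε) ^ k

end RealRAM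

end

/-!
**Correctness.** Let `U = Ā R⁻¹` be the whitened matrix. Since `Q` is orthonormal, the embedding
bounds on the sketching matrix become `‖y‖₂ ≤ ‖U y‖_G ≤ κ ‖y‖₂` (`IsInstance.whitened_lower`,
`IsInstance.whitened_upper`). So on the unit sphere of `‖U ·‖_G`, where `∑ G((U z)ᵢ) = 1`, the score
`G(‖Uᵢ‖₂)` of a row bounds its contribution to this sum, and a row is either kept with certainty
or has a probability that is large compared with its contribution. Bernstein's inequality
(`weightLaw_bernstein`) shows that the weighted sum at a fixed `z` deviates from `1` by more than
a multiple of `ε` with probability `exp(-Ω(C d log(1/ε)))`. The volume argument gives a net of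
`ε^{-O(d)}` points of the sphere (`exists_net`), and a seminorm that is close to the norm on a net is
close to it everywhere (`seminorm_close_of_net`). Hence the weighted norm approximates the norm on
the whole column space up to a factor `1 ± ε/16` (`exists_embedding_net`), and minimizers, even
approximate ones, carry over (`IsInstance.isApproxSolution`).

**Scores and probabilities.** The factor `R` is inverted by back substitution. The row norms of `U`
are estimated without forming `U`, by multiplying `R⁻¹` with `O(log n)` random sign vectors and then
multiplying each sparse row of `Ā` with the result. Exponential moments, obtained by averaging over
one sign at a time (`sum_exp_sq_le`, `sum_exp_neg_sq_le`), show that all estimates are correct up to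
a factor `2` for all but a small fraction of the sign matrices (`card_not_forall_sketchGood_le`).
The growth condition turns this into estimates of the scores up to a factor `4 C_G`. As the machine
has no logarithm, `log(1/ε)` is replaced by `1/ε` in the probabilities (`RealRAM.admissible_sketchProb`);
the expected number of sampled rows is still polynomial in `C_G d κ / ε` (`RealRAM.sum_sketchProb_le`).
The probabilities depend on the signs, but signs and weights are read from disjoint parts of the
tape, so one can condition on the signs (`RealRAM.tapeLaw_two_phase`).

**Solving the weighted problem.** In the coordinates `R (x, -1)` the residuals are `U` times a vector
with fixed last coordinate `-r`, and the objective is comparable to the Euclidean norm. It is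
minimized by a descent with steps of fixed length on the sampled rows. The level is lowered as soon as
the current point attains it, and otherwise a step is made against a substitute of the
subgradient, which is built from difference quotients of `G` (`relSlope`), because only evaluations
of `G` are available. As long as the level is not close to the value of a comparison point, every
step lowers a potential, consisting of the squared distance to that point and the level, by one.
So `2 ^ 21 κ ^ 4 / ε ^ 2` steps suffice (`DescentParams.Valid.objective_best_le`).

**Running time.** Programs are verified with triples `RealRAM.Runs`, which bound the number of steps
and come with the frame rule that a program changes only the arrays it writes to
(`RealRAM.Exec.frame`). The run succeeds, within the time bound (`RealRAM.time_bound_le`), whenever the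
signs preserve the row norms, the weights give an embedding and not too many of them are
non-zero (`RealRAM.successfulRun_of_good`). These three events fail with probability at most `1/50`,
`1/32` and `1/100` (`RealRAM.tapeLaw_not_successfulRun_le`).
-/

noncomputable section

/-! ### Orlicz functions and norms -/

namespace IsOrliczFunction

variable {G : ℝ → ℝ} {CG : ℝ}

lemma map_abs (hG : IsOrliczFunction G CG) (x : ℝ) : G |x| = G x := by
  rcases abs_choice x with h | h
  · rw [h]
  · rw [h, ← hG.even]

lemma mono (hG : IsOrliczFunction G CG) {x y : ℝ} (hx : 0 ≤ x) (hxy : x ≤ y) : G x ≤ G y :=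
  hG.strictMonoOn.monotoneOn hx (hx.trans hxy : (0 : ℝ) ≤ y) hxy

lemma mono_abs (hG : IsOrliczFunction G CG) {x y : ℝ} (hxy : |x| ≤ |y|) : G x ≤ G y := by
  rw [← hG.map_abs x, ← hG.map_abs y]
  exact hG.mono (abs_nonneg x) hxy

lemma pos (hG : IsOrliczFunction G CG) {x : ℝ} (hx : 0 < x) : 0 < G x := by
  rw [← hG.map_zero]
  exact hG.strictMonoOn (le_refl (0 : ℝ)) hx.le hx

/-- Convexity on `[0, ∞)`, monotonicity and evenness give convexity on the whole line. -/
lemma convexOn_univ (hG : IsOrliczFunction G CG) : ConvexOn ℝ Set.univ G := by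
  refine ⟨convex_univ, fun x _ y _ a b ha hb hab => ?_⟩
  have h1 : G (a • x + b • y) ≤ G (a • |x| + b • |y|) := by
    apply hG.mono_abs
    have h : 0 ≤ a * |x| + b * |y| := by positivity
    simp only [smul_eq_mul]
    rw [abs_of_nonneg h]
    calc |a * x + b * y| ≤ |a * x| + |b * y| := abs_add_le _ _
      _ = a * |x| + b * |y| := by rw [abs_mul, abs_mul, abs_of_nonneg ha, abs_of_nonneg hb]
  have h2 := hG.convexOn.2 (abs_nonneg x : (0 : ℝ) ≤ |x|) (abs_nonneg y : (0 : ℝ) ≤ |y|) ha hb hab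
  rw [hG.map_abs, hG.map_abs] at h2
  exact h1.trans h2

lemma continuous (hG : IsOrliczFunction G CG) : Continuous G := by
  have := hG.convexOn_univ.continuousOn isOpen_univ
  exact continuousOn_univ.mp this

lemma map_mul_le (hG : IsOrliczFunction G CG) {t : ℝ} (h0 : 0 ≤ t) (h1 : t ≤ 1) (x : ℝ) :
    G (t * x) ≤ t * G x := by
  have h := hG.convexOn_univ.2 (Set.mem_univ x) (Set.mem_univ 0) h0 (sub_nonneg.2 h1) (by ring)
  simpa [hG.map_zero] using h

/-- A constant below `1` is impossible, since convexity forces at least linear growth. -/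
lemma one_le_const (hG : IsOrliczFunction G CG) : 1 ≤ CG := by
  by_contra! hlt
  have h0 := hG.const_pos
  have hp := hG.pos one_pos
  -- a point strictly between `1` and `CG⁻¹` violates the growth bound
  obtain ⟨s, hs1, hs⟩ := exists_between ((one_lt_inv₀ h0).2 hlt)
  have hs0 : 0 < s := by linarith
  have h3 := hG.growth 1 s one_pos hs1
  rw [div_le_iff₀ hp, div_one] at h3
  have h4 := hG.map_mul_le (t := s⁻¹) (by positivity) (inv_le_one_of_one_le₀ hs1.le) s
  rw [inv_mul_cancel₀ hs0.ne'] at h4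
  have h5 : s * G 1 ≤ G s := by
    have := mul_le_mul_of_nonneg_left h4 hs0.le
    rwa [← mul_assoc, mul_inv_cancel₀ hs0.ne', one_mul] at this
  have h6 : s ≤ CG * s ^ 2 := le_of_mul_le_mul_right (h5.trans h3) hp
  have h7 : s * CG < 1 := by rwa [← lt_div_iff₀ h0, one_div]
  nlinarith

/-- The quadratic growth bound, without restrictions on the arguments. -/
lemma map_mul_le_sq (hG : IsOrliczFunction G CG) {c : ℝ} (hc : 1 ≤ c) (x : ℝ) :
    G (c * x) ≤ CG * c ^ 2 * G x := by
  have h1 := hG.one_le_const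
  rcases eq_or_ne x 0 with rfl | hx
  · simp [hG.map_zero]
  rcases hc.eq_or_lt with rfl | hc
  · have := hG.nonneg x
    simp only [one_mul, one_pow, mul_one]
    nlinarith
  have hx' : 0 < |x| := abs_pos.2 hx
  have h := hG.growth |x| (c * |x|) hx' (by nlinarith)
  rw [div_le_iff₀ (hG.pos hx'), mul_div_assoc, div_self hx'.ne', mul_one, hG.map_abs] at h
  rwa [← hG.map_abs (c * x), abs_mul, abs_of_pos (by linarith : 0 < c)]

/-- The largest of the entries dominates their average. -/
lemma map_sum_abs_le (hG : IsOrliczFunction G CG) {m : ℕ} (v : Fin m → ℝ) :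
    G (∑ j, |v j|) ≤ ∑ j, G (m * v j) := by
  rcases Nat.eq_zero_or_pos m with rfl | hm
  · simp [hG.map_zero]
  obtain ⟨j, -, hj⟩ := Finset.exists_max_image (Finset.univ : Finset (Fin m)) (fun j => |v j|)
    ⟨⟨0, hm⟩, Finset.mem_univ _⟩
  calc G (∑ j, |v j|) ≤ G (m * v j) := by
        apply hG.mono_abs
        rw [abs_of_nonneg (Finset.sum_nonneg fun j _ => abs_nonneg _), abs_mul, Nat.abs_cast]
        calc ∑ i, |v i| ≤ ∑ _i : Fin m, |v j| := Finset.sum_le_sum fun i hi => hj i hi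
          _ = m * |v j| := by simp
    _ ≤ ∑ j, G (m * v j) :=
        Finset.single_le_sum (f := fun j => G (m * v j)) (fun i _ => hG.nonneg _) (Finset.mem_univ j)

end IsOrliczFunction

/-- The sum `∑ wᵢ G(|yᵢ| / α)` whose level set at `1` defines the weighted Orlicz norm. -/
def orliczSum {n : ℕ} (G : ℝ → ℝ) (w y : Fin n → ℝ) (α : ℝ) : ℝ :=
  ∑ i, w i * G (|y i| / α)

section norm

variable {G : ℝ → ℝ} {CG : ℝ} {n : ℕ} {w y z : Fin n → ℝ} {α β c : ℝ}

lemma orliczSum_anti (hG : IsOrliczFunction G CG) (hw : 0 ≤ w) (hα : 0 < α) (h : α ≤ β) :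
    orliczSum G w y β ≤ orliczSum G w y α :=
  Finset.sum_le_sum fun i _ => mul_le_mul_of_nonneg_left
    (hG.mono (by have := hα.trans_le h; positivity)
      (div_le_div_of_nonneg_left (abs_nonneg _) hα h)) (hw i)

/-- By convexity, increasing the scale by a factor `c⁻¹ ≥ 1` decreases the sum by at least the
same factor. -/
lemma orliczSum_le_mul (hG : IsOrliczFunction G CG) (hw : 0 ≤ w) (hc0 : 0 < c) (hc : c ≤ 1) :
    orliczSum G w y α ≤ c * orliczSum G w y (c * α) := by
  rw [orliczSum, orliczSum, Finset.mul_sum]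
  refine Finset.sum_le_sum fun i _ => ?_
  have h := hG.map_mul_le hc0.le hc (|y i| / (c * α))
  have e : c * (|y i| / (c * α)) = |y i| / α := by
    rw [mul_div_assoc', mul_div_mul_left _ _ hc0.ne']
  rw [e] at h
  calc w i * G (|y i| / α) ≤ w i * (c * G (|y i| / (c * α))) := mul_le_mul_of_nonneg_left h (hw i)
    _ = _ := by ring

lemma orliczSum_smul {t : ℝ} (ht : t ≠ 0) :
    orliczSum G w (t • y) (|t| * α) = orliczSum G w y α := by
  refine Finset.sum_congr rfl fun i _ => ?_
  rw [Pi.smul_apply, smul_eq_mul, abs_mul, mul_div_mul_left _ _ (abs_ne_zero.2 ht)]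

lemma orliczSum_eq_zero (hG : IsOrliczFunction G CG) (h : ∀ i, w i * |y i| = 0) :
    orliczSum G w y α = 0 := by
  refine Finset.sum_eq_zero fun i _ => ?_
  rcases mul_eq_zero.1 (h i) with h | h <;> simp [h, hG.map_zero]

lemma weightedOrliczNorm_nonneg : 0 ≤ weightedOrliczNorm G w y :=
  Real.sInf_nonneg fun _ h => h.1.le

lemma exists_orliczSum_eq_one (hG : IsOrliczFunction G CG) (hw : 0 ≤ w)
    (h : ∃ i, w i * |y i| ≠ 0) : ∃ α, 0 < α ∧ orliczSum G w y α = 1 := by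
  obtain ⟨i, hi⟩ := h
  have hwi : 0 < w i := (hw i).lt_of_ne (fun h => hi (by rw [← h]; simp))
  have hyi : 0 < |y i| := (abs_nonneg _).lt_of_ne (fun h => hi (by rw [← h]; simp))
  -- in terms of the inverse scale `t = α⁻¹` the sum is continuous on `[0, ∞)`
  set F : ℝ → ℝ := fun t => ∑ i, w i * G (|y i| * t) with hF
  have hcont : Continuous F := by
    have := hG.continuous
    fun_prop
  have h0 : F 0 = 0 := by simp [hF, hG.map_zero]
  set a := w i * G |y i| with ha
  have hapos : 0 < a := mul_pos hwi (hG.pos hyi)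
  have hlow : ∀ t, 1 ≤ t → t * a ≤ F t := by
    intro t ht
    have h1 := hG.map_mul_le (t := t⁻¹) (by positivity) (inv_le_one_of_one_le₀ ht) (|y i| * t)
    have ht0 : t ≠ 0 := by positivity
    have e : t⁻¹ * (|y i| * t) = |y i| := by field_simp
    rw [e] at h1
    have h2 : t * a ≤ w i * G (|y i| * t) := by
      rw [ha]
      calc t * (w i * G |y i|) ≤ t * (w i * (t⁻¹ * G (|y i| * t))) := by gcongr
        _ = w i * G (|y i| * t) := by field_simp
    exact h2.trans (Finset.single_le_sum (f := fun i => w i * G (|y i| * t))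
      (fun i _ => mul_nonneg (hw i) (hG.nonneg _)) (Finset.mem_univ i))
  set t₁ := max 1 a⁻¹
  have h1 : 1 ≤ F t₁ := by
    refine le_trans ?_ (hlow t₁ (le_max_left _ _))
    calc (1 : ℝ) = a⁻¹ * a := by field_simp
      _ ≤ t₁ * a := by gcongr; exact le_max_right _ _
  have hmem : (1 : ℝ) ∈ Set.Icc (F 0) (F t₁) := ⟨by rw [h0]; norm_num, h1⟩
  obtain ⟨t, ht, hFt⟩ := intermediate_value_Icc (by positivity) hcont.continuousOn hmem
  have htpos : 0 < t := ht.1.lt_of_ne (by rintro rfl; rw [h0] at hFt; norm_num at hFt)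
  refine ⟨t⁻¹, by positivity, ?_⟩
  rw [← hFt]
  simp [orliczSum, hF]

lemma weightedOrliczNorm_eq_zero (hG : IsOrliczFunction G CG) (h : ∀ i, w i * |y i| = 0) :
    weightedOrliczNorm G w y = 0 := by
  have : {α : ℝ | 0 < α ∧ ∑ i, w i * G (|y i| / α) = 1} = ∅ := by
    ext α
    have := orliczSum_eq_zero (α := α) hG h
    rw [orliczSum] at this
    simp [this]
  rw [weightedOrliczNorm, this, Real.sInf_empty]

/-- The weighted Orlicz norm is the gauge of the sublevel set of `orliczSum` at level `1`. -/
lemma weightedOrliczNorm_le_iff (hG : IsOrliczFunction G CG) (hw : 0 ≤ w) (hα : 0 < α) :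
    weightedOrliczNorm G w y ≤ α ↔ orliczSum G w y α ≤ 1 := by
  by_cases h : ∀ i, w i * |y i| = 0
  · rw [weightedOrliczNorm_eq_zero hG h, orliczSum_eq_zero hG h]
    simp [hα.le]
  push Not at h
  obtain ⟨β, hβ, hβ1⟩ := exists_orliczSum_eq_one hG hw h
  have key : ∀ γ, 0 < γ → γ < β → 1 < orliczSum G w y γ := by
    intro γ hγ hlt
    have h1 := orliczSum_le_mul (y := y) (α := β) hG hw (div_pos hγ hβ) ((div_le_one hβ).2 hlt.le)
    rw [hβ1, div_mul_cancel₀ _ hβ.ne', div_mul_eq_mul_div, le_div_iff₀ hβ, one_mul] at h1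
    by_contra! h2
    have : γ * orliczSum G w y γ ≤ γ := by nlinarith
    linarith
  have hval : weightedOrliczNorm G w y = β := by
    have : {α : ℝ | 0 < α ∧ ∑ i, w i * G (|y i| / α) = 1} = {β} := by
      ext γ
      constructor
      · rintro ⟨hγ, hγ1⟩
        change orliczSum G w y γ = 1 at hγ1
        rcases lt_trichotomy γ β with hlt | heq | hgt
        · exact absurd hγ1 (key γ hγ hlt).ne'
        · exact heq
        · have h1 := orliczSum_le_mul (y := y) (α := γ) hG hw (div_pos hβ hγ)
            ((div_le_one hγ).2 hgt.le)
          rw [hγ1, div_mul_cancel₀ _ hγ.ne', hβ1, mul_one, le_div_iff₀ hγ] at h1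
          linarith
      · rintro rfl
        exact ⟨hβ, hβ1⟩
    rw [weightedOrliczNorm, this, csInf_singleton]
  rw [hval]
  constructor
  · intro hle
    exact (orliczSum_anti hG hw hβ hle).trans hβ1.le
  · intro hle
    by_contra! hlt
    exact absurd (key α hα hlt) (not_lt.2 hle)

/-- A nonnegative number is determined by its positive upper bounds. -/
lemma le_of_forall_pos_le {a b : ℝ} (hb : 0 ≤ b) (h : ∀ t, 0 < t → b ≤ t → a ≤ t) : a ≤ b := by
  refine le_of_forall_gt_imp_ge_of_dense fun t ht => h t (hb.trans_lt ht) ht.le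

lemma weightedOrliczNorm_smul_le (hG : IsOrliczFunction G CG) (hw : 0 ≤ w) {t : ℝ} (ht : t ≠ 0) :
    weightedOrliczNorm G w (t • y) ≤ |t| * weightedOrliczNorm G w y := by
  have ht' : 0 < |t| := abs_pos.2 ht
  refine le_of_forall_pos_le (mul_nonneg ht'.le weightedOrliczNorm_nonneg) fun s hs hle => ?_
  have hs' : 0 < s / |t| := div_pos hs ht'
  have h1 : weightedOrliczNorm G w y ≤ s / |t| := by
    rw [le_div_iff₀ ht', mul_comm]; exact hle
  rw [weightedOrliczNorm_le_iff hG hw hs'] at h1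
  rw [weightedOrliczNorm_le_iff hG hw hs, ← mul_div_cancel₀ s ht'.ne',
    orliczSum_smul ht]
  exact h1

lemma weightedOrliczNorm_zero (hG : IsOrliczFunction G CG) : weightedOrliczNorm G w 0 = 0 :=
  weightedOrliczNorm_eq_zero hG (by simp)

lemma weightedOrliczNorm_smul (hG : IsOrliczFunction G CG) (hw : 0 ≤ w) (t : ℝ) :
    weightedOrliczNorm G w (t • y) = |t| * weightedOrliczNorm G w y := by
  rcases eq_or_ne t 0 with rfl | ht
  · simp [weightedOrliczNorm_zero hG]
  refine le_antisymm (weightedOrliczNorm_smul_le hG hw ht) ?_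
  have h := weightedOrliczNorm_smul_le (y := t • y) hG hw (inv_ne_zero ht)
  rw [smul_smul, inv_mul_cancel₀ ht, one_smul, abs_inv] at h
  rwa [← le_inv_mul_iff₀ (abs_pos.2 ht)]

lemma weightedOrliczNorm_add_le (hG : IsOrliczFunction G CG) (hw : 0 ≤ w) :
    weightedOrliczNorm G w (y + z) ≤ weightedOrliczNorm G w y + weightedOrliczNorm G w z := by
  have aux : ∀ a b : ℝ, 0 < a → 0 < b → weightedOrliczNorm G w y ≤ a →
      weightedOrliczNorm G w z ≤ b → weightedOrliczNorm G w (y + z) ≤ a + b := by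
    intro a b ha hb hya hzb
    rw [weightedOrliczNorm_le_iff hG hw ha] at hya
    rw [weightedOrliczNorm_le_iff hG hw hb] at hzb
    rw [weightedOrliczNorm_le_iff hG hw (add_pos ha hb)]
    have hab : 0 < a + b := add_pos ha hb
    calc orliczSum G w (y + z) (a + b)
        ≤ ∑ i, (a / (a + b) * (w i * G (|y i| / a)) + b / (a + b) * (w i * G (|z i| / b))) := by
          refine Finset.sum_le_sum fun i _ => ?_
          have h1 := hG.convexOn_univ.2 (Set.mem_univ (|y i| / a)) (Set.mem_univ (|z i| / b))
            (by positivity : 0 ≤ a / (a + b)) (by positivity : 0 ≤ b / (a + b)) (by field_simp)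
          have h2 : G (|(y + z) i| / (a + b)) ≤
              G ((a / (a + b)) • (|y i| / a) + (b / (a + b)) • (|z i| / b)) := by
            apply hG.mono (by positivity)
            have e : (a / (a + b)) • (|y i| / a) + (b / (a + b)) • (|z i| / b)
                = (|y i| + |z i|) / (a + b) := by
              simp only [smul_eq_mul]; field_simp
            rw [e, Pi.add_apply]
            gcongr
            exact abs_add_le _ _
          have h3 := mul_le_mul_of_nonneg_left (h2.trans h1) (hw i)
          simp only [smul_eq_mul] at h3
          linarith
      _ = a / (a + b) * orliczSum G w y a + b / (a + b) * orliczSum G w z b := by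
          rw [Finset.sum_add_distrib, ← Finset.mul_sum, ← Finset.mul_sum]; rfl
      _ ≤ a / (a + b) * 1 + b / (a + b) * 1 := by gcongr
      _ = 1 := by field_simp
  refine le_of_forall_pos_le_add fun e he => ?_
  have := aux (weightedOrliczNorm G w y + e / 2) (weightedOrliczNorm G w z + e / 2)
    (add_pos_of_nonneg_of_pos weightedOrliczNorm_nonneg (by positivity))
    (add_pos_of_nonneg_of_pos weightedOrliczNorm_nonneg (by positivity))
    (by linarith) (by linarith)
  linarith

/-- If the norm is at most `c α` with `c ≤ 1`, then the sum at scale `α` is at most `c`. -/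
lemma orliczSum_le_of_norm_le (hG : IsOrliczFunction G CG) (hw : 0 ≤ w) (hα : 0 < α) (hc0 : 0 < c)
    (hc : c ≤ 1) (h : weightedOrliczNorm G w y ≤ c * α) : orliczSum G w y α ≤ c := by
  rw [weightedOrliczNorm_le_iff hG hw (mul_pos hc0 hα)] at h
  calc orliczSum G w y α ≤ c * orliczSum G w y (c * α) := orliczSum_le_mul hG hw hc0 hc
    _ ≤ c := by nlinarith

lemma norm_le_of_orliczSum_le (hG : IsOrliczFunction G CG) (hw : 0 ≤ w) (hα : 0 < α) (hc : 1 ≤ c)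
    (h : orliczSum G w y α ≤ c) : weightedOrliczNorm G w y ≤ c * α := by
  have hc0 : 0 < c := by linarith
  rw [weightedOrliczNorm_le_iff hG hw (mul_pos hc0 hα)]
  have h1 := orliczSum_le_mul (y := y) (α := c * α) hG hw (inv_pos.2 hc0)
    (inv_le_one_of_one_le₀ hc)
  rw [inv_mul_cancel_left₀ hc0.ne'] at h1
  calc _ ≤ c⁻¹ * orliczSum G w y α := h1
    _ ≤ c⁻¹ * c := by gcongr
    _ = 1 := inv_mul_cancel₀ hc0.ne'

lemma le_norm_of_le_orliczSum (hG : IsOrliczFunction G CG) (hw : 0 ≤ w) (hα : 0 < α)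
    (hc : c ≤ 1) (h : c ≤ orliczSum G w y α) : c * α ≤ weightedOrliczNorm G w y := by
  by_contra! hlt
  have hN : 0 ≤ weightedOrliczNorm G w y := weightedOrliczNorm_nonneg
  obtain ⟨s, hs1, hs2⟩ := exists_between hlt
  have hs0 : 0 < s / α := div_pos (hN.trans_lt hs1) hα
  have hs3 : s / α < c := (div_lt_iff₀ hα).2 hs2
  have := orliczSum_le_of_norm_le (y := y) hG hw hα hs0 (hs3.le.trans hc)
    (by rw [div_mul_cancel₀ _ hα.ne']; exact hs1.le)
  linarith

lemma orliczNorm_eq_zero_iff (hG : IsOrliczFunction G CG) : orliczNorm G y = 0 ↔ y = 0 := by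
  refine ⟨fun h => ?_, fun h => by rw [h]; exact weightedOrliczNorm_zero hG⟩
  by_contra hy
  obtain ⟨i, hi⟩ := Function.ne_iff.1 hy
  obtain ⟨α, hα, hα1⟩ := exists_orliczSum_eq_one (w := fun _ => 1) hG (fun _ => zero_le_one)
    ⟨i, by simpa using hi⟩
  have := le_norm_of_le_orliczSum hG (fun _ => zero_le_one) hα le_rfl hα1.ge
  rw [orliczNorm] at h
  linarith

end norm

/-! ### Nets for norms -/

section net

variable {D : ℕ}

lemma seminorm_continuous (p : Seminorm ℝ (Fin D → ℝ)) : Continuous p := by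
  have := p.convexOn.continuousOn isOpen_univ
  exact continuousOn_univ.mp this

open scoped Pointwise in
lemma volume_seminorm_ball (p : Seminorm ℝ (Fin D → ℝ)) (z : Fin D → ℝ) {r : ℝ} (hr : 0 < r) :
    volume (p.ball z r) = ENNReal.ofReal (r ^ D) * volume (p.ball 0 1) := by
  have h1 : p.ball z r = z +ᵥ r • p.ball 0 1 := by
    rw [Seminorm.smul_ball_zero hr.ne', Seminorm.vadd_ball]
    simp [abs_of_pos hr]
  rw [h1, measure_vadd, Measure.addHaar_smul]
  simp [abs_of_pos hr]

/-- The volume bound for separated sets in the unit ball of a norm. -/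
lemma card_mul_le_of_separated (p : Seminorm ℝ (Fin D → ℝ)) (hp : ∀ y, ‖y‖ ≤ p y) {θ : ℝ}
    (hθ : 0 < θ) (T : Finset (Fin D → ℝ)) (h1 : ∀ z ∈ T, p z ≤ 1)
    (hsep : ∀ z ∈ T, ∀ z' ∈ T, z ≠ z' → θ < p (z - z')) :
    (T.card : ℝ) * (θ / 2) ^ D ≤ (1 + θ / 2) ^ D := by
  have hopen : IsOpen (p.ball 0 1) := by
    have : p.ball 0 1 = p ⁻¹' Set.Iio 1 := by ext; simp [Seminorm.mem_ball]
    rw [this]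
    exact isOpen_Iio.preimage (seminorm_continuous p)
  have hpos : volume (p.ball 0 1) ≠ 0 :=
    (hopen.measure_pos volume ⟨0, by simp [Seminorm.mem_ball]⟩).ne'
  have hfin : volume (p.ball 0 1) ≠ ⊤ := by
    have hsub : p.ball 0 1 ⊆ Metric.ball 0 1 := by
      intro y hy
      rw [Seminorm.mem_ball, sub_zero] at hy
      rw [mem_ball_zero_iff]
      exact (hp y).trans_lt hy
    exact ((measure_mono hsub).trans_lt measure_ball_lt_top).ne
  have hmeas : ∀ z ∈ T, MeasurableSet (p.ball z (θ / 2)) := fun z _ => by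
    have : p.ball z (θ / 2) = (fun y => p (y - z)) ⁻¹' Set.Iio (θ / 2) := by
      ext; simp [Seminorm.mem_ball]
    rw [this]
    exact (isOpen_Iio.preimage ((seminorm_continuous p).comp (by fun_prop))).measurableSet
  have hdisj : (T : Set (Fin D → ℝ)).PairwiseDisjoint fun z => p.ball z (θ / 2) := by
    intro z hz z' hz' hne
    rw [Function.onFun, Set.disjoint_left]
    intro y hy hy'
    rw [Seminorm.mem_ball] at hy hy'
    have h2 := hsep z hz z' hz' hne
    have h3 : p (z - z') ≤ p (y - z) + p (y - z') := by
      have := map_sub_le_add p (y - z') (y - z)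
      rw [show y - z' - (y - z) = z - z' by abel] at this
      linarith
    linarith
  have hsub : (⋃ z ∈ T, p.ball z (θ / 2)) ⊆ p.ball 0 (1 + θ / 2) := by
    intro y hy
    simp only [Set.mem_iUnion, exists_prop] at hy
    obtain ⟨z, hz, hy⟩ := hy
    rw [Seminorm.mem_ball] at hy ⊢
    have := map_add_le_add p (y - z) z
    rw [sub_add_cancel] at this
    have := h1 z hz
    rw [sub_zero]
    linarith
  have h2 := measure_mono (μ := volume) hsub
  rw [measure_biUnion_finset hdisj hmeas, volume_seminorm_ball p _ (by positivity),
    Finset.sum_congr rfl fun z _ => volume_seminorm_ball p z (by positivity : 0 < θ / 2),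
    Finset.sum_const, nsmul_eq_mul, ← mul_assoc,
    ENNReal.mul_le_mul_iff_left hpos hfin, ← ENNReal.ofReal_natCast,
    ← ENNReal.ofReal_mul (by positivity), ENNReal.ofReal_le_ofReal_iff (by positivity)] at h2
  exact h2

/-- The unit sphere of a norm on `ℝ^D` has a `θ`-net, with respect to the norm itself, of at most
`(3 / θ) ^ D` points. -/
lemma exists_net (p : Seminorm ℝ (Fin D → ℝ)) (hp : ∀ y, ‖y‖ ≤ p y) {θ : ℝ}
    (hθ : 0 < θ) (hθ1 : θ ≤ 1) : ∃ T : Finset (Fin D → ℝ), (T.card : ℝ) ≤ (3 / θ) ^ D ∧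
      (∀ z ∈ T, p z = 1) ∧ ∀ y, p y = 1 → ∃ z ∈ T, p (y - z) ≤ θ := by
  classical
  let P : Finset (Fin D → ℝ) → Prop := fun T => (∀ z ∈ T, p z = 1) ∧
    ∀ z ∈ T, ∀ z' ∈ T, z ≠ z' → θ < p (z - z')
  have hcard : ∀ T, P T → (T.card : ℝ) ≤ (3 / θ) ^ D := by
    intro T hT
    have h1 := card_mul_le_of_separated p hp hθ T (fun z hz => (hT.1 z hz).le) hT.2
    rw [← le_div_iff₀ (by positivity), ← div_pow] at h1
    refine h1.trans (pow_le_pow_left₀ (by positivity) ?_ _)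
    rw [div_le_div_iff₀ (by positivity) hθ]
    nlinarith
  have hne : ({m | ∃ T, P T ∧ T.card = m} : Set ℕ).Nonempty := ⟨0, ∅, by simp [P], rfl⟩
  have hbdd : BddAbove ({m | ∃ T, P T ∧ T.card = m} : Set ℕ) := by
    refine ⟨⌊(3 / θ) ^ D⌋₊, ?_⟩
    rintro m ⟨T, hT, rfl⟩
    exact Nat.le_floor (hcard T hT)
  -- a separated subset of maximal cardinality is a net
  obtain ⟨T, hT, hTc⟩ := Nat.sSup_mem hne hbdd
  refine ⟨T, hcard T hT, hT.1, fun y hy => ?_⟩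
  by_contra! hcon
  have hyT : y ∉ T := fun h => by
    have := hcon y h
    rw [sub_self, map_zero] at this
    linarith
  have hins : P (insert y T) := by
    refine ⟨fun z hz => ?_, fun z hz z' hz' hne => ?_⟩
    · rcases Finset.mem_insert.1 hz with rfl | hz
      exacts [hy, hT.1 z hz]
    · rcases Finset.mem_insert.1 hz with h | h <;> rcases Finset.mem_insert.1 hz' with h' | h'
      · exact absurd (h.trans h'.symm) hne
      · rw [h]; exact hcon z' h'
      · rw [h', map_sub_rev]; exact hcon z h
      · exact hT.2 z h z' h' hne
  have := le_csSup hbdd ⟨insert y T, hins, rfl⟩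
  rw [← hTc, Finset.card_insert_of_notMem hyT] at this
  omega

/-- A seminorm which is close to the norm `p` on an `η`-net of its unit sphere is close to it
everywhere. -/
lemma seminorm_close_of_net (p q : Seminorm ℝ (Fin D → ℝ)) (hp : ∀ y, ‖y‖ ≤ p y) {η : ℝ}
    (hη : 0 < η) (hη1 : η ≤ 1 / 3) (T : Finset (Fin D → ℝ))
    (hT : ∀ y, p y = 1 → ∃ z ∈ T, p (y - z) ≤ η)
    (hlo : ∀ z ∈ T, 1 - η ≤ q z) (hhi : ∀ z ∈ T, q z ≤ 1 + η) (y : Fin D → ℝ) :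
    (1 - 3 * η) * p y ≤ q y ∧ q y ≤ (1 + 3 * η) * p y := by
  -- `q` is bounded by some multiple of `p`
  obtain ⟨M, hM⟩ : ∃ M : ℝ, ∀ y, q y ≤ M * p y := by
    refine ⟨∑ j, q (Pi.single j 1), fun y => ?_⟩
    have h1 : y = ∑ j, y j • (Pi.single j 1 : Fin D → ℝ) := by
      ext i
      simp [Finset.sum_apply, Pi.single_apply]
    calc q y = q (∑ j, y j • (Pi.single j 1 : Fin D → ℝ)) := by rw [← h1]
      _ ≤ ∑ j, q (y j • (Pi.single j 1 : Fin D → ℝ)) :=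
          Finset.le_sum_of_subadditive q (map_zero q).le (map_add_le_add q) _ _
      _ ≤ ∑ j, q (Pi.single j 1) * p y := by
          refine Finset.sum_le_sum fun j _ => ?_
          rw [map_smul_eq_mul, mul_comm]
          exact mul_le_mul_of_nonneg_left ((norm_le_pi_norm y j).trans (hp y)) (apply_nonneg q _)
      _ = _ := by rw [Finset.sum_mul]
  have hne : ({m | ∃ y, p y = 1 ∧ q y = m} ∪ {0} : Set ℝ).Nonempty := ⟨0, by simp⟩
  have hbdd : BddAbove ({m | ∃ y, p y = 1 ∧ q y = m} ∪ {0} : Set ℝ) := by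
    refine ⟨max M 0, ?_⟩
    rintro m (⟨y, hy, rfl⟩ | rfl)
    · refine (hM y).trans ?_
      rw [hy, mul_one]
      exact le_max_left _ _
    · exact le_max_right _ _
  -- `S` is the operator norm of `q` relative to `p`; the net shows `S ≤ 1 + η + S η`
  set S := sSup ({m | ∃ y, p y = 1 ∧ q y = m} ∪ {0} : Set ℝ) with hS
  have hS0 : 0 ≤ S := le_csSup hbdd (by simp)
  have hqS : ∀ y, q y ≤ S * p y := by
    intro y
    rcases (apply_nonneg p y).eq_or_lt with h | h
    · have := hM y
      rw [← h] at this ⊢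
      simpa using this
    · have h1 : p ((p y)⁻¹ • y) = 1 := by
        rw [map_smul_eq_mul, norm_inv, Real.norm_of_nonneg h.le, inv_mul_cancel₀ h.ne']
      have h2 : q ((p y)⁻¹ • y) ≤ S := le_csSup hbdd (Or.inl ⟨_, h1, rfl⟩)
      rwa [map_smul_eq_mul, norm_inv, Real.norm_of_nonneg h.le, inv_mul_le_iff₀ h, mul_comm] at h2
  have hup : ∀ y, p y = 1 → q y ≤ 1 + η + S * η := by
    intro y hy
    obtain ⟨z, hz, hyz⟩ := hT y hy
    have h1 := map_add_le_add q (y - z) z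
    rw [sub_add_cancel] at h1
    have h2 := hqS (y - z)
    have h3 := hhi z hz
    have h4 : S * p (y - z) ≤ S * η := mul_le_mul_of_nonneg_left hyz hS0
    linarith
  have hSle : S ≤ 1 + η + S * η := by
    refine csSup_le hne ?_
    rintro m (⟨y, hy, rfl⟩ | rfl)
    · exact hup y hy
    · positivity
  have hS3 : S ≤ 1 + 3 * η := by nlinarith
  have hmain : ∀ y, p y = 1 → 1 - 3 * η ≤ q y ∧ q y ≤ 1 + 3 * η := by
    intro y hy
    obtain ⟨z, hz, hyz⟩ := hT y hy
    have h1 := map_sub_le_add q y (y - z)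
    rw [sub_sub_cancel] at h1
    have h2 := hqS (y - z)
    have h3 := hlo z hz
    have h4 : S * p (y - z) ≤ S * η := mul_le_mul_of_nonneg_left hyz hS0
    have h5 := hup y hy
    constructor <;> nlinarith
  rcases (apply_nonneg p y).eq_or_lt with h | h
  · have h1 := hqS y
    have h2 := apply_nonneg q y
    rw [← h] at h1 ⊢
    constructor <;> linarith
  · have h1 : p ((p y)⁻¹ • y) = 1 := by
      rw [map_smul_eq_mul, norm_inv, Real.norm_of_nonneg h.le, inv_mul_cancel₀ h.ne']
    have h2 := hmain _ h1
    rw [map_smul_eq_mul, norm_inv, Real.norm_of_nonneg h.le, inv_mul_le_iff₀ h,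
      le_inv_mul_iff₀ h] at h2
    constructor <;> linarith

end net

/-! ### Concentration of the sampled weights -/

section sampling

/-- The law of a single weight: `1 / p` with probability `p` and `0` otherwise. -/
def weightAtom (p : ℝ) : Measure ℝ :=
  ENNReal.ofReal p • Measure.dirac (1 / p) + ENNReal.ofReal (1 - p) • Measure.dirac 0

lemma weightLaw_eq {n : ℕ} (p : Fin n → ℝ) : weightLaw p = Measure.pi fun i => weightAtom (p i) :=
  rfl

instance (p : ℝ) : IsFiniteMeasure (weightAtom p) := by
  unfold weightAtom
  have h1 := Measure.smul_finite (Measure.dirac (1 / p) : Measure ℝ)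
    (ENNReal.ofReal_ne_top (r := p))
  have h2 := Measure.smul_finite (Measure.dirac 0 : Measure ℝ) (ENNReal.ofReal_ne_top (r := 1 - p))
  infer_instance

lemma isProbabilityMeasure_weightAtom {p : ℝ} (h0 : 0 ≤ p) (h1 : p ≤ 1) :
    IsProbabilityMeasure (weightAtom p) := by
  constructor
  simp only [weightAtom, Measure.add_apply, Measure.smul_apply, measure_univ, smul_eq_mul, mul_one]
  rw [← ENNReal.ofReal_add h0 (by linarith)]
  simp

lemma integrable_weightAtom (p : ℝ) (f : ℝ → ℝ) : Integrable f (weightAtom p) :=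
  ((integrable_dirac (by simp)).smul_measure ENNReal.ofReal_ne_top).add_measure
    ((integrable_dirac (by simp)).smul_measure ENNReal.ofReal_ne_top)

lemma integral_weightAtom {p : ℝ} (h0 : 0 ≤ p) (h1 : p ≤ 1) (f : ℝ → ℝ) :
    ∫ x, f x ∂(weightAtom p) = p * f (1 / p) + (1 - p) * f 0 := by
  rw [weightAtom, integral_add_measure
    ((integrable_dirac (by simp)).smul_measure ENNReal.ofReal_ne_top)
    ((integrable_dirac (by simp)).smul_measure ENNReal.ofReal_ne_top)]
  simp [integral_smul_measure, ENNReal.toReal_ofReal h0, ENNReal.toReal_ofReal (sub_nonneg.2 h1)]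

lemma exp_le_one_add_add_sq {x : ℝ} (hx : |x| ≤ 1) : Real.exp x ≤ 1 + x + x ^ 2 := by
  have := (abs_le.1 (Real.abs_exp_sub_one_sub_id_le hx)).2
  linarith

/-- The exponential moment of a single centred and scaled weight. -/
lemma weightAtom_mgf_le {p g M l : ℝ} (h0 : 0 ≤ p) (h1 : p ≤ 1) (hg : 0 ≤ g) (hM : 0 < M)
    (h : p = 1 ∨ g ≤ M * p) (hl : |l| * M ≤ 1) :
    ∫ x, Real.exp (l * ((x - 1) * g)) ∂(weightAtom p) ≤ Real.exp (l ^ 2 * M * g) := by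
  rw [integral_weightAtom h0 h1]
  have hexp : 1 ≤ Real.exp (l ^ 2 * M * g) := Real.one_le_exp (by positivity)
  by_cases hp1 : p = 1
  · subst hp1; simpa using hexp
  have hgp : g ≤ M * p := h.resolve_left hp1
  rcases h0.eq_or_lt with rfl | hp
  · have : g = 0 := le_antisymm (by simpa using hgp) hg
    subst this; simp
  have hlp : |l| * g ≤ p := by
    calc |l| * g ≤ |l| * (M * p) := by gcongr
      _ = |l| * M * p := by ring
      _ ≤ 1 * p := by gcongr
      _ = p := one_mul p
  have e1 : (1 / p - 1) * g = (1 - p) * g / p := by field_simp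
  have b1 : |l * ((1 / p - 1) * g)| ≤ 1 := by
    rw [e1, abs_mul, abs_div, abs_of_pos hp, abs_of_nonneg (mul_nonneg (sub_nonneg.2 h1) hg),
      mul_div_assoc', div_le_one hp]
    calc |l| * ((1 - p) * g) ≤ |l| * (1 * g) := by gcongr; linarith
      _ = |l| * g := by ring
      _ ≤ p := hlp
  have b2 : |l * ((0 - 1) * g)| ≤ 1 := by
    rw [abs_mul, abs_mul, abs_of_nonneg hg]
    simp only [zero_sub, abs_neg, abs_one, one_mul]
    linarith
  have k1 := mul_le_mul_of_nonneg_left (exp_le_one_add_add_sq b1) h0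
  have k2 := mul_le_mul_of_nonneg_left (exp_le_one_add_add_sq b2) (sub_nonneg.2 h1)
  have k3 : p * (1 + l * ((1 / p - 1) * g) + (l * ((1 / p - 1) * g)) ^ 2) +
      (1 - p) * (1 + l * ((0 - 1) * g) + (l * ((0 - 1) * g)) ^ 2)
      = 1 + l ^ 2 * (g * (g / p)) * (1 - p) := by
    field_simp
    ring
  have hgp' : g / p ≤ M := by rwa [div_le_iff₀ hp]
  have k4 : l ^ 2 * (g * (g / p)) * (1 - p) ≤ l ^ 2 * (g * M) * 1 := by
    have : 0 ≤ g / p := by positivity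
    gcongr
    linarith
  calc _ ≤ _ := add_le_add k1 k2
    _ = _ := k3
    _ ≤ 1 + l ^ 2 * (g * M) * 1 := by linarith
    _ = l ^ 2 * M * g + 1 := by ring
    _ ≤ _ := Real.add_one_le_exp _

variable {n : ℕ} {p g : Fin n → ℝ}

lemma isProbabilityMeasure_weightLaw (hp : ∀ i, 0 ≤ p i ∧ p i ≤ 1) :
    IsProbabilityMeasure (weightLaw p) := by
  have := fun i => isProbabilityMeasure_weightAtom (hp i).1 (hp i).2
  rw [weightLaw_eq]
  infer_instance

/-- The exponential Markov inequality, for both tails at once: `l` may be negative. Rows that are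
kept with certainty do not contribute to the deviation. -/
lemma weightLaw_chernoff (hp : ∀ i, 0 ≤ p i ∧ p i ≤ 1) (hg : ∀ i, 0 ≤ g i) {M : ℝ} (hM : 0 < M)
    (h : ∀ i, p i = 1 ∨ g i ≤ M * p i) (hsum : ∑ i, g i = 1) {l : ℝ} (hl : |l| * M ≤ 1) (t : ℝ) :
    weightLaw p {w | t ≤ l * (∑ i, w i * g i - 1)} ≤
      ENNReal.ofReal (Real.exp (l ^ 2 * M - t)) := by
  have := isProbabilityMeasure_weightLaw hp
  set F : (Fin n → ℝ) → ℝ := fun w => ∏ i, Real.exp (l * ((w i - 1) * g i)) with hF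
  have hFe : ∀ w, F w = Real.exp (l * (∑ i, w i * g i - 1)) := by
    intro w
    have e : ∑ i, w i * g i - 1 = ∑ i, (w i - 1) * g i := by
      simp only [sub_mul, one_mul, Finset.sum_sub_distrib, hsum]
    rw [hF, e, Finset.mul_sum, Real.exp_sum]
  have hint : Integrable F (weightLaw p) := by
    rw [weightLaw_eq]
    exact Integrable.fintype_prod (f := fun i x => Real.exp (l * ((x - 1) * g i)))
      fun i => integrable_weightAtom _ _
  have hle : ∫ w, F w ∂(weightLaw p) ≤ Real.exp (l ^ 2 * M) := by
    rw [weightLaw_eq,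
      integral_fintype_prod_eq_prod (fun i x => Real.exp (l * ((x - 1) * g i)))]
    calc _ ≤ ∏ i, Real.exp (l ^ 2 * M * g i) :=
          Finset.prod_le_prod (fun i _ => integral_nonneg fun x => (Real.exp_pos _).le)
            fun i _ => weightAtom_mgf_le (hp i).1 (hp i).2 (hg i) hM (h i) hl
      _ = Real.exp (l ^ 2 * M) := by
          rw [← Real.exp_sum, ← Finset.mul_sum, hsum, mul_one]
  have hmk := mul_meas_ge_le_integral_of_nonneg (μ := weightLaw p)
    (Filter.Eventually.of_forall fun w => by rw [hFe]; exact (Real.exp_pos _).le) hint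
    (Real.exp t)
  have hset : {w | Real.exp t ≤ F w} = {w | t ≤ l * (∑ i, w i * g i - 1)} := by
    ext w
    simp only [Set.mem_ofPred_eq, hFe, Real.exp_le_exp]
  rw [hset] at hmk
  rw [← ENNReal.ofReal_toReal (measure_ne_top (weightLaw p) _)]
  apply ENNReal.ofReal_le_ofReal
  rw [Real.exp_sub, le_div_iff₀ (Real.exp_pos _), mul_comm]
  exact hmk.trans hle

/-- Bernstein's inequality for the weighted sum: each row is either kept with certainty or sampled
with a probability proportional to an upper bound of its contribution. -/
lemma weightLaw_bernstein (hp : ∀ i, 0 ≤ p i ∧ p i ≤ 1) (hg : ∀ i, 0 ≤ g i) {M : ℝ} (hM : 0 < M)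
    (h : ∀ i, p i = 1 ∨ g i ≤ M * p i) (hsum : ∑ i, g i = 1) {η : ℝ} (hη : 0 < η) (hη1 : η ≤ 1) :
    weightLaw p {w | η < |∑ i, w i * g i - 1|} ≤
      ENNReal.ofReal (2 * Real.exp (-(η ^ 2 / (4 * M)))) := by
  set l := η / (2 * M) with hl
  have hl0 : 0 < l := by positivity
  have hlM : |l| * M ≤ 1 := by
    rw [abs_of_pos hl0, hl]
    field_simp
    linarith
  have h1 := weightLaw_chernoff hp hg hM h hsum hlM (l * η)
  have h2 := weightLaw_chernoff hp hg hM h hsum (l := -l) (by rwa [abs_neg]) (l * η)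
  have e : l ^ 2 * M - l * η = -(η ^ 2 / (4 * M)) := by
    rw [hl]; field_simp; ring
  rw [neg_sq, e] at h2
  rw [e] at h1
  have hsub : {w : Fin n → ℝ | η < |∑ i, w i * g i - 1|} ⊆
      {w | l * η ≤ l * (∑ i, w i * g i - 1)} ∪ {w | l * η ≤ -l * (∑ i, w i * g i - 1)} := by
    intro w hw
    rcases lt_abs.1 (Set.mem_ofPred_eq ▸ hw) with hw | hw
    · left; exact mul_le_mul_of_nonneg_left hw.le hl0.le
    · right
      have := mul_le_mul_of_nonneg_left hw.le hl0.le
      simp only [Set.mem_ofPred_eq]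
      linarith
  calc _ ≤ _ := measure_mono hsub
    _ ≤ _ := measure_union_le _ _
    _ ≤ ENNReal.ofReal (Real.exp (-(η ^ 2 / (4 * M)))) +
        ENNReal.ofReal (Real.exp (-(η ^ 2 / (4 * M)))) := add_le_add h1 h2
    _ = _ := by
      rw [← ENNReal.ofReal_add (Real.exp_pos _).le (Real.exp_pos _).le]
      ring_nf

lemma weightLaw_eval (hp : ∀ i, 0 ≤ p i ∧ p i ≤ 1) (i : Fin n) {s : Set ℝ} (hs : MeasurableSet s) :
    weightLaw p {w | w i ∈ s} = weightAtom (p i) s := by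
  have := fun i => isProbabilityMeasure_weightAtom (hp i).1 (hp i).2
  have h := (measurePreserving_eval (fun i => weightAtom (p i)) i).measure_preimage
    hs.nullMeasurableSet
  rw [weightLaw_eq]
  exact h

lemma weightLaw_not_nonneg (hp : ∀ i, 0 ≤ p i ∧ p i ≤ 1) : weightLaw p {w | ¬ 0 ≤ w} = 0 := by
  have hsub : {w : Fin n → ℝ | ¬ 0 ≤ w} ⊆ ⋃ i, {w | w i ∈ Set.Iio (0 : ℝ)} := by
    intro w hw
    simp only [Set.mem_ofPred_eq, Pi.le_def, not_forall, not_le] at hw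
    exact Set.mem_iUnion.2 hw
  refine measure_mono_null hsub (measure_iUnion_null fun i => ?_)
  rw [weightLaw_eval hp i measurableSet_Iio, weightAtom]
  have := (hp i).1
  simp [this]

/-- Markov's inequality for the number of sampled rows. -/
lemma weightLaw_card_le (hp : ∀ i, 0 ≤ p i ∧ p i ≤ 1) {B : ℝ} (hB : 0 < B)
    (hsum : ∑ i, p i ≤ B) :
    weightLaw p {w | 100 * B < ∑ i, Set.indicator {0}ᶜ (fun _ => (1 : ℝ)) (w i)} ≤
      ENNReal.ofReal (1 / 100) := by
  have := isProbabilityMeasure_weightLaw hp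
  have hpm := fun i => isProbabilityMeasure_weightAtom (hp i).1 (hp i).2
  set f : ℝ → ℝ := Set.indicator {0}ᶜ (fun _ => (1 : ℝ)) with hf
  have hmp := fun i => measurePreserving_eval (fun i => weightAtom (p i)) i
  have hint : ∀ i, Integrable (fun w : Fin n → ℝ => f (w i)) (weightLaw p) := fun i =>
    (hmp i).integrable_comp_of_integrable (integrable_weightAtom _ f)
  have hval : ∀ i, ∫ w, f (w i) ∂(weightLaw p) ≤ p i := by
    intro i
    have h1 : ∫ w, f (w i) ∂(weightLaw p) = ∫ x, f x ∂(weightAtom (p i)) := by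
      rw [← (hmp i).map_eq, integral_map (hmp i).measurable.aemeasurable]
      · rfl
      · rw [(hmp i).map_eq]; exact (integrable_weightAtom _ f).aestronglyMeasurable
    rw [h1, integral_weightAtom (hp i).1 (hp i).2]
    have h2 : f 0 = 0 := by simp [hf]
    have h3 : f (1 / p i) ≤ 1 := Set.indicator_le_self' (fun _ _ => zero_le_one) _
    have := (hp i).1
    rw [h2]
    nlinarith
  have hmk := mul_meas_ge_le_integral_of_nonneg (μ := weightLaw p)
    (f := fun w : Fin n → ℝ => ∑ i, f (w i))
    (Filter.Eventually.of_forall fun w => Finset.sum_nonneg fun i _ =>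
      Set.indicator_nonneg (fun _ _ => zero_le_one) _) (integrable_finsetSum _ fun i _ => hint i)
    (100 * B)
  rw [integral_finsetSum _ fun i _ => hint i] at hmk
  have h4 : (weightLaw p).real {w | 100 * B ≤ ∑ i, f (w i)} ≤ 1 / 100 := by
    have := hmk.trans ((Finset.sum_le_sum fun i _ => hval i).trans hsum)
    rw [le_div_iff₀ (by norm_num)]
    nlinarith
  have hsub : {w : Fin n → ℝ | 100 * B < ∑ i, f (w i)} ⊆ {w | 100 * B ≤ ∑ i, f (w i)} :=
    fun w hw => by
      simp only [Set.mem_ofPred_eq] at hw ⊢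
      exact hw.le
  refine (measure_mono hsub).trans ?_
  rw [← ENNReal.ofReal_toReal (measure_ne_top (weightLaw p) _)]
  exact ENNReal.ofReal_le_ofReal h4

end sampling

/-! ### Subspace embeddings -/

section euclidean

variable {m k : ℕ}

lemma l2_sq (v : Fin m → ℝ) : l2 v ^ 2 = ∑ j, v j ^ 2 := by
  rw [l2, EuclideanSpace.norm_sq_eq]
  simp

lemma l2_nonneg (v : Fin m → ℝ) : 0 ≤ l2 v := norm_nonneg _

lemma l2_eq_sqrt (v : Fin m → ℝ) : l2 v = Real.sqrt (∑ j, v j ^ 2) := by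
  rw [← l2_sq, Real.sqrt_sq (l2_nonneg v)]

lemma l2_smul (c : ℝ) (v : Fin m → ℝ) : l2 (c • v) = |c| * l2 v := by
  rw [l2, l2, WithLp.toLp_smul, norm_smul, Real.norm_eq_abs]

lemma l2_single (j : Fin m) : l2 (Pi.single j 1 : Fin m → ℝ) = 1 := by
  rw [l2_eq_sqrt]
  simp [Pi.single_apply]

lemma abs_le_l2 (v : Fin m → ℝ) (j : Fin m) : |v j| ≤ l2 v := by
  rw [l2_eq_sqrt]
  apply Real.abs_le_sqrt
  exact Finset.single_le_sum (f := fun j => v j ^ 2) (fun i _ => sq_nonneg _) (Finset.mem_univ j)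

lemma norm_le_l2 (v : Fin m → ℝ) : ‖v‖ ≤ l2 v :=
  (pi_norm_le_iff_of_nonneg (l2_nonneg v)).2 fun j => abs_le_l2 v j

lemma l2_le_sum_abs (v : Fin m → ℝ) : l2 v ≤ ∑ j, |v j| := by
  rw [l2_eq_sqrt]
  apply Real.sqrt_le_iff.2 ⟨Finset.sum_nonneg fun j _ => abs_nonneg _, ?_⟩
  calc ∑ j, v j ^ 2 = ∑ j, |v j| ^ 2 := by simp
    _ ≤ (∑ j, |v j|) ^ 2 := Finset.sum_sq_le_sq_sum_of_nonneg fun j _ => abs_nonneg _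

lemma abs_dotProduct_le (u v : Fin m → ℝ) : |u ⬝ᵥ v| ≤ l2 u * l2 v := by
  have h := abs_real_inner_le_norm (WithLp.toLp 2 v) (WithLp.toLp 2 u)
  rw [EuclideanSpace.inner_toLp_toLp] at h
  rw [l2, l2, mul_comm]
  simpa using h

lemma abs_mulVec_le (U : Matrix (Fin k) (Fin m) ℝ) (z : Fin m → ℝ) (i : Fin k) :
    |(U *ᵥ z) i| ≤ l2 (U i) * l2 z := abs_dotProduct_le _ _

lemma l2_mulVec_of_orthonormal {Q : Matrix (Fin k) (Fin m) ℝ} (hQ : Qᵀ * Q = 1) (y : Fin m → ℝ) :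
    l2 (Q *ᵥ y) = l2 y := by
  have h : l2 (Q *ᵥ y) ^ 2 = l2 y ^ 2 := by
    have e : ∀ {r : ℕ} (v : Fin r → ℝ), l2 v ^ 2 = v ⬝ᵥ v := fun v => by
      rw [l2_sq]; simp [dotProduct, sq]
    rw [e, e, Matrix.dotProduct_mulVec, Matrix.vecMul_mulVec, hQ, Matrix.vecMul_one]
  rwa [sq_eq_sq₀ (l2_nonneg _) (l2_nonneg _)] at h

end euclidean

section embedding

variable {G : ℝ → ℝ} {CG : ℝ} {n D d : ℕ}

/-- The seminorm `y ↦ ‖U y‖_{G,w}`. -/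
def orliczSeminorm (hG : IsOrliczFunction G CG) {w : Fin n → ℝ} (hw : 0 ≤ w)
    (U : Matrix (Fin n) (Fin D) ℝ) : Seminorm ℝ (Fin D → ℝ) :=
  Seminorm.of (fun y => weightedOrliczNorm G w (U *ᵥ y))
    (fun x y => by rw [Matrix.mulVec_add]; exact weightedOrliczNorm_add_le hG hw)
    (fun a x => by rw [Matrix.mulVec_smul, weightedOrliczNorm_smul hG hw, Real.norm_eq_abs])

/-- The weights for which the weighted sum is far from its expectation `1` at some point of `T`. -/
def deviationSet (G : ℝ → ℝ) (U : Matrix (Fin n) (Fin D) ℝ) (T : Finset (Fin D → ℝ)) (ε : ℝ) :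
    Set (Fin n → ℝ) :=
  {w | ∃ z ∈ T, ε / 48 < |orliczSum G w (U *ᵥ z) 1 - 1|}

lemma measurableSet_deviationSet (U : Matrix (Fin n) (Fin D) ℝ) (T : Finset (Fin D → ℝ)) (ε : ℝ) :
    MeasurableSet (deviationSet G U T ε) := by
  have : deviationSet G U T ε =
      ⋃ z ∈ T, {w | ε / 48 < |orliczSum G w (U *ᵥ z) 1 - 1|} := by
    ext w; simp [deviationSet]
  rw [this]
  refine T.measurableSet_biUnion fun z _ => ?_
  refine measurableSet_lt measurable_const ?_
  unfold orliczSum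
  fun_prop

/-- The weighted norm approximates the unweighted one on the column space of `U`. -/
def IsEmbedding (G : ℝ → ℝ) (U : Matrix (Fin n) (Fin D) ℝ) (w : Fin n → ℝ) (δ : ℝ) : Prop :=
  ∀ y, (1 - δ) * orliczNorm G (U *ᵥ y) ≤ weightedOrliczNorm G w (U *ᵥ y) ∧
    weightedOrliczNorm G w (U *ᵥ y) ≤ (1 + δ) * orliczNorm G (U *ᵥ y)

/-- With admissible probabilities, sampling yields a subspace embedding: the failure event is
contained in the deviation event for a net of the unit sphere. The net and the deviation are both
of size `η = ε / 48`, so that `seminorm_close_of_net` gives the distortion `3 η = ε / 16`. -/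
lemma exists_embedding_net (hG : IsOrliczFunction G CG) (U : Matrix (Fin n) (Fin (d + 1)) ℝ)
    (hU : ∀ y, l2 y ≤ orliczNorm G (U *ᵥ y)) (hd : 1 ≤ d) {ε : ℝ} (hε : 0 < ε) (hε1 : ε ≤ 1 / 2) :
    ∃ T : Finset (Fin (d + 1) → ℝ),
      (∀ w : Fin n → ℝ, 0 ≤ w → w ∉ deviationSet G U T ε → IsEmbedding G U w (ε / 16)) ∧
      ∀ C : ℝ, 9216 * 24 ≤ C → ∀ p : Fin n → ℝ, Admissible C d ε (fun i => G (l2 (U i))) p →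
        weightLaw p (deviationSet G U T ε) ≤ ENNReal.ofReal (1 / 32) := by
  have hw1 : (0 : Fin n → ℝ) ≤ fun _ => 1 := fun _ => zero_le_one
  set P := orliczSeminorm hG hw1 U with hP
  have hPl2 : ∀ y, l2 y ≤ P y := hU
  have hPn : ∀ y, ‖y‖ ≤ P y := fun y => (norm_le_l2 y).trans (hPl2 y)
  set η := ε / 48 with hη
  have hη0 : 0 < η := by positivity
  obtain ⟨T, hTc, hT1, hTnet⟩ := exists_net P hPn hη0 (by linarith)
  refine ⟨T, fun w hw hgood y => ?_, fun C hC p hp => ?_⟩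
  · have hgood' : ∀ z ∈ T, |orliczSum G w (U *ᵥ z) 1 - 1| ≤ η := by
      intro z hz
      by_contra! h
      exact hgood ⟨z, hz, h⟩
    have h := seminorm_close_of_net P (orliczSeminorm hG hw U) hPn hη0 (by linarith) T hTnet
      (fun z hz => by
        have := (abs_le.1 (hgood' z hz)).1
        have := le_norm_of_le_orliczSum (c := 1 - η) hG hw one_pos (by linarith)
          (by linarith : 1 - η ≤ orliczSum G w (U *ᵥ z) 1)
        rwa [mul_one] at this)
      (fun z hz => by
        have := (abs_le.1 (hgood' z hz)).2
        have := norm_le_of_orliczSum_le (c := 1 + η) hG hw one_pos (by linarith)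
          (by linarith : orliczSum G w (U *ᵥ z) 1 ≤ 1 + η)
        rwa [mul_one] at this) y
    have e : 3 * η = ε / 16 := by rw [hη]; ring
    rw [e] at h
    exact h
  · have hp01 : ∀ i, 0 ≤ p i ∧ p i ≤ 1 := fun i => ⟨(hp i).1, (hp i).2.1⟩
    set L := Real.log (1 / ε) with hL
    have hL2 : Real.log 2 ≤ L := by
      apply Real.log_le_log (by norm_num)
      rw [le_div_iff₀ hε]; linarith
    have hlog2 : 0 < Real.log 2 := Real.log_pos (by norm_num)
    have hL0 : 0 < L := hlog2.trans_le hL2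
    have hd0 : (1 : ℝ) ≤ d := by exact_mod_cast hd
    have hC0 : 0 < C := by linarith
    set M := (C * d * (ε ^ 2)⁻¹ * L)⁻¹ with hM
    have hM0 : 0 < M := by positivity
    have hz : ∀ z ∈ T, weightLaw p {w | η < |orliczSum G w (U *ᵥ z) 1 - 1|} ≤
        ENNReal.ofReal (2 * Real.exp (-(η ^ 2 / (4 * M)))) := by
      intro z hz
      have hPz : weightedOrliczNorm G (fun _ => 1) (U *ᵥ z) = 1 := hT1 z hz
      -- on the unit sphere the defining sum is exactly `1`, also at the scale `1`
      have hsum : ∑ i, G (|(U *ᵥ z) i| / 1) = 1 := by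
        have h1 := (weightedOrliczNorm_le_iff hG hw1 one_pos).1 hPz.le
        have h2 : 1 ≤ orliczSum G (fun _ => 1) (U *ᵥ z) 1 := by
          by_contra! hlt
          obtain ⟨c, hc, hc1⟩ := exists_between (max_lt hlt one_half_lt_one)
          have hc0 : 0 < c := one_half_pos.trans ((le_max_right _ _).trans_lt hc)
          have hs := exists_orliczSum_eq_one (y := U *ᵥ z) hG hw1 (by
            by_contra! h0
            have := weightedOrliczNorm_eq_zero hG h0
            linarith)
          obtain ⟨α, hα, hα1⟩ := hs
          have h3 := le_norm_of_le_orliczSum hG hw1 hα le_rfl hα1.ge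
          have h4 := (weightedOrliczNorm_le_iff hG hw1 hα).2 hα1.le
          have : α = 1 := by linarith
          rw [this] at hα1
          linarith
        have h3 := le_antisymm h1 h2
        simpa [orliczSum] using h3
      refine weightLaw_bernstein hp01 (fun i => hG.nonneg _) hM0 (fun i => ?_) hsum hη0
        (by linarith)
      rcases min_le_iff.1 (hp i).2.2 with h | h
      · left; exact le_antisymm (hp i).2.1 h
      · right
        -- conditioning: the score of a row bounds its contribution at every point of the sphere
        have h1 : G (|(U *ᵥ z) i| / 1) ≤ G (l2 (U i)) := by
          apply hG.mono (by positivity)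
          rw [div_one]
          calc |(U *ᵥ z) i| ≤ l2 (U i) * l2 z := abs_mulVec_le U z i
            _ ≤ l2 (U i) * 1 := mul_le_mul_of_nonneg_left
                ((hPl2 z).trans (hT1 z hz).le) (l2_nonneg _)
            _ = l2 (U i) := mul_one _
        refine h1.trans ?_
        rw [hM, le_inv_mul_iff₀ (by positivity)]
        exact h
    have hsub : deviationSet G U T ε =
        ⋃ z ∈ T, {w | η < |orliczSum G w (U *ᵥ z) 1 - 1|} := by
      ext w; simp [deviationSet, hη]
    rw [hsub]
    refine (measure_biUnion_finset_le _ _).trans ((Finset.sum_le_sum hz).trans ?_)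
    rw [Finset.sum_const, nsmul_eq_mul, ← ENNReal.ofReal_natCast,
      ← ENNReal.ofReal_mul (by positivity)]
    apply ENNReal.ofReal_le_ofReal
    -- the net has at most `exp (18 d L)` points, while each exponent is at most `- 24 d L`
    have e1 : η ^ 2 / (4 * M) = C / 9216 * (d * L) := by
      rw [hM, hη]; field_simp; ring
    have e2 : (3 / η) ^ (d + 1) ≤ Real.exp (18 * (d * L)) := by
      have h3 : 3 / η ≤ Real.exp (9 * L) := by
        have h144 : (144 : ℝ) ≤ Real.exp (8 * L) := by
          calc (144 : ℝ) ≤ 2 ^ 8 := by norm_num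
            _ = Real.exp (8 * Real.log 2) := by
              rw [mul_comm, Real.exp_mul, Real.exp_log (by norm_num)]; norm_num
            _ ≤ _ := Real.exp_le_exp.2 (by linarith)
        have hexpL : Real.exp L = 1 / ε := Real.exp_log (by positivity)
        calc 3 / η = 144 * (1 / ε) := by rw [hη]; field_simp; norm_num
          _ ≤ Real.exp (8 * L) * Real.exp L := by rw [hexpL]; gcongr
          _ = Real.exp (9 * L) := by rw [← Real.exp_add]; ring_nf
      calc (3 / η) ^ (d + 1) ≤ Real.exp (9 * L) ^ (d + 1) := by gcongr
        _ = Real.exp (9 * L * (d + 1)) := by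
          rw [← Real.exp_nat_mul]; push_cast; ring_nf
        _ ≤ _ := Real.exp_le_exp.2 (by nlinarith)
    calc (T.card : ℝ) * (2 * Real.exp (-(η ^ 2 / (4 * M))))
        ≤ Real.exp (18 * (d * L)) * (2 * Real.exp (-(24 * (d * L)))) := by
          have hdL : 0 < d * L := by positivity
          have hC' : 24 ≤ C / 9216 := by rw [le_div_iff₀ (by norm_num)]; linarith
          rw [e1]
          gcongr
          exact hTc.trans e2
      _ = 2 * Real.exp (-(6 * (d * L))) := by
          rw [mul_left_comm, ← Real.exp_add]; ring_nf
      _ ≤ 2 * Real.exp (-(6 * Real.log 2)) := by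
          gcongr
          nlinarith
      _ = 1 / 32 := by
          rw [Real.exp_neg, mul_comm 6, Real.exp_mul, Real.exp_log (by norm_num)]; norm_num

/-- The sum of the scores is polynomially bounded. -/
lemma sum_score_le (hG : IsOrliczFunction G CG) (U : Matrix (Fin n) (Fin D) ℝ) {κ : ℝ}
    (hκ : 1 ≤ κ) (hU : ∀ y, orliczNorm G (U *ᵥ y) ≤ κ * l2 y) :
    ∑ i, G (l2 (U i)) ≤ CG * D ^ 3 * κ ^ 2 := by
  rcases Nat.eq_zero_or_pos D with rfl | hD
  · simp [l2_eq_sqrt, hG.map_zero]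
  have hD1 : (1 : ℝ) ≤ D := by exact_mod_cast hD
  have hκ0 : 0 < κ := by linarith
  have hCG := hG.one_le_const
  have h1 : ∀ i, G (l2 (U i)) ≤ ∑ j, CG * (D * κ) ^ 2 * G (|U i j| / κ) := by
    intro i
    calc G (l2 (U i)) ≤ G (∑ j, |U i j|) := hG.mono (l2_nonneg _) (l2_le_sum_abs _)
      _ ≤ ∑ j, G (D * U i j) := hG.map_sum_abs_le _
      _ ≤ _ := Finset.sum_le_sum fun j _ => by
        have h := hG.map_mul_le_sq (c := D * κ) (by nlinarith) (|U i j| / κ)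
        have e : D * κ * (|U i j| / κ) = |D * U i j| := by
          rw [abs_mul, Nat.abs_cast]; field_simp
        rwa [e, hG.map_abs] at h
  calc ∑ i, G (l2 (U i)) ≤ ∑ i, ∑ j, CG * (D * κ) ^ 2 * G (|U i j| / κ) :=
        Finset.sum_le_sum fun i _ => h1 i
    _ = ∑ j, CG * (D * κ) ^ 2 * ∑ i, G (|U i j| / κ) := by
        rw [Finset.sum_comm]; simp only [Finset.mul_sum]
    _ ≤ ∑ _j : Fin D, CG * (D * κ) ^ 2 * 1 := by
        refine Finset.sum_le_sum fun j _ => ?_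
        gcongr
        have h := hU (Pi.single j 1)
        rw [l2_single, mul_one, orliczNorm,
          weightedOrliczNorm_le_iff hG (fun _ => zero_le_one) hκ0] at h
        simpa [orliczSum] using h
    _ = _ := by simp; ring

end embedding

/-! ### Conditioning by the triangular factor -/

section whitening

variable {G : ℝ → ℝ} {CG : ℝ} {n d s : ℕ} {A : Matrix (Fin n) (Fin d) ℝ} {b : Fin n → ℝ}
  {S : Matrix (Fin s) (Fin n) ℝ} {κ ε : ℝ} {Q : Matrix (Fin s) (Fin (d + 1)) ℝ}
  {R : Matrix (Fin (d + 1)) (Fin (d + 1)) ℝ}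

/-- The matrix `Ā R⁻¹` with well-conditioned columns. -/
def whitened (A : Matrix (Fin n) (Fin d) ℝ) (b : Fin n → ℝ)
    (R : Matrix (Fin (d + 1)) (Fin (d + 1)) ℝ) : Matrix (Fin n) (Fin (d + 1)) ℝ :=
  augment A b * R⁻¹

lemma augment_mulVec_snoc (A : Matrix (Fin n) (Fin d) ℝ) (b : Fin n → ℝ) (x : Fin d → ℝ) :
    augment A b *ᵥ (Fin.snoc x (-1) : Fin (d + 1) → ℝ) = A *ᵥ x - b := by
  ext i
  simp only [Matrix.mulVec, dotProduct, augment, Matrix.of_apply, Pi.sub_apply]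
  rw [Fin.sum_univ_castSucc]
  simp only [Fin.snoc_castSucc, Fin.snoc_last]
  ring

namespace IsInstance

lemma mulVec_ne_zero (h : IsInstance G CG A b S κ ε Q R) {x : Fin (d + 1) → ℝ} (hx : x ≠ 0) :
    augment A b *ᵥ x ≠ 0 := by
  have hinj := Matrix.mulVec_injective_iff.2 h.fullRank
  intro h0
  exact hx (hinj (by rw [h0, Matrix.mulVec_zero]))

lemma orliczNorm_pos (h : IsInstance G CG A b S κ ε Q R) {x : Fin (d + 1) → ℝ} (hx : x ≠ 0) :
    0 < orliczNorm G (augment A b *ᵥ x) :=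
  weightedOrliczNorm_nonneg.lt_of_ne fun h0 =>
    h.mulVec_ne_zero hx ((orliczNorm_eq_zero_iff h.orlicz).1 h0.symm)

lemma one_le_kappa (h : IsInstance G CG A b S κ ε Q R) : 1 ≤ κ := by
  have hx : (1 : Fin (d + 1) → ℝ) ≠ 0 := one_ne_zero
  have h1 := (h.lower 1).trans (h.upper 1)
  have h2 := h.orliczNorm_pos hx
  nlinarith

lemma l2_mulVec (h : IsInstance G CG A b S κ ε Q R) (x : Fin (d + 1) → ℝ) :
    l2 (R *ᵥ x) = κ⁻¹ * l2 ((S * augment A b) *ᵥ x) := by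
  have hκ : 0 < κ := one_pos.trans_le h.one_le_kappa
  rw [← l2_mulVec_of_orthonormal h.qr.orthonormal, Matrix.mulVec_mulVec, h.qr.mul_eq,
    Matrix.smul_mulVec, l2_smul, abs_of_pos (inv_pos.2 hκ)]

lemma isUnit_det (h : IsInstance G CG A b S κ ε Q R) : IsUnit R.det := by
  rw [← Matrix.isUnit_iff_isUnit_det, ← Matrix.mulVec_injective_iff_isUnit]
  have hκ : 0 < κ := one_pos.trans_le h.one_le_kappa
  intro x y hxy
  by_contra hne
  have h0 : R *ᵥ (x - y) = 0 := by rw [Matrix.mulVec_sub, sub_eq_zero]; exact hxy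
  have h1 := h.l2_mulVec (x - y)
  have h2 := h.lower (x - y)
  have h3 := h.orliczNorm_pos (sub_ne_zero.2 hne)
  have h4 : l2 (R *ᵥ (x - y)) = 0 := by rw [h0, l2]; simp
  rw [h4] at h1
  have h5 : 0 < κ⁻¹ * l2 ((S * augment A b) *ᵥ (x - y)) := mul_pos (inv_pos.2 hκ) (by linarith)
  linarith

lemma diag_ne_zero (h : IsInstance G CG A b S κ ε Q R) (i : Fin (d + 1)) : R i i ≠ 0 := by
  have h1 := h.isUnit_det.ne_zero
  rw [Matrix.det_of_isUpperTriangular (fun i j hij => h.qr.upper i j hij)] at h1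
  exact fun h0 => h1 (Finset.prod_eq_zero (Finset.mem_univ i) h0)

lemma whitened_mulVec (h : IsInstance G CG A b S κ ε Q R) (y : Fin (d + 1) → ℝ) :
    whitened A b R *ᵥ (R *ᵥ y) = augment A b *ᵥ y := by
  rw [whitened, Matrix.mulVec_mulVec, Matrix.mul_assoc, Matrix.nonsing_inv_mul _ h.isUnit_det,
    Matrix.mul_one]

lemma whitened_lower (h : IsInstance G CG A b S κ ε Q R) (y : Fin (d + 1) → ℝ) :
    l2 y ≤ orliczNorm G (whitened A b R *ᵥ y) := by
  have hκ : 0 < κ := one_pos.trans_le h.one_le_kappa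
  have e : y = R *ᵥ (R⁻¹ *ᵥ y) := by
    rw [Matrix.mulVec_mulVec, Matrix.mul_nonsing_inv _ h.isUnit_det, Matrix.one_mulVec]
  rw [e, h.whitened_mulVec, h.l2_mulVec, inv_mul_le_iff₀ hκ]
  exact h.upper _

lemma whitened_upper (h : IsInstance G CG A b S κ ε Q R) (y : Fin (d + 1) → ℝ) :
    orliczNorm G (whitened A b R *ᵥ y) ≤ κ * l2 y := by
  have hκ : 0 < κ := one_pos.trans_le h.one_le_kappa
  have e : y = R *ᵥ (R⁻¹ *ᵥ y) := by
    rw [Matrix.mulVec_mulVec, Matrix.mul_nonsing_inv _ h.isUnit_det, Matrix.one_mulVec]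
  rw [e, h.whitened_mulVec, h.l2_mulVec, mul_inv_cancel_left₀ hκ.ne']
  exact h.lower _

lemma residual_eq (h : IsInstance G CG A b S κ ε Q R) (x : Fin d → ℝ) :
    A *ᵥ x - b = whitened A b R *ᵥ (R *ᵥ (Fin.snoc x (-1) : Fin (d + 1) → ℝ)) := by
  rw [h.whitened_mulVec, augment_mulVec_snoc]

/-- On the embedding event, an approximate minimizer of the weighted problem is an approximate
solution of the original problem. -/
lemma isApproxSolution (h : IsInstance G CG A b S κ ε Q R) {w : Fin n → ℝ}
    (hw : IsEmbedding G (whitened A b R) w (ε / 16)) {c : ℝ} (hc0 : 0 ≤ c) (hc : c ≤ 1 + ε / 4)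
    {x : Fin d → ℝ} (hx : IsMinimizer G A b w c x) : IsApproxSolution G A b ε x := by
  intro z
  have h1 := (hw (R *ᵥ (Fin.snoc x (-1) : Fin (d + 1) → ℝ))).1
  have h2 := (hw (R *ᵥ (Fin.snoc z (-1) : Fin (d + 1) → ℝ))).2
  rw [← h.residual_eq] at h1 h2
  have h3 := hx z
  set a := orliczNorm G (A *ᵥ x - b)
  set a' := orliczNorm G (A *ᵥ z - b)
  have ha' : 0 ≤ a' := weightedOrliczNorm_nonneg
  have hε := h.eps_pos
  have hε1 := h.eps_le
  have h4 : (1 - ε / 16) * a ≤ (1 + ε / 4) * ((1 + ε / 16) * a') :=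
    h1.trans (h3.trans ((mul_le_mul_of_nonneg_left h2 hc0).trans
      (mul_le_mul_of_nonneg_right hc (by positivity))))
  have h5 : (1 + ε / 4) * ((1 + ε / 16) * a') ≤ (1 - ε / 16) * ((1 + ε) * a') := by
    rw [← mul_assoc, ← mul_assoc]
    apply mul_le_mul_of_nonneg_right _ ha'
    nlinarith
  exact le_of_mul_le_mul_left (h4.trans h5) (by linarith)

/-- The weighted problem has a minimizer on the embedding event, by coercivity. -/
lemma exists_isMinimizer (h : IsInstance G CG A b S κ ε Q R) {w : Fin n → ℝ} (hw0 : 0 ≤ w)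
    (hw : IsEmbedding G (whitened A b R) w (ε / 16)) : ∃ x, IsMinimizer G A b w 1 x := by
  set U := whitened A b R with hU
  set q := orliczSeminorm h.orlicz hw0 U with hq
  set Y : (Fin d → ℝ) → Fin (d + 1) → ℝ := fun x => R *ᵥ (Fin.snoc x (-1) : Fin (d + 1) → ℝ)
    with hY
  have hcontY : Continuous Y := by
    have h1 : Continuous fun x : Fin d → ℝ => (Fin.snoc x (-1) : Fin (d + 1) → ℝ) := by
      refine continuous_pi fun j => ?_
      refine Fin.lastCases ?_ (fun j => ?_) j
      · simp only [Fin.snoc_last]; exact continuous_const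
      · simp only [Fin.snoc_castSucc]; exact continuous_apply j
    exact (Continuous.matrix_mulVec continuous_const h1)
  have hcont : Continuous fun x => q (Y x) := (seminorm_continuous q).comp hcontY
  -- `‖x‖` is bounded by a multiple of the objective
  obtain ⟨K, hK0, hK⟩ : ∃ K : ℝ, 0 ≤ K ∧ ∀ x : Fin d → ℝ, ‖x‖ ≤ K * q (Y x) := by
    refine ⟨2 * ∑ i, l2 (R⁻¹ i), mul_nonneg zero_le_two
      (Finset.sum_nonneg fun i _ => l2_nonneg _), fun x => ?_⟩
    have h1 : l2 (Y x) ≤ 2 * q (Y x) := by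
      have h2 := (hw (Y x)).1
      have h3 := h.whitened_lower (Y x)
      have h4 := h.eps_le
      have h5 := l2_nonneg (Y x)
      change _ ≤ q (Y x) at h2
      nlinarith
    have hq0 : 0 ≤ q (Y x) := apply_nonneg q _
    refine (pi_norm_le_iff_of_nonneg (mul_nonneg (mul_nonneg zero_le_two
      (Finset.sum_nonneg fun i _ => l2_nonneg _)) hq0)).2 fun j => ?_
    have e : x j = (R⁻¹ *ᵥ Y x) j.castSucc := by
      rw [hY, Matrix.mulVec_mulVec, Matrix.nonsing_inv_mul _ h.isUnit_det, Matrix.one_mulVec,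
        Fin.snoc_castSucc]
    rw [Real.norm_eq_abs, e]
    calc _ ≤ l2 (R⁻¹ j.castSucc) * l2 (Y x) := abs_mulVec_le _ _ _
      _ ≤ (∑ i, l2 (R⁻¹ i)) * (2 * q (Y x)) :=
          mul_le_mul (Finset.single_le_sum (f := fun i => l2 (R⁻¹ i)) (fun i _ => l2_nonneg _)
            (Finset.mem_univ _)) h1 (l2_nonneg _) (Finset.sum_nonneg fun i _ => l2_nonneg _)
      _ = _ := by ring
  have hcoer : Filter.Tendsto (fun x => q (Y x)) (Filter.cocompact _) Filter.atTop := by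
    have h1 : Filter.Tendsto (fun x : Fin d → ℝ => ‖x‖ / (K + 1)) (Filter.cocompact _)
        Filter.atTop := (tendsto_norm_cocompact_atTop).atTop_div_const (by positivity)
    refine Filter.tendsto_atTop_mono (fun x => ?_) h1
    rw [div_le_iff₀ (by positivity)]
    have := hK x
    have hq0 : 0 ≤ q (Y x) := apply_nonneg q _
    nlinarith
  obtain ⟨x, hx⟩ := hcont.exists_forall_le hcoer
  refine ⟨x, fun z => ?_⟩
  rw [one_mul, h.residual_eq, h.residual_eq]
  exact hx z

/-- Correctness for arbitrary admissible sampling probabilities. -/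
theorem correctness (h : IsInstance G CG A b S κ ε Q R) {C : ℝ} (hC : 9216 * 24 ≤ C)
    {p : Fin n → ℝ} (hp : Admissible C d ε (leverage G A b R) p) :
    weightLaw p {w | ¬ ((∃ x, IsMinimizer G A b w 1 x) ∧
      ∀ x, IsMinimizer G A b w 1 x → IsApproxSolution G A b ε x)} ≤ 1 / 10 := by
  obtain ⟨T, hT, hTp⟩ := exists_embedding_net h.orlicz (whitened A b R) h.whitened_lower h.one_le_d
    h.eps_pos h.eps_le
  have hp01 : ∀ i, 0 ≤ p i ∧ p i ≤ 1 := fun i => ⟨(hp i).1, (hp i).2.1⟩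
  have hε := h.eps_pos
  have hsub : {w | ¬ ((∃ x, IsMinimizer G A b w 1 x) ∧
      ∀ x, IsMinimizer G A b w 1 x → IsApproxSolution G A b ε x)} ⊆
      {w | ¬ 0 ≤ w} ∪ deviationSet G (whitened A b R) T ε := by
    intro w hw
    by_contra hcon
    rw [Set.mem_union, not_or] at hcon
    have hw0 : 0 ≤ w := by
      by_contra h0
      exact hcon.1 h0
    have hemb := hT w hw0 hcon.2
    exact hw ⟨h.exists_isMinimizer hw0 hemb,
      fun x hx => h.isApproxSolution hemb zero_le_one (by linarith) hx⟩
  calc _ ≤ _ := measure_mono hsub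
    _ ≤ _ := measure_union_le _ _
    _ ≤ 0 + ENNReal.ofReal (1 / 32) :=
      add_le_add (weightLaw_not_nonneg hp01).le (hTp C hC p hp)
    _ ≤ 1 / 10 := by
      rw [zero_add]
      refine ENNReal.ofReal_le_of_le_toReal ?_
      simp only [ENNReal.toReal_div, ENNReal.toReal_one, ENNReal.toReal_ofNat]
      norm_num

end IsInstance

end whitening

/-! ### Random sign sketches -/

section sketch

/-- The sign `±1` encoded by a bit. -/
def bitSign (t : Bool) : ℝ := if t then 1 else -1

/-- Averaging over one sign, by `cosh x ≤ exp (x ^ 2 / 2)`. -/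
lemma sum_bool_exp_le (l a v : ℝ) :
    ∑ t : Bool, Real.exp (l * (a + v * bitSign t) ^ 2) ≤
      2 * (Real.exp ((l + 2 * l ^ 2 * v ^ 2) * a ^ 2) * Real.exp (l * v ^ 2)) := by
  have h := Real.cosh_le_exp_half_sq (2 * l * a * v)
  rw [Real.cosh_eq] at h
  have e : ∑ t : Bool, Real.exp (l * (a + v * bitSign t) ^ 2) = Real.exp (l * (a ^ 2 + v ^ 2)) *
      (Real.exp (2 * l * a * v) + Real.exp (-(2 * l * a * v))) := by
    rw [Fintype.sum_bool, mul_add, ← Real.exp_add, ← Real.exp_add]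
    simp only [bitSign]
    congr 2 <;> simp <;> ring
  rw [e]
  calc _ ≤ Real.exp (l * (a ^ 2 + v ^ 2)) * (2 * Real.exp ((2 * l * a * v) ^ 2 / 2)) := by
        gcongr; linarith
    _ = _ := by
        rw [mul_left_comm, ← Real.exp_add, ← Real.exp_add]; ring_nf

lemma sum_bool_pi_succ {D : ℕ} (F : (Fin (D + 1) → Bool) → ℝ) :
    ∑ t, F t = ∑ t' : Fin D → Bool, ∑ t : Bool, F (Fin.cons t t') := by
  rw [← (Fin.consEquiv fun _ => Bool).sum_comp, Fintype.sum_prod_type, Finset.sum_comm]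
  rfl

/-- Exponential moment of the square of a random signed sum, obtained by averaging over one sign
at a time. -/
lemma sum_exp_sq_le {D : ℕ} : ∀ (v : Fin D → ℝ) (a l L : ℝ), 0 ≤ l → 0 ≤ L →
    l * (1 + 2 * L * ∑ j, v j ^ 2) ≤ L →
    ∑ t : Fin D → Bool, Real.exp (l * (a + ∑ j, v j * bitSign (t j)) ^ 2) ≤
      2 ^ D * Real.exp (L * (a ^ 2 + ∑ j, v j ^ 2)) := by
  induction D with
  | zero =>
    intro v a l L hl hL h
    simp only [Finset.univ_eq_empty, Finset.sum_empty, mul_zero, add_zero, mul_one] at h ⊢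
    simp only [Finset.sum_const, Finset.card_univ, Fintype.card_pi, Finset.univ_eq_empty,
      Finset.prod_empty, one_smul, pow_zero, one_mul]
    exact Real.exp_le_exp.2 (mul_le_mul_of_nonneg_right h (sq_nonneg a))
  | succ D ih =>
    intro v a l L hl hL h
    set V' := ∑ j : Fin D, v j.succ ^ 2 with hV'
    have hV0 : 0 ≤ V' := Finset.sum_nonneg fun j _ => sq_nonneg _
    rw [Fin.sum_univ_succ, ← hV'] at h ⊢
    rw [sum_bool_pi_succ]
    have hv0 := sq_nonneg (v 0)
    have hlL' : l * (1 + 2 * L * V') ≤ L := by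
      refine le_trans ?_ h
      gcongr
      linarith
    have hlL : l ≤ L := by nlinarith [mul_nonneg hl (mul_nonneg hL hV0)]
    have step : ∀ t' : Fin D → Bool, ∑ t : Bool, Real.exp (l * (a + ∑ j : Fin (D + 1),
        v j * bitSign ((Fin.cons t t' : Fin (D + 1) → Bool) j)) ^ 2) ≤
        2 * Real.exp (l * v 0 ^ 2) * Real.exp ((l + 2 * l ^ 2 * v 0 ^ 2) *
          (a + ∑ j : Fin D, v j.succ * bitSign (t' j)) ^ 2) := by
      intro t'
      have h1 := sum_bool_exp_le l (a + ∑ j : Fin D, v j.succ * bitSign (t' j)) (v 0)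
      refine le_trans (le_of_eq ?_) (h1.trans (le_of_eq (by ring)))
      refine Finset.sum_congr rfl fun t _ => ?_
      rw [Fin.sum_univ_succ]
      simp only [Fin.cons_zero, Fin.cons_succ]
      ring_nf
    refine (Finset.sum_le_sum fun t' _ => step t').trans ?_
    rw [← Finset.mul_sum]
    have h2 := ih (fun j => v j.succ) a (l + 2 * l ^ 2 * v 0 ^ 2) L (by positivity) hL (by
      rw [← hV']
      calc (l + 2 * l ^ 2 * v 0 ^ 2) * (1 + 2 * L * V')
          = l * (1 + 2 * L * V') + 2 * l * v 0 ^ 2 * (l * (1 + 2 * L * V')) := by ring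
        _ ≤ l * (1 + 2 * L * V') + 2 * l * v 0 ^ 2 * L := by gcongr
        _ = l * (1 + 2 * L * (v 0 ^ 2 + V')) := by ring
        _ ≤ L := h)
    rw [← hV'] at h2
    calc _ ≤ 2 * Real.exp (l * v 0 ^ 2) * (2 ^ D * Real.exp (L * (a ^ 2 + V'))) := by gcongr
      _ = 2 ^ (D + 1) * Real.exp (l * v 0 ^ 2 + L * (a ^ 2 + V')) := by
          rw [Real.exp_add]; ring
      _ ≤ 2 ^ (D + 1) * Real.exp (L * (a ^ 2 + (v 0 ^ 2 + V'))) := by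
          gcongr
          nlinarith

/-- The counterpart of `sum_exp_sq_le` for the lower tail. -/
lemma sum_exp_neg_sq_le {D : ℕ} : ∀ (v : Fin D → ℝ) (a l : ℝ), 0 ≤ l →
    2 * l * ∑ j, v j ^ 2 ≤ 1 →
    ∑ t : Fin D → Bool, Real.exp (-l * (a + ∑ j, v j * bitSign (t j)) ^ 2) ≤
      2 ^ D * Real.exp (-(l - 2 * l ^ 2 * ∑ j, v j ^ 2) * (a ^ 2 + ∑ j, v j ^ 2)) := by
  induction D with
  | zero =>
    intro v a l hl h
    simp
  | succ D ih =>
    intro v a l hl h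
    set V' := ∑ j : Fin D, v j.succ ^ 2 with hV'
    have hV0 : 0 ≤ V' := Finset.sum_nonneg fun j _ => sq_nonneg _
    rw [Fin.sum_univ_succ, ← hV'] at h ⊢
    rw [sum_bool_pi_succ]
    have hv0 := sq_nonneg (v 0)
    have hlv : 0 ≤ l * v 0 ^ 2 := mul_nonneg hl hv0
    have hlV : 0 ≤ l * V' := mul_nonneg hl hV0
    have step : ∀ t' : Fin D → Bool, ∑ t : Bool, Real.exp (-l * (a + ∑ j : Fin (D + 1),
        v j * bitSign ((Fin.cons t t' : Fin (D + 1) → Bool) j)) ^ 2) ≤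
        2 * Real.exp (-l * v 0 ^ 2) * Real.exp (-(l - 2 * l ^ 2 * v 0 ^ 2) *
          (a + ∑ j : Fin D, v j.succ * bitSign (t' j)) ^ 2) := by
      intro t'
      have h1 := sum_bool_exp_le (-l) (a + ∑ j : Fin D, v j.succ * bitSign (t' j)) (v 0)
      refine le_trans (le_of_eq ?_) (h1.trans (le_of_eq ?_))
      · refine Finset.sum_congr rfl fun t _ => ?_
        rw [Fin.sum_univ_succ]
        simp only [Fin.cons_zero, Fin.cons_succ]
        ring_nf
      · ring_nf
    refine (Finset.sum_le_sum fun t' _ => step t').trans ?_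
    rw [← Finset.mul_sum]
    set l' := l - 2 * l ^ 2 * v 0 ^ 2 with hl'
    have hl'0 : 0 ≤ l' := by
      have : l' = l * (1 - 2 * (l * v 0 ^ 2)) := by rw [hl']; ring
      rw [this]
      exact mul_nonneg hl (by linarith)
    have hl'l : l' ≤ l := by rw [hl']; nlinarith [mul_nonneg (sq_nonneg l) hv0]
    have h2 := ih (fun j => v j.succ) a l' hl'0 (by
      rw [← hV']
      have := mul_le_mul_of_nonneg_right hl'l hV0
      linarith)
    rw [← hV'] at h2
    have hsq : l' ^ 2 * V' ≤ l ^ 2 * V' := by gcongr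
    have key : l - 2 * l ^ 2 * (v 0 ^ 2 + V') ≤ l' - 2 * l' ^ 2 * V' := by
      rw [hl'] at hsq ⊢; linarith
    have key2 : l - 2 * l ^ 2 * (v 0 ^ 2 + V') ≤ l := by
      nlinarith [mul_nonneg (sq_nonneg l) hv0, mul_nonneg (sq_nonneg l) hV0]
    calc _ ≤ 2 * Real.exp (-l * v 0 ^ 2) *
          (2 ^ D * Real.exp (-(l' - 2 * l' ^ 2 * V') * (a ^ 2 + V'))) := by gcongr
      _ = 2 ^ (D + 1) * Real.exp (-l * v 0 ^ 2 + -(l' - 2 * l' ^ 2 * V') * (a ^ 2 + V')) := by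
          rw [Real.exp_add]; ring
      _ ≤ _ := by
          gcongr
          have a1 := mul_le_mul_of_nonneg_right key (add_nonneg (sq_nonneg a) hV0)
          have a2 := mul_le_mul_of_nonneg_right key2 hv0
          linarith

variable {D m : ℕ}

/-- The squared norm of the sketch of `v` by the sign matrix `s`. -/
def sketchSq (v : Fin D → ℝ) (s : Fin m → Fin D → Bool) : ℝ :=
  ∑ l, (∑ j, v j * bitSign (s l j)) ^ 2

/-- The rows of the sign matrix are independent, so the exponential moments multiply. -/
lemma sum_exp_sketchSq (v : Fin D → ℝ) (c : ℝ) :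
    ∑ s : Fin m → Fin D → Bool, Real.exp (c * sketchSq v s) =
      (∑ t : Fin D → Bool, Real.exp (c * (0 + ∑ j, v j * bitSign (t j)) ^ 2)) ^ m := by
  rw [← Finset.card_fin m, ← Finset.prod_const, Finset.prod_univ_sum, Finset.card_fin]
  simp only [Fintype.piFinset_univ, zero_add, sketchSq, Finset.mul_sum, Real.exp_sum]

open Classical in
/-- Markov's inequality for the exponential moment, by counting sign matrices. -/
lemma card_mul_exp_le (v : Fin D → ℝ) (c t : ℝ) :
    (({s : Fin m → Fin D → Bool | t ≤ c * sketchSq v s} : Finset _).card : ℝ) * Real.exp t ≤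
      ∑ s : Fin m → Fin D → Bool, Real.exp (c * sketchSq v s) := by
  rw [← nsmul_eq_mul, ← Finset.sum_const]
  refine (Finset.sum_le_sum fun s hs => ?_).trans (Finset.sum_le_sum_of_subset_of_nonneg
    (Finset.subset_univ _) fun s _ _ => (Real.exp_pos _).le)
  exact Real.exp_le_exp.2 (Finset.mem_filter.1 hs).2

/-- The sketch preserves the squared norm of `v` up to a factor `4`. -/
def SketchGood (v : Fin D → ℝ) (s : Fin m → Fin D → Bool) : Prop :=
  m / 4 * ∑ j, v j ^ 2 ≤ sketchSq v s ∧ sketchSq v s ≤ 4 * m * ∑ j, v j ^ 2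

open Classical in
/-- The exponential moments are taken at `1 / (8 V)` for the upper and at `1 / (4 V)` for the lower
tail, with `V` the squared norm of `v`. -/
lemma card_not_sketchGood_le (v : Fin D → ℝ) :
    (({s : Fin m → Fin D → Bool | ¬ SketchGood v s} : Finset _).card : ℝ) ≤
      2 * (2 ^ D) ^ m * Real.exp (-(m / 16)) := by
  set V := ∑ j, v j ^ 2 with hV
  have hV0 : 0 ≤ V := Finset.sum_nonneg fun j _ => sq_nonneg _
  rcases hV0.eq_or_lt with h0 | hpos
  · have hv : ∀ j, v j = 0 := fun j => by
      have := (Finset.sum_eq_zero_iff_of_nonneg (fun j _ => sq_nonneg (v j))).1 h0.symm j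
        (Finset.mem_univ j)
      exact pow_eq_zero_iff (two_ne_zero) |>.1 this
    have : ({s : Fin m → Fin D → Bool | ¬ SketchGood v s} : Finset _) = ∅ := by
      refine Finset.filter_eq_empty_iff.2 fun s _ => ?_
      simp [SketchGood, sketchSq, hv]
    rw [this]
    simp only [Finset.card_empty, Nat.cast_zero]
    positivity
  have hup : (({s : Fin m → Fin D → Bool | (m / 2 : ℝ) ≤ 1 / (8 * V) * sketchSq v s} :
      Finset _).card : ℝ) ≤ (2 ^ D) ^ m * Real.exp (-(m / 16)) := by
    have h1 := card_mul_exp_le (m := m) v (1 / (8 * V)) (m / 2)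
    rw [sum_exp_sketchSq] at h1
    have h2 := sum_exp_sq_le v 0 (1 / (8 * V)) (1 / (6 * V)) (by positivity) (by positivity) (by
      rw [← hV]; apply le_of_eq; field_simp; norm_num)
    have h3 := h1.trans (pow_le_pow_left₀ (Finset.sum_nonneg fun t _ => (Real.exp_pos _).le) h2 m)
    rw [mul_pow, ← Real.exp_nat_mul, ← hV] at h3
    have e : (m : ℝ) * (1 / (6 * V) * (0 ^ 2 + V)) = m / 6 := by field_simp; ring
    rw [e] at h3
    rw [← mul_le_mul_iff_left₀ (Real.exp_pos (m / 2))]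
    refine h3.trans ?_
    rw [mul_assoc, ← Real.exp_add]
    gcongr
    have : (0 : ℝ) ≤ m := Nat.cast_nonneg m
    linarith
  have hlo : (({s : Fin m → Fin D → Bool | (-(m / 16) : ℝ) ≤ -(1 / (4 * V)) * sketchSq v s} :
      Finset _).card : ℝ) ≤ (2 ^ D) ^ m * Real.exp (-(m / 16)) := by
    have h1 := card_mul_exp_le (m := m) v (-(1 / (4 * V))) (-(m / 16))
    rw [sum_exp_sketchSq] at h1
    have h2 := sum_exp_neg_sq_le v 0 (1 / (4 * V)) (by positivity) (by
      rw [← hV]; field_simp; norm_num)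
    have h3 := h1.trans (pow_le_pow_left₀ (Finset.sum_nonneg fun t _ => (Real.exp_pos _).le) h2 m)
    rw [mul_pow, ← Real.exp_nat_mul, ← hV] at h3
    have e : (m : ℝ) * (-(1 / (4 * V) - 2 * (1 / (4 * V)) ^ 2 * V) * (0 ^ 2 + V)) = -(m / 8) := by
      field_simp; ring
    rw [e] at h3
    rw [← mul_le_mul_iff_left₀ (Real.exp_pos (-(m / 16)))]
    refine h3.trans (le_of_eq ?_)
    rw [mul_assoc, ← Real.exp_add]
    ring_nf
  have hsub : ({s : Fin m → Fin D → Bool | ¬ SketchGood v s} : Finset _) ⊆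
      ({s : Fin m → Fin D → Bool | (-(m / 16) : ℝ) ≤ -(1 / (4 * V)) * sketchSq v s} : Finset _) ∪
      ({s : Fin m → Fin D → Bool | (m / 2 : ℝ) ≤ 1 / (8 * V) * sketchSq v s} : Finset _) := by
    intro s hs
    rw [Finset.mem_filter, SketchGood, not_and_or, not_le, not_le] at hs
    rw [Finset.mem_union, Finset.mem_filter, Finset.mem_filter]
    rcases hs.2 with h | h
    · left
      refine ⟨Finset.mem_univ _, ?_⟩
      rw [neg_mul, neg_le_neg_iff, one_div, inv_mul_le_iff₀ (by positivity)]
      linarith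
    · right
      refine ⟨Finset.mem_univ _, ?_⟩
      rw [one_div, le_inv_mul_iff₀ (by positivity)]
      linarith
  have hc := Finset.card_le_card hsub
  have hc2 : (({s : Fin m → Fin D → Bool | ¬ SketchGood v s} : Finset _).card : ℝ) ≤ _ :=
    Nat.cast_le.2 (hc.trans (Finset.card_union_le _ _))
  push_cast at hc2
  linarith

open Classical in
/-- With logarithmically many sketch vectors, all rows of `U` are preserved for all but a small
fraction of the sign matrices. -/
lemma card_not_forall_sketchGood_le {n : ℕ} (U : Matrix (Fin n) (Fin D) ℝ) {L : ℕ}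
    (hL : n ≤ 2 ^ L) (hm : m = 16 * (L + 5)) :
    (({s : Fin m → Fin D → Bool | ¬ ∀ i, SketchGood (U i) s} : Finset _).card : ℝ) ≤
      1 / 50 * (2 ^ D) ^ m := by
  have hsub : ({s : Fin m → Fin D → Bool | ¬ ∀ i, SketchGood (U i) s} : Finset _) ⊆
      Finset.univ.biUnion fun i : Fin n =>
        ({s : Fin m → Fin D → Bool | ¬ SketchGood (U i) s} : Finset _) := by
    intro s hs
    simp only [Finset.mem_filter, Finset.mem_univ, true_and, not_forall] at hs
    simpa using hs
  have h1 : (({s : Fin m → Fin D → Bool | ¬ ∀ i, SketchGood (U i) s} : Finset _).card : ℝ) ≤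
      ∑ i : Fin n, (({s : Fin m → Fin D → Bool | ¬ SketchGood (U i) s} : Finset _).card : ℝ) := by
    exact_mod_cast (Finset.card_le_card hsub).trans Finset.card_biUnion_le
  refine h1.trans ((Finset.sum_le_sum fun i _ => card_not_sketchGood_le (U i)).trans ?_)
  rw [Finset.sum_const, Finset.card_univ, Fintype.card_fin, nsmul_eq_mul]
  have e1 : (m : ℝ) / 16 = L + 5 := by rw [hm]; push_cast; ring
  have e2 : (n : ℝ) ≤ Real.exp L := by
    calc (n : ℝ) ≤ 2 ^ L := by exact_mod_cast hL
      _ ≤ Real.exp 1 ^ L := by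
        gcongr
        have := Real.add_one_le_exp (1 : ℝ)
        linarith
      _ = Real.exp L := by rw [← Real.exp_nat_mul, mul_one]
  have e3 : Real.exp (-5) ≤ 1 / 100 := by
    rw [Real.exp_neg, inv_eq_one_div]
    apply one_div_le_one_div_of_le (by norm_num)
    calc (100 : ℝ) ≤ 2.7 ^ 5 := by norm_num
      _ ≤ Real.exp 1 ^ 5 := by
        gcongr
        exact (by norm_num : (2.7 : ℝ) ≤ 2.7182818283).trans Real.exp_one_gt_d9.le
      _ = Real.exp 5 := by rw [← Real.exp_nat_mul]; norm_num
  rw [e1]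
  calc (n : ℝ) * (2 * (2 ^ D) ^ m * Real.exp (-(L + 5)))
      ≤ Real.exp L * (2 * (2 ^ D) ^ m * Real.exp (-(L + 5))) := by gcongr
    _ = 2 * (2 ^ D) ^ m * Real.exp (-5) := by
      rw [mul_left_comm, ← Real.exp_add]; ring_nf
    _ ≤ 2 * (2 ^ D) ^ m * (1 / 100) := by gcongr
    _ = _ := by ring

end sketch

/-! ### The random tape -/

namespace RealRAM

open ProbabilityTheory

lemma iIndepFun_tape : iIndepFun (fun (i : ℕ) (ω : Tape) => ω i) tapeLaw :=
  iIndepFun_infinitePi (P := fun _ : ℕ => (volume : Measure unitInterval)) (X := fun _ x => x)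
    fun _ => measurable_id

instance : IsProbabilityMeasure tapeLaw := by
  unfold tapeLaw; infer_instance

lemma tapeLaw_preimage_eval (k : ℕ) {s : Set unitInterval} (hs : MeasurableSet s) :
    tapeLaw {ω | ω k ∈ s} = volume s :=
  (measurePreserving_eval_infinitePi (fun _ : ℕ => (volume : Measure unitInterval)) k).measure_preimage
    hs.nullMeasurableSet

lemma volume_lt {p : ℝ} (h0 : 0 ≤ p) (h1 : p ≤ 1) :
    volume {x : unitInterval | (x : ℝ) < p} = ENNReal.ofReal p :=
  unitInterval.volume_Iio ⟨p, h0, h1⟩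

lemma volume_not_lt {p : ℝ} (h0 : 0 ≤ p) (h1 : p ≤ 1) :
    volume {x : unitInterval | ¬ (x : ℝ) < p} = ENNReal.ofReal (1 - p) := by
  have : {x : unitInterval | ¬ (x : ℝ) < p} = Set.Ici ⟨p, h0, h1⟩ := by
    ext x
    simp only [Set.mem_ofPred_eq, not_lt, Set.mem_Ici]
    exact Iff.rfl
  rw [this, unitInterval.volume_Ici]

lemma measurableSet_lt_coe (p : ℝ) : MeasurableSet {x : unitInterval | (x : ℝ) < p} :=
  measurableSet_lt measurable_subtype_coe measurable_const

/-- The weight decided by a single random number. -/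
def drawWeight (p : ℝ) (x : unitInterval) : ℝ := if (x : ℝ) < p then 1 / p else 0

lemma measurable_drawWeight (p : ℝ) : Measurable (drawWeight p) :=
  Measurable.ite (measurableSet_lt_coe p) measurable_const measurable_const

lemma map_drawWeight {p : ℝ} (h0 : 0 ≤ p) (h1 : p ≤ 1) :
    Measure.map (drawWeight p) volume = weightAtom p := by
  ext s hs
  rw [Measure.map_apply (measurable_drawWeight p) hs]
  have e : drawWeight p ⁻¹' s = ({x : unitInterval | (x : ℝ) < p} ∩ {_x | 1 / p ∈ s}) ∪
      ({x : unitInterval | ¬ (x : ℝ) < p} ∩ {_x | (0 : ℝ) ∈ s}) := by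
    ext x
    simp only [Set.mem_preimage, drawWeight, Set.mem_union, Set.mem_inter_iff, Set.mem_ofPred_eq]
    split_ifs with h <;> simp [h]
  have hd : Disjoint ({x : unitInterval | (x : ℝ) < p} ∩ {_x | 1 / p ∈ s})
      ({x : unitInterval | ¬ (x : ℝ) < p} ∩ {_x | (0 : ℝ) ∈ s}) := by
    rw [Set.disjoint_left]
    rintro x ⟨hx, -⟩ ⟨hx', -⟩
    exact hx' hx
  have hm : MeasurableSet ({x : unitInterval | ¬ (x : ℝ) < p} ∩ {_x | (0 : ℝ) ∈ s}) :=
    (measurableSet_lt_coe p).compl.inter (MeasurableSet.const _)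
  rw [e, measure_union hd hm, weightAtom, Measure.add_apply, Measure.smul_apply,
    Measure.smul_apply, Measure.dirac_apply' _ hs, Measure.dirac_apply' _ hs, smul_eq_mul,
    smul_eq_mul, ← volume_lt h0 h1, ← volume_not_lt h0 h1]
  congr 1
  · by_cases h : 1 / p ∈ s
    · rw [Set.indicator_of_mem h]; simp only [h]; simp
    · rw [Set.indicator_of_notMem h]; simp only [h]; simp
  · by_cases h : (0 : ℝ) ∈ s
    · rw [Set.indicator_of_mem h]; simp only [h]; simp
    · rw [Set.indicator_of_notMem h]; simp only [h]; simp

/-- Weights drawn from the tape have the law of the random weights. -/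
lemma map_drawWeights (q : ℕ) {n : ℕ} {p : Fin n → ℝ} (hp : ∀ i, 0 ≤ p i ∧ p i ≤ 1) :
    Measure.map (fun ω => drawWeights ω q p) tapeLaw = weightLaw p := by
  have hinj : Function.Injective fun i : Fin n => q + (i : ℕ) := by
    intro i j h
    exact Fin.ext (Nat.add_left_cancel h)
  have h1 := (iIndepFun_tape.precomp hinj).comp (fun i => drawWeight (p i))
    (fun i => measurable_drawWeight (p i))
  have hmeas : ∀ i : Fin n, Measurable ((drawWeight (p i)) ∘ fun ω : Tape => ω (q + i)) :=
    fun i => (measurable_drawWeight (p i)).comp (measurable_pi_apply _)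
  have h2 := (iIndepFun_iff_map_fun_eq_pi_map fun i => (hmeas i).aemeasurable).1 h1
  rw [weightLaw_eq]
  refine h2.trans ?_
  congr 1
  ext1 i
  rw [← Measure.map_map (measurable_drawWeight (p i)) (measurable_pi_apply (q + (i : ℕ)))]
  have h3 : Measure.map (fun ω : Tape => ω (q + i)) tapeLaw = volume :=
    (measurePreserving_eval_infinitePi
      (fun _ : ℕ => (volume : Measure unitInterval)) (q + i)).map_eq
  rw [h3, map_drawWeight (hp i).1 (hp i).2]

/-- The table of random bits read from the tape, row by row, starting at position `q`. -/
def tapeBits (ω : Tape) (q m D : ℕ) : Fin m → Fin D → Bool :=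
  fun l j => decide ((ω (q + (l * D + j)) : ℝ) < 1 / 2)

lemma measurable_decide_lt : Measurable fun x : unitInterval => decide ((x : ℝ) < 1 / 2) := by
  have : (fun x : unitInterval => decide ((x : ℝ) < 1 / 2)) =
      fun x : unitInterval => if (x : ℝ) < 1 / 2 then true else false := by
    funext x
    by_cases h : (x : ℝ) < 1 / 2
    · rw [if_pos h, decide_eq_true h]
    · rw [if_neg h, decide_eq_false h]
  rw [this]
  exact Measurable.ite (measurableSet_lt_coe _) measurable_const measurable_const

lemma mul_add_lt {m D l j : ℕ} (hl : l < m) (hj : j < D) : l * D + j < m * D := by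
  calc l * D + j < l * D + D := by omega
    _ = (l + 1) * D := by ring
    _ ≤ m * D := Nat.mul_le_mul_right _ hl

/-- The bits read from the tape are uniformly distributed over the sign matrices. -/
lemma tapeLaw_tapeBits_eq (q : ℕ) {m D : ℕ} (s : Fin m → Fin D → Bool) :
    tapeLaw {ω | tapeBits ω q m D = s} = ENNReal.ofReal (((2 ^ D) ^ m)⁻¹) := by
  have hinj : Function.Injective fun x : Fin m × Fin D => q + ((x.1 : ℕ) * D + x.2) := by
    rintro ⟨l, j⟩ ⟨l', j'⟩ h
    have h1 : (l : ℕ) * D + j = l' * D + j' := Nat.add_left_cancel h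
    have hD : 0 < D := j.pos
    have h2 : ((l : ℕ) * D + j) / D = l := by
      rw [mul_comm, Nat.mul_add_div hD, Nat.div_eq_of_lt j.2, add_zero]
    have h3 : ((l' : ℕ) * D + j') / D = l' := by
      rw [mul_comm, Nat.mul_add_div hD, Nat.div_eq_of_lt j'.2, add_zero]
    have h4 : (l : ℕ) = l' := by rw [← h2, ← h3, h1]
    have h5 : (j : ℕ) = j' := by rw [h4] at h1; omega
    exact Prod.ext (Fin.ext h4) (Fin.ext h5)
  have h1 := (iIndepFun_tape.precomp hinj).measure_inter_preimage_eq_mul Finset.univ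
    (sets := fun x => {y : unitInterval | decide ((y : ℝ) < 1 / 2) = s x.1 x.2})
    (fun x _ => measurable_decide_lt (measurableSet_singleton (s x.1 x.2)))
  have e : {ω | tapeBits ω q m D = s} = ⋂ x ∈ (Finset.univ : Finset (Fin m × Fin D)),
      (fun ω : Tape => ω (q + ((x.1 : ℕ) * D + x.2))) ⁻¹'
        {y : unitInterval | decide ((y : ℝ) < 1 / 2) = s x.1 x.2} := by
    ext ω
    simp only [Set.mem_ofPred_eq, Finset.mem_univ, Set.iInter_true, Set.mem_iInter,
      Set.mem_preimage, funext_iff, tapeBits, Prod.forall]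
  rw [e]
  refine h1.trans ?_
  have h2 : ∀ x : Fin m × Fin D, tapeLaw ((fun ω : Tape => ω (q + ((x.1 : ℕ) * D + x.2))) ⁻¹'
        {y : unitInterval | decide ((y : ℝ) < 1 / 2) = s x.1 x.2}) = ENNReal.ofReal (1 / 2) := by
    intro x
    have h3 := tapeLaw_preimage_eval (q + ((x.1 : ℕ) * D + x.2))
      (measurable_decide_lt (measurableSet_singleton (s x.1 x.2)))
    refine h3.trans ?_
    cases h : s x.1 x.2
    · have := volume_not_lt (p := 1 / 2) (by norm_num) (by norm_num)
      rw [show (1 : ℝ) - 1 / 2 = 1 / 2 by norm_num] at this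
      rw [← this]
      congr 1
      ext x
      simp
    · rw [← volume_lt (p := 1 / 2) (by norm_num) (by norm_num)]
      congr 1
      ext x
      simp
  have h3 : ∏ x ∈ (Finset.univ : Finset (Fin m × Fin D)),
      tapeLaw ((fun ω : Tape => ω (q + ((x.1 : ℕ) * D + x.2))) ⁻¹'
        {y : unitInterval | decide ((y : ℝ) < 1 / 2) = s x.1 x.2}) =
      ENNReal.ofReal (((2 ^ D) ^ m)⁻¹) := by
    rw [Finset.prod_congr rfl fun x _ => h2 x, Finset.prod_const, ← ENNReal.ofReal_pow (by norm_num)]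
    congr 1
    rw [Finset.card_univ, Fintype.card_prod, Fintype.card_fin, Fintype.card_fin, one_div, inv_pow,
      ← pow_mul, mul_comm]
  exact h3

/-- The two phases read disjoint parts of the tape. The probabilities are fixed here; those that
depend on the bits are treated by conditioning on the bits. -/
lemma indepFun_tapeBits_drawWeights (q m D : ℕ) {n : ℕ} (p : Fin n → ℝ) :
    IndepFun (fun ω => tapeBits ω q m D) (fun ω => drawWeights ω (q + m * D) p) tapeLaw := by
  set S := Finset.Ico q (q + m * D)
  set T := Finset.Ico (q + m * D) (q + m * D + n)
  have hdisj : Disjoint S T := Finset.Ico_disjoint_Ico_consecutive _ _ _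
  have h := iIndepFun_tape.indepFun_finset S T hdisj fun i => measurable_pi_apply i
  have hS : ∀ (l : Fin m) (j : Fin D), q + ((l : ℕ) * D + j) ∈ S := fun l j =>
    Finset.mem_Ico.2 ⟨by omega, Nat.add_lt_add_left (mul_add_lt l.2 j.2) q⟩
  have hT : ∀ i : Fin n, q + m * D + (i : ℕ) ∈ T := fun i =>
    Finset.mem_Ico.2 ⟨by omega, by omega⟩
  refine h.comp (φ := fun f (l : Fin m) (j : Fin D) =>
    decide ((f ⟨q + ((l : ℕ) * D + j), hS l j⟩ : ℝ) < 1 / 2))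
    (ψ := fun f (i : Fin n) => drawWeight (p i) (f ⟨q + m * D + i, hT i⟩)) ?_ ?_
  · exact measurable_pi_lambda _ fun l => measurable_pi_lambda _ fun j =>
      measurable_decide_lt.comp (measurable_pi_apply _)
  · exact measurable_pi_lambda _ fun i =>
      (measurable_drawWeight (p i)).comp (measurable_pi_apply _)

open Classical in
/-- Failure probability of the two random phases: the probabilities `P s` of the second phase
depend on the bits `s` drawn in the first one. -/
lemma tapeLaw_two_phase (q : ℕ) {m D n : ℕ} (Good : (Fin m → Fin D → Bool) → Prop)
    (P : (Fin m → Fin D → Bool) → Fin n → ℝ) (B : Set (Fin n → ℝ)) (hB : MeasurableSet B)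
    (hP : ∀ s i, 0 ≤ P s i ∧ P s i ≤ 1) {γ δ : ℝ} (hγ : 0 ≤ γ) (hδ : 0 ≤ δ)
    (hGood : (({s | ¬ Good s} : Finset (Fin m → Fin D → Bool)).card : ℝ) ≤ γ * (2 ^ D) ^ m)
    (hPB : ∀ s, Good s → weightLaw (P s) B ≤ ENNReal.ofReal δ) :
    tapeLaw {ω | ¬ (Good (tapeBits ω q m D) ∧
      drawWeights ω (q + m * D) (P (tapeBits ω q m D)) ∉ B)} ≤ ENNReal.ofReal (γ + δ) := by
  set N : ℝ := (2 ^ D) ^ m with hN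
  have hN0 : 0 < N := by positivity
  have hsub : {ω | ¬ (Good (tapeBits ω q m D) ∧
      drawWeights ω (q + m * D) (P (tapeBits ω q m D)) ∉ B)} ⊆
      (⋃ s ∈ ({s | ¬ Good s} : Finset (Fin m → Fin D → Bool)), {ω | tapeBits ω q m D = s}) ∪
      ⋃ s ∈ ({s | Good s} : Finset (Fin m → Fin D → Bool)),
        ((fun ω => tapeBits ω q m D) ⁻¹' {s} ∩
          (fun ω => drawWeights ω (q + m * D) (P s)) ⁻¹' B) := by
    intro ω hω
    simp only [Set.mem_ofPred_eq, not_and_or, not_not] at hω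
    by_cases hg : Good (tapeBits ω q m D)
    · right
      have hw := hω.resolve_left (not_not.2 hg)
      simp only [Set.mem_iUnion, Finset.mem_filter, Finset.mem_univ, true_and, exists_prop]
      exact ⟨_, hg, rfl, hw⟩
    · left
      simp only [Set.mem_iUnion, Finset.mem_filter, Finset.mem_univ, true_and, exists_prop]
      exact ⟨_, hg, rfl⟩
  have h1 : tapeLaw (⋃ s ∈ ({s | ¬ Good s} : Finset (Fin m → Fin D → Bool)),
      {ω | tapeBits ω q m D = s}) ≤ ENNReal.ofReal γ := by
    refine (measure_biUnion_finset_le _ _).trans ?_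
    rw [Finset.sum_congr rfl fun s _ => tapeLaw_tapeBits_eq q s, Finset.sum_const, nsmul_eq_mul,
      ← ENNReal.ofReal_natCast, ← ENNReal.ofReal_mul (by positivity)]
    apply ENNReal.ofReal_le_ofReal
    rw [← hN, ← div_eq_mul_inv, div_le_iff₀ hN0]
    exact hGood
  have h2 : tapeLaw (⋃ s ∈ ({s | Good s} : Finset (Fin m → Fin D → Bool)),
        ((fun ω => tapeBits ω q m D) ⁻¹' {s} ∩
          (fun ω => drawWeights ω (q + m * D) (P s)) ⁻¹' B)) ≤ ENNReal.ofReal δ := by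
    have h3 : ∀ s ∈ ({s | Good s} : Finset (Fin m → Fin D → Bool)),
        tapeLaw ((fun ω => tapeBits ω q m D) ⁻¹' {s} ∩
          (fun ω => drawWeights ω (q + m * D) (P s)) ⁻¹' B) ≤ ENNReal.ofReal (N⁻¹ * δ) := by
      intro s hs
      have hmeas : Measurable fun ω => drawWeights ω (q + m * D) (P s) :=
        measurable_pi_lambda _ fun i =>
          (measurable_drawWeight (P s i)).comp (measurable_pi_apply _)
      rw [(indepFun_tapeBits_drawWeights q m D (P s)).measure_inter_preimage_eq_mul _ _
        (measurableSet_singleton s) hB, ← Measure.map_apply hmeas hB,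
        map_drawWeights _ (hP s), ENNReal.ofReal_mul (by positivity)]
      refine mul_le_mul' (le_of_eq (tapeLaw_tapeBits_eq q s)) (hPB s ?_)
      simpa using hs
    refine (measure_biUnion_finset_le _ _).trans ((Finset.sum_le_sum h3).trans ?_)
    rw [Finset.sum_const, nsmul_eq_mul, ← ENNReal.ofReal_natCast,
      ← ENNReal.ofReal_mul (by positivity)]
    apply ENNReal.ofReal_le_ofReal
    have hc : ((({s | Good s} : Finset (Fin m → Fin D → Bool)).card : ℕ) : ℝ) ≤ N := by
      have := Finset.card_le_univ ({s | Good s} : Finset (Fin m → Fin D → Bool))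
      rw [Fintype.card_pi, Finset.prod_const, Fintype.card_pi, Finset.prod_const, Fintype.card_bool,
        Finset.card_univ, Finset.card_univ, Fintype.card_fin, Fintype.card_fin] at this
      rw [hN]
      exact_mod_cast this
    calc _ ≤ N * (N⁻¹ * δ) := by gcongr
      _ = δ := by field_simp
  calc _ ≤ _ := measure_mono hsub
    _ ≤ _ := measure_union_le _ _
    _ ≤ _ := add_le_add h1 h2
    _ = _ := (ENNReal.ofReal_add hγ hδ).symm

end RealRAM

/-! ### Descent with difference quotients -/

section descent

variable {G : ℝ → ℝ} {CG : ℝ} {n d : ℕ}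

/-- The relative difference quotient of `G` at `c`, a substitute for a subgradient which needs
evaluations of `G` only. At `c = 0` it is `0`. -/
def relSlope (G : ℝ → ℝ) (η c : ℝ) : ℝ := (G ((1 + η) * c) - G c) / (η * c)

/-- The subgradient inequality for the difference quotient, with a relative error. -/
lemma IsOrliczFunction.le_map_of_relSlope (hG : IsOrliczFunction G CG) {η : ℝ} (hη : 0 < η)
    (hη1 : η ≤ 1) (c c' : ℝ) :
    (1 - 4 * CG * η) * G c + relSlope G η c * (c' - c) ≤ G c' := by
  have hgrow : ∀ c, G ((1 + η) * c) - G c ≤ 4 * CG * η * G c := by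
    intro c
    have h1 := hG.convexOn_univ.2 (Set.mem_univ c) (Set.mem_univ (2 * c)) (sub_nonneg.2 hη1) hη.le
      (by ring)
    have e : (1 - η) • c + η • (2 * c) = (1 + η) * c := by simp only [smul_eq_mul]; ring
    rw [e] at h1
    have h2 := hG.map_mul_le_sq one_le_two c
    have h3 := mul_le_mul_of_nonneg_left h2 hη.le
    have h4 := hG.nonneg c
    simp only [smul_eq_mul] at h1
    nlinarith
  -- by evenness it suffices to consider `c > 0`
  have main : ∀ c c', 0 < c → (1 - 4 * CG * η) * G c + relSlope G η c * (c' - c) ≤ G c' := by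
    intro c c' hc
    have hηc : 0 < η * c := mul_pos hη hc
    set t := (1 + η) * c with ht
    have htc : t - c = η * c := by rw [ht]; ring
    have hct : c < t := by linarith
    set s := relSlope G η c with hs
    have hsη : s * (η * c) = G t - G c := by rw [hs, relSlope, div_mul_cancel₀ _ hηc.ne']
    have hs0 : 0 ≤ s := div_nonneg (sub_nonneg.2 (hG.mono hc.le hct.le)) hηc.le
    have hgc := hgrow c
    have hs' : s = (G t - G c) / (t - c) := by rw [htc]; rfl
    rcases lt_trichotomy c' c with h | h | h
    · have h1 := hG.convexOn_univ.slope_mono_adjacent (Set.mem_univ c') (Set.mem_univ t) h hct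
      rw [← hs', div_le_iff₀ (by linarith)] at h1
      have : 0 ≤ G t - G c := sub_nonneg.2 (hG.mono hc.le hct.le)
      nlinarith
    · have : 0 ≤ G t - G c := sub_nonneg.2 (hG.mono hc.le hct.le)
      rw [h]
      nlinarith
    · rcases le_or_gt c' t with h' | h'
      · have h1 : s * (c' - c) ≤ s * (η * c) := by
          apply mul_le_mul_of_nonneg_left _ hs0; linarith
        have h2 := hG.mono hc.le h.le
        linarith
      · have h1 := hG.convexOn_univ.secant_mono (Set.mem_univ c) (Set.mem_univ t)
          (Set.mem_univ c') hct.ne' (by linarith : c' ≠ c) h'.le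
        rw [← hs', le_div_iff₀ (by linarith)] at h1
        have : 0 ≤ G t - G c := sub_nonneg.2 (hG.mono hc.le hct.le)
        nlinarith
  rcases lt_trichotomy c 0 with hc | rfl | hc
  · have h := main (-c) (-c') (by linarith)
    have e : relSlope G η (-c) = -relSlope G η c := by
      rw [relSlope, relSlope, mul_neg, ← hG.even, ← hG.even, mul_neg, div_neg]
    rw [e, ← hG.even, ← hG.even] at h
    linarith
  · simp only [relSlope, mul_zero, div_zero, zero_mul, hG.map_zero, add_zero]
    exact hG.nonneg _
  · exact main c c' hc

/-- The point of the affine subspace belonging to the coordinates `z`: the last coordinate of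
`R (x, -1)` is `-r` for every `x`, with `r` the last diagonal entry of `R`. -/
def affPoint (r : ℝ) (z : Fin d → ℝ) : Fin (d + 1) → ℝ := Fin.snoc z (-r)

lemma l2_snoc_sq (z : Fin d → ℝ) (t : ℝ) :
    l2 (Fin.snoc z t : Fin (d + 1) → ℝ) ^ 2 = ∑ j, z j ^ 2 + t ^ 2 := by
  rw [l2_sq, Fin.sum_univ_castSucc]
  simp only [Fin.snoc_castSucc, Fin.snoc_last]

lemma affPoint_sub (r : ℝ) (z z' : Fin d → ℝ) :
    affPoint r z - affPoint r z' = (Fin.snoc (z - z') 0 : Fin (d + 1) → ℝ) := by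
  ext j
  refine Fin.lastCases ?_ (fun j => ?_) j
  · simp [affPoint]
  · simp [affPoint]

/-- State of the descent: the current point, the best point found, and the current scale, which is
the level whose attainability is being tested. -/
structure Descent (d : ℕ) where
  /-- the current point -/
  z : Fin d → ℝ
  /-- the last point that attained the current level -/
  best : Fin d → ℝ
  /-- the level to be attained -/
  scale : ℝ

/-- Parameters of the descent step. -/
structure DescentParams (n d : ℕ) where
  /-- weights of the rows -/
  w : Fin n → ℝ
  /-- conditioned matrix -/
  U : Matrix (Fin n) (Fin (d + 1)) ℝ
  /-- the points of the affine subspace have last coordinate `-r` -/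
  r : ℝ
  /-- accuracy -/
  ε : ℝ
  /-- step length -/
  ρ : ℝ
  /-- relative increment of the difference quotients -/
  η : ℝ

namespace DescentParams

variable (P : DescentParams n d)

/-- The row sums relative to the scale. -/
def coord (z : Fin d → ℝ) (α : ℝ) (i : Fin n) : ℝ := (P.U *ᵥ affPoint P.r z) i / α

/-- The approximate subgradient of `z ↦ ∑ wᵢ G(cᵢ)`, up to the factor `α`. -/
def grad (G : ℝ → ℝ) (z : Fin d → ℝ) (α : ℝ) (j : Fin d) : ℝ :=
  ∑ i, P.w i * relSlope G P.η (P.coord z α i) * P.U i j.castSucc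

/-- Euclidean length of the approximate subgradient. -/
def gradNorm (G : ℝ → ℝ) (z : Fin d → ℝ) (α : ℝ) : ℝ := Real.sqrt (∑ j, P.grad G z α j ^ 2)

open Classical in
/-- If the current point attains the level, record it and lower the level; otherwise make a step of
fixed length against the approximate subgradient. -/
def step (G : ℝ → ℝ) (s : Descent d) : Descent d :=
  if 1 < ∑ i, P.w i * G (P.coord s.z s.scale i) then
    { s with z := fun j => s.z j - P.ρ * P.grad G s.z s.scale j / P.gradNorm G s.z s.scale }
  else { z := s.z, best := s.z, scale := s.scale * (1 - P.ε / 16) }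

/-- The objective function. -/
def objective (G : ℝ → ℝ) (z : Fin d → ℝ) : ℝ := weightedOrliczNorm G P.w (P.U *ᵥ affPoint P.r z)

lemma sum_coord_eq (hG : IsOrliczFunction G CG) (z : Fin d → ℝ) {α : ℝ} (hα : 0 < α) :
    ∑ i, P.w i * G (P.coord z α i) = orliczSum G P.w (P.U *ᵥ affPoint P.r z) α := by
  refine Finset.sum_congr rfl fun i _ => ?_
  rw [← hG.map_abs (P.coord z α i), coord, abs_div, abs_of_pos hα]

/-- The approximate subgradient separates the current point from points of smaller value. -/
lemma grad_separates (hG : IsOrliczFunction G CG) (hw : 0 ≤ P.w) (hη : 0 < P.η) (hη1 : P.η ≤ 1)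
    {α : ℝ} (hα : 0 < α) (z ζ : Fin d → ℝ) :
    ∑ j, P.grad G z α j * (ζ j - z j) ≤ α * (orliczSum G P.w (P.U *ᵥ affPoint P.r ζ) α -
      (1 - 4 * CG * P.η) * orliczSum G P.w (P.U *ᵥ affPoint P.r z) α) := by
  have hdiff : ∀ i, P.coord ζ α i - P.coord z α i =
      α⁻¹ * ∑ j : Fin d, P.U i j.castSucc * (ζ j - z j) := by
    intro i
    have : (P.U *ᵥ affPoint P.r ζ) i - (P.U *ᵥ affPoint P.r z) i =
        ∑ j : Fin d, P.U i j.castSucc * (ζ j - z j) := by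
      rw [← Pi.sub_apply, ← Matrix.mulVec_sub, affPoint_sub, Matrix.mulVec, dotProduct,
        Fin.sum_univ_castSucc]
      simp
    rw [coord, coord, ← sub_div, this]
    field_simp
  have h1 : (1 - 4 * CG * P.η) * ∑ i, P.w i * G (P.coord z α i) +
      ∑ i, P.w i * relSlope G P.η (P.coord z α i) * (P.coord ζ α i - P.coord z α i) ≤
      ∑ i, P.w i * G (P.coord ζ α i) := by
    rw [Finset.mul_sum, ← Finset.sum_add_distrib]
    refine Finset.sum_le_sum fun i _ => ?_
    have := mul_le_mul_of_nonneg_left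
      (hG.le_map_of_relSlope hη hη1 (P.coord z α i) (P.coord ζ α i)) (hw i)
    linarith
  rw [P.sum_coord_eq hG _ hα, P.sum_coord_eq hG _ hα] at h1
  have h2 : ∑ j, P.grad G z α j * (ζ j - z j) = α *
      ∑ i, P.w i * relSlope G P.η (P.coord z α i) * (P.coord ζ α i - P.coord z α i) := by
    simp only [hdiff, grad, Finset.sum_mul, Finset.mul_sum]
    rw [Finset.sum_comm]
    refine Finset.sum_congr rfl fun i _ => Finset.sum_congr rfl fun j _ => ?_
    field_simp
  rw [h2]
  apply mul_le_mul_of_nonneg_left _ hα.le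
  linarith

/-- What the analysis needs: the objective is comparable to the Euclidean norm, and step length and
increment are chosen accordingly. -/
structure Valid (G : ℝ → ℝ) (CG κ : ℝ) : Prop where
  orlicz : IsOrliczFunction G CG
  w_nonneg : 0 ≤ P.w
  kappa : 1 ≤ κ
  lower : ∀ y, 1 / 2 * l2 y ≤ weightedOrliczNorm G P.w (P.U *ᵥ y)
  upper : ∀ y, weightedOrliczNorm G P.w (P.U *ᵥ y) ≤ 2 * κ * l2 y
  r_ne : P.r ≠ 0
  eps_pos : 0 < P.ε
  eps_le : P.ε ≤ 1 / 2
  rho : P.ρ = P.ε * |P.r| / (256 * κ)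
  eta : P.η = P.ε / (256 * CG)

namespace Valid

variable {P} {κ : ℝ}

lemma r_le_objective (h : P.Valid G CG κ) (z : Fin d → ℝ) : |P.r| / 2 ≤ P.objective G z := by
  have h1 := h.lower (affPoint P.r z)
  have h2 : |P.r| ≤ l2 (affPoint P.r z) := by
    have := abs_le_l2 (affPoint P.r z) (Fin.last d)
    simpa [affPoint] using this
  unfold objective
  linarith

lemma rho_pos (h : P.Valid G CG κ) : 0 < P.ρ := by
  have := abs_pos.2 h.r_ne
  have := h.eps_pos
  have := h.kappa
  rw [h.rho]
  positivity

/-- All points within the step length of a point `z'` have a value which is clearly smaller than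
the level, as long as the level is not close to the value of `z'`. -/
lemma orliczSum_le_of_close (h : P.Valid G CG κ) {z' ζ : Fin d → ℝ} {α : ℝ}
    (hα : (1 + P.ε / 16) * P.objective G z' ≤ α) (hζ : ∑ j, (ζ j - z' j) ^ 2 ≤ P.ρ ^ 2) :
    orliczSum G P.w (P.U *ᵥ affPoint P.r ζ) α ≤ 1 - P.ε / 32 := by
  have hε := h.eps_pos
  have hε1 := h.eps_le
  have hκ := h.kappa
  have hv := h.r_le_objective z'
  have hr : 0 < |P.r| := abs_pos.2 h.r_ne
  have hα0 : 0 < α := lt_of_lt_of_le (mul_pos (by positivity)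
    (lt_of_lt_of_le (by positivity) hv)) hα
  have h1 : P.objective G ζ ≤ P.objective G z' + 2 * κ * P.ρ := by
    have e : P.U *ᵥ affPoint P.r ζ =
        P.U *ᵥ affPoint P.r z' + P.U *ᵥ (Fin.snoc (ζ - z') 0 : Fin (d + 1) → ℝ) := by
      rw [← affPoint_sub P.r, ← Matrix.mulVec_add, add_sub_cancel]
    have h2 : l2 (Fin.snoc (ζ - z') 0 : Fin (d + 1) → ℝ) ≤ P.ρ := by
      apply le_of_sq_le_sq _ h.rho_pos.le
      rw [l2_snoc_sq]
      simpa using hζ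
    rw [objective, e]
    refine (weightedOrliczNorm_add_le h.orlicz h.w_nonneg).trans ?_
    have := h.upper (Fin.snoc (ζ - z') 0)
    have : 2 * κ * l2 (Fin.snoc (ζ - z') 0 : Fin (d + 1) → ℝ) ≤ 2 * κ * P.ρ := by gcongr
    unfold objective
    linarith
  have h2 : 2 * κ * P.ρ = P.ε / 64 * (|P.r| / 2) := by
    rw [h.rho]; field_simp; norm_num
  refine orliczSum_le_of_norm_le h.orlicz h.w_nonneg hα0 (by linarith) (by linarith) ?_
  change P.objective G ζ ≤ _
  have h3 : P.ε / 64 * (|P.r| / 2) ≤ P.ε / 64 * P.objective G z' := by gcongr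
  have h4 : (1 - P.ε / 32) * ((1 + P.ε / 16) * P.objective G z') ≤ (1 - P.ε / 32) * α :=
    mul_le_mul_of_nonneg_left hα (by linarith)
  have h5 : (1 + P.ε / 64) * P.objective G z' ≤
      (1 - P.ε / 32) * (1 + P.ε / 16) * P.objective G z' := by
    apply mul_le_mul_of_nonneg_right _ (by linarith [abs_nonneg P.r])
    nlinarith
  linarith

/-- A step against the approximate subgradient `g` brings the current point closer to `z'`: the
subgradient separates `z` not only from `z'` but even from `z' + ρ g / |g|`, so the step gains at
least `ρ ^ 2`. -/
lemma dist_step_le (h : P.Valid G CG κ) {z z' : Fin d → ℝ} {α : ℝ}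
    (hα : (1 + P.ε / 16) * P.objective G z' ≤ α)
    (hz : 1 < ∑ i, P.w i * G (P.coord z α i)) :
    ∑ j, (z j - P.ρ * P.grad G z α j / P.gradNorm G z α - z' j) ^ 2 ≤
      ∑ j, (z j - z' j) ^ 2 - P.ρ ^ 2 := by
  have hε := h.eps_pos
  have hε1 := h.eps_le
  have hρ := h.rho_pos
  have hCG := h.orlicz.one_le_const
  have hr : 0 < |P.r| := abs_pos.2 h.r_ne
  have hα0 : 0 < α := lt_of_lt_of_le (mul_pos (by positivity)
    (lt_of_lt_of_le (by positivity) (h.r_le_objective z'))) hα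
  have hη : 0 < P.η := by rw [h.eta]; positivity
  have hη1 : P.η ≤ 1 := by rw [h.eta, div_le_one (by positivity)]; linarith
  have hη2 : 4 * CG * P.η = P.ε / 64 := by rw [h.eta]; field_simp; norm_num
  rw [P.sum_coord_eq h.orlicz z hα0] at hz
  have sep : ∀ ζ : Fin d → ℝ, ∑ j, (ζ j - z' j) ^ 2 ≤ P.ρ ^ 2 →
      ∑ j, P.grad G z α j * (ζ j - z j) < 0 := by
    intro ζ hζ
    have h1 := P.grad_separates h.orlicz h.w_nonneg hη hη1 hα0 z ζ
    have h2 := h.orliczSum_le_of_close hα hζ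
    rw [hη2] at h1
    refine h1.trans_lt (mul_neg_of_pos_of_neg hα0 ?_)
    nlinarith
  set g := P.grad G z α with hg
  set N := P.gradNorm G z α with hN
  have hN2 : N ^ 2 = ∑ j, g j ^ 2 := by
    rw [hN, gradNorm, Real.sq_sqrt (Finset.sum_nonneg fun j _ => sq_nonneg _)]
  have hN0 : 0 < N := by
    -- a vanishing subgradient would not separate `z` from `z'`
    refine (Real.sqrt_nonneg _).lt_of_ne fun h0 => ?_
    have hz0 : N = 0 := h0.symm
    rw [hz0] at hN2
    have hgj : ∀ j, g j = 0 := fun j => by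
      have := (Finset.sum_eq_zero_iff_of_nonneg (fun j _ => sq_nonneg (g j))).1
        (by rw [← hN2]; norm_num) j (Finset.mem_univ j)
      exact pow_eq_zero_iff two_ne_zero |>.1 this
    have := sep z' (by simp [sq_nonneg])
    simp [hgj] at this
  have h1 := sep (fun j => z' j + P.ρ * g j / N) (by
    apply le_of_eq
    calc ∑ j, (z' j + P.ρ * g j / N - z' j) ^ 2 = (P.ρ / N) ^ 2 * ∑ j, g j ^ 2 := by
          rw [Finset.mul_sum]; exact Finset.sum_congr rfl fun j _ => by ring
      _ = P.ρ ^ 2 := by rw [← hN2]; field_simp)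
  have h2 : ∑ j, g j * (z' j + P.ρ * g j / N - z j) =
      P.ρ * N - ∑ j, g j * (z j - z' j) := by
    have : P.ρ * N = P.ρ / N * ∑ j, g j ^ 2 := by rw [← hN2]; field_simp
    rw [this, Finset.mul_sum, ← Finset.sum_sub_distrib]
    exact Finset.sum_congr rfl fun j _ => by ring
  rw [h2] at h1
  have h3 : ∑ j, (z j - P.ρ * g j / N - z' j) ^ 2 =
      ∑ j, (z j - z' j) ^ 2 - 2 * (P.ρ / N) * ∑ j, g j * (z j - z' j) +
        (P.ρ / N) ^ 2 * ∑ j, g j ^ 2 := by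
    rw [Finset.mul_sum, Finset.mul_sum, ← Finset.sum_sub_distrib, ← Finset.sum_add_distrib]
    exact Finset.sum_congr rfl fun j _ => by ring
  rw [h3, ← hN2]
  have h4 : (P.ρ / N) ^ 2 * N ^ 2 = P.ρ ^ 2 := by field_simp
  have h5 : 2 * (P.ρ / N) * (P.ρ * N) = 2 * P.ρ ^ 2 := by field_simp
  have h6 : 2 * (P.ρ / N) * (P.ρ * N) ≤ 2 * (P.ρ / N) * ∑ j, g j * (z j - z' j) := by
    apply mul_le_mul_of_nonneg_left (by linarith) (by positivity)
  linarith

/-- The potential of the descent, relative to a comparison point. -/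
def potential (P : DescentParams n d) (z' : Fin d → ℝ) (s : Descent d) : ℝ :=
  (∑ j, (s.z j - z' j) ^ 2) / P.ρ ^ 2 + 32 * s.scale / (P.ε * |P.r|)

/-- Every step lowers the potential by one until the level is close to the value of `z'`; meanwhile
the best point attains the previous level. -/
lemma step_invariant (h : P.Valid G CG κ) (z' : Fin d → ℝ) {c : ℝ} {s : Descent d}
    (h0 : 0 < s.scale) (hb : (1 - P.ε / 16) * P.objective G s.best ≤ s.scale)
    (hp : s.scale < (1 + P.ε / 16) * P.objective G z' ∨ potential P z' s ≤ c) :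
    0 < (P.step G s).scale ∧
    (1 - P.ε / 16) * P.objective G (P.step G s).best ≤ (P.step G s).scale ∧
    ((P.step G s).scale < (1 + P.ε / 16) * P.objective G z' ∨
      potential P z' (P.step G s) ≤ c - 1) := by
  have hε := h.eps_pos
  have hε1 := h.eps_le
  have hr : 0 < |P.r| := abs_pos.2 h.r_ne
  have hρ := h.rho_pos
  unfold step
  split_ifs with hc
  · refine ⟨h0, hb, ?_⟩
    rcases lt_or_ge s.scale ((1 + P.ε / 16) * P.objective G z') with hlt | hge
    · exact Or.inl hlt
    right
    have hp' := hp.resolve_left (not_lt.2 hge)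
    have h1 := h.dist_step_le hge hc
    unfold potential at hp' ⊢
    have h2 := div_le_div_of_nonneg_right h1 (sq_nonneg P.ρ)
    rw [sub_div, div_self (by positivity)] at h2
    simp only
    linarith
  · rw [not_lt, P.sum_coord_eq h.orlicz _ h0,
      ← weightedOrliczNorm_le_iff h.orlicz h.w_nonneg h0] at hc
    refine ⟨mul_pos h0 (by linarith), ?_, ?_⟩
    · simp only
      rw [mul_comm]
      exact mul_le_mul_of_nonneg_right hc (by linarith)
    · rcases lt_or_ge s.scale ((1 + P.ε / 16) * P.objective G z') with hlt | hge
      · left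
        simp only
        nlinarith
      right
      have hp' := hp.resolve_left (not_lt.2 hge)
      have hv := h.r_le_objective z'
      have h3 : |P.r| / 2 ≤ s.scale := by nlinarith
      unfold potential at hp' ⊢
      simp only
      have h4 : 32 * (s.scale * (1 - P.ε / 16)) / (P.ε * |P.r|) =
          32 * s.scale / (P.ε * |P.r|) - s.scale / (|P.r| / 2) := by
        field_simp; ring
      have h5 : 1 ≤ s.scale / (|P.r| / 2) := by rwa [one_le_div (by positivity)]
      rw [h4]
      linarith

/-- The descent finds an approximate minimizer within `2 ^ 21 κ ^ 4 / ε ^ 2` steps. -/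
theorem objective_best_le (h : P.Valid G CG κ) {N : ℕ} (hN : 2 ^ 21 * κ ^ 4 ≤ N * P.ε ^ 2)
    (z' : Fin d → ℝ) :
    P.objective G ((P.step G)^[N] ⟨0, 0, 2 * κ * |P.r|⟩).best ≤
      (1 + P.ε / 4) * P.objective G z' := by
  have hε := h.eps_pos
  have hε1 := h.eps_le
  have hκ := h.kappa
  have hr : 0 < |P.r| := abs_pos.2 h.r_ne
  have hρ := h.rho_pos
  have h00 : P.objective G 0 ≤ 2 * κ * |P.r| := by
    refine (h.upper _).trans ?_
    have h1 : l2 (affPoint P.r (0 : Fin d → ℝ)) ≤ |P.r| := by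
      apply le_of_sq_le_sq _ hr.le
      rw [affPoint, l2_snoc_sq]
      simp
    gcongr
  -- points worse than the origin need not be compared with
  wlog hz' : P.objective G z' ≤ P.objective G 0 generalizing z'
  · refine (this 0 le_rfl).trans ?_
    gcongr
    exact (not_le.1 hz').le
  have hsq : ∑ j, z' j ^ 2 ≤ 16 * κ ^ 2 * |P.r| ^ 2 := by
    have h1 := h.lower (affPoint P.r z')
    have h2 : l2 (affPoint P.r z') ≤ 4 * κ * |P.r| := by
      unfold objective at hz' h00
      linarith
    have h3 := pow_le_pow_left₀ (l2_nonneg _) h2 2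
    rw [affPoint, l2_snoc_sq] at h3
    nlinarith [sq_nonneg (-P.r)]
  set s₀ : Descent d := ⟨0, 0, 2 * κ * |P.r|⟩ with hs₀
  have hpot : potential P z' s₀ ≤ 2 ^ 21 * κ ^ 4 / P.ε ^ 2 := by
    have h1 : (∑ j, (s₀.z j - z' j) ^ 2) / P.ρ ^ 2 ≤ 2 ^ 20 * κ ^ 4 / P.ε ^ 2 := by
      have e : ∑ j, (s₀.z j - z' j) ^ 2 = ∑ j, z' j ^ 2 := by simp [hs₀]
      rw [e]
      calc _ ≤ 16 * κ ^ 2 * |P.r| ^ 2 / P.ρ ^ 2 := by gcongr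
        _ = _ := by rw [h.rho]; field_simp; norm_num
    have h2 : 32 * s₀.scale / (P.ε * |P.r|) ≤ 2 ^ 20 * κ ^ 4 / P.ε ^ 2 := by
      have e : 32 * s₀.scale / (P.ε * |P.r|) = 64 * κ * P.ε / P.ε ^ 2 := by
        simp only [hs₀]; field_simp; norm_num
      rw [e]
      apply div_le_div_of_nonneg_right _ (sq_nonneg P.ε)
      have h3 : κ ≤ κ ^ 4 := le_self_pow₀ hκ (by norm_num)
      nlinarith
    unfold potential
    calc _ ≤ 2 ^ 20 * κ ^ 4 / P.ε ^ 2 + 2 ^ 20 * κ ^ 4 / P.ε ^ 2 := add_le_add h1 h2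
      _ = _ := by ring
  have inv : ∀ k : ℕ, 0 < ((P.step G)^[k] s₀).scale ∧
      (1 - P.ε / 16) * P.objective G ((P.step G)^[k] s₀).best ≤ ((P.step G)^[k] s₀).scale ∧
      (((P.step G)^[k] s₀).scale < (1 + P.ε / 16) * P.objective G z' ∨
        potential P z' ((P.step G)^[k] s₀) ≤ 2 ^ 21 * κ ^ 4 / P.ε ^ 2 - k) := by
    intro k
    induction k with
    | zero =>
      refine ⟨by simp only [Function.iterate_zero, id, hs₀]; positivity, ?_, Or.inr ?_⟩
      · simp only [Function.iterate_zero, id, hs₀]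
        have h0 : 0 ≤ P.objective G (0 : Fin d → ℝ) := weightedOrliczNorm_nonneg
        nlinarith
      · simpa using hpot
    | succ k ih =>
      rw [Function.iterate_succ_apply']
      have := h.step_invariant z' ih.1 ih.2.1 ih.2.2
      refine ⟨this.1, this.2.1, this.2.2.imp_right fun h => h.trans (le_of_eq ?_)⟩
      push_cast; ring
  obtain ⟨h1, h2, h3⟩ := inv N
  have h4 : ((P.step G)^[N] s₀).scale < (1 + P.ε / 16) * P.objective G z' := by
    refine h3.resolve_right fun hle => ?_
    have hpos : 0 < potential P z' ((P.step G)^[N] s₀) := by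
      unfold potential
      have : 0 ≤ ∑ j, (((P.step G)^[N] s₀).z j - z' j) ^ 2 :=
        Finset.sum_nonneg fun j _ => sq_nonneg _
      positivity
    have : 2 ^ 21 * κ ^ 4 / P.ε ^ 2 ≤ N := by rwa [div_le_iff₀ (by positivity)]
    linarith
  have h5 : 0 ≤ P.objective G z' := weightedOrliczNorm_nonneg
  have h6 : (1 + P.ε / 16) * P.objective G z' ≤
      (1 - P.ε / 16) * ((1 + P.ε / 4) * P.objective G z') := by
    rw [← mul_assoc]
    apply mul_le_mul_of_nonneg_right _ h5
    nlinarith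
  exact le_of_mul_le_mul_left (h2.trans (h4.le.trans h6)) (by linarith)

end Valid

end DescentParams

end descent

/-! ### Step-counting program logic -/

namespace RealRAM

variable {G : ℝ → ℝ} {ω : Tape}

/-- The integer arrays a program may write to. -/
def Cmd.intWrites : Cmd → List ℕ
  | .skip => []
  | .iset a _ _ _ => [a]
  | .rset _ _ _ _ => []
  | .rand _ _ _ => []
  | .seq c c' => c.intWrites ++ c'.intWrites
  | .ite _ c c' => c.intWrites ++ c'.intWrites
  | .loop _ c => c.intWrites

/-- The real arrays a program may write to. -/
def Cmd.realWrites : Cmd → List ℕ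
  | .skip => []
  | .iset _ _ _ _ => []
  | .rset a _ _ _ => [a]
  | .rand a _ _ => [a]
  | .seq c c' => c.realWrites ++ c'.realWrites
  | .ite _ c c' => c.realWrites ++ c'.realWrites
  | .loop _ c => c.realWrites

/-- The program reads no random numbers. -/
def Cmd.noRand : Cmd → Bool
  | .skip => true
  | .iset _ _ _ _ => true
  | .rset _ _ _ _ => true
  | .rand _ _ _ => false
  | .seq c c' => c.noRand && c'.noRand
  | .ite _ c c' => c.noRand && c'.noRand
  | .loop _ c => c.noRand

/-- `σ'` differs from `σ` only in the arrays that `c` may write to, and in the position of the tape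
only if `c` reads random numbers. -/
structure Frame (c : Cmd) (σ σ' : State) : Prop where
  int : ∀ a, a ∉ c.intWrites → σ'.int a = σ.int a
  real : ∀ a, a ∉ c.realWrites → σ'.real a = σ.real a
  pos : c.noRand = true → σ'.pos = σ.pos

lemma Frame.refl (c : Cmd) (σ : State) : Frame c σ σ := ⟨fun _ _ => rfl, fun _ _ => rfl, fun _ => rfl⟩

lemma Frame.trans {c : Cmd} {σ σ' σ'' : State} (h : Frame c σ σ') (h' : Frame c σ' σ'') :
    Frame c σ σ'' :=
  ⟨fun a ha => (h'.int a ha).trans (h.int a ha), fun a ha => (h'.real a ha).trans (h.real a ha),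
    fun hn => (h'.pos hn).trans (h.pos hn)⟩

lemma Frame.mono {c c' : Cmd} {σ σ' : State} (h : Frame c σ σ')
    (hi : ∀ a ∈ c.intWrites, a ∈ c'.intWrites) (hr : ∀ a ∈ c.realWrites, a ∈ c'.realWrites)
    (hn : c'.noRand = true → c.noRand = true) : Frame c' σ σ' :=
  ⟨fun a ha => h.int a fun h' => ha (hi a h'), fun a ha => h.real a fun h' => ha (hr a h'),
    fun h' => h.pos (hn h')⟩

lemma Frame.seq_left {c c' : Cmd} {σ σ' : State} (h : Frame c σ σ') : Frame (.seq c c') σ σ' :=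
  h.mono (fun _ ha => List.mem_append_left _ ha) (fun _ ha => List.mem_append_left _ ha)
    fun hn => (Bool.and_eq_true_iff.1 hn).1

lemma Frame.seq_right {c c' : Cmd} {σ σ' : State} (h : Frame c' σ σ') : Frame (.seq c c') σ σ' :=
  h.mono (fun _ ha => List.mem_append_right _ ha) (fun _ ha => List.mem_append_right _ ha)
    fun hn => (Bool.and_eq_true_iff.1 hn).2

lemma Frame.loop {c : Cmd} {u : BExp} {σ σ' : State} (h : Frame c σ σ') : Frame (.loop u c) σ σ' :=
  h.mono (fun _ ha => ha) (fun _ ha => ha) fun hn => hn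

lemma frame_setInt (σ : State) (a i j v : ℕ) (ei ej e : IExp) :
    Frame (.iset a ei ej e) σ (σ.setInt a i j v) := by
  refine ⟨fun a' ha => ?_, fun _ _ => rfl, fun _ => rfl⟩
  funext i' j'
  have : a' ≠ a := fun h => ha (by simp [Cmd.intWrites, h])
  simp [State.setInt, this]

lemma frame_setReal (σ : State) (a i j : ℕ) (v : ℝ) (ei ej : IExp) (e : RExp) :
    Frame (.rset a ei ej e) σ (σ.setReal a i j v) := by
  refine ⟨fun _ _ => rfl, fun a' ha => ?_, fun _ => rfl⟩
  funext i' j'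
  have : a' ≠ a := fun h => ha (by simp [Cmd.realWrites, h])
  simp [State.setReal, this]

/-- Programs change only the arrays they write to. -/
lemma Exec.frame {c : Cmd} {σ σ' : State} {t : ℕ} (h : Exec G ω c σ σ' t) : Frame c σ σ' := by
  induction h with
  | skip σ => exact Frame.refl _ _
  | iset σ a i j e => exact frame_setInt _ _ _ _ _ _ _ _
  | rset σ a i j e => exact frame_setReal _ _ _ _ _ _ _ _
  | rand σ a i j =>
    refine ⟨fun _ _ => rfl, fun a' ha => ?_, fun hn => by simp [Cmd.noRand] at hn⟩
    funext i' j'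
    have : a' ≠ a := fun h => ha (by simp [Cmd.realWrites, h])
    simp [State.setReal, this]
  | seq _ _ h h' => exact h.seq_left.trans h'.seq_right
  | ite_true _ _ h =>
    exact h.mono (fun _ ha => List.mem_append_left _ ha) (fun _ ha => List.mem_append_left _ ha)
      fun hn => (Bool.and_eq_true_iff.1 hn).1
  | ite_false _ _ h =>
    exact h.mono (fun _ ha => List.mem_append_right _ ha) (fun _ ha => List.mem_append_right _ ha)
      fun hn => (Bool.and_eq_true_iff.1 hn).2
  | loop_done _ => exact Frame.refl _ _
  | loop_step _ _ _ h h' => exact h.loop.trans h'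

/-- Started in `σ`, the program `c` halts within `T` steps in a state satisfying `Q`. -/
def Runs (G : ℝ → ℝ) (ω : Tape) (c : Cmd) (σ : State) (T : ℕ) (Q : State → Prop) : Prop :=
  ∃ σ' t, Exec G ω c σ σ' t ∧ t ≤ T ∧ Q σ'

section rules

variable {c c' : Cmd} {σ : State} {T T' : ℕ} {P Q : State → Prop}

lemma Runs.mono (h : Runs G ω c σ T P) (hT : T ≤ T') (hQ : ∀ σ', Frame c σ σ' → P σ' → Q σ') :
    Runs G ω c σ T' Q := by
  obtain ⟨σ', t, hE, ht, hP⟩ := h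
  exact ⟨σ', t, hE, ht.trans hT, hQ σ' hE.frame hP⟩

lemma Runs.seq (h : Runs G ω c σ T P)
    (h' : ∀ σ', Frame c σ σ' → P σ' → Runs G ω c' σ' T' Q) :
    Runs G ω (.seq c c') σ (T + T') Q := by
  obtain ⟨σ', t, hE, ht, hP⟩ := h
  obtain ⟨σ'', t', hE', ht', hQ⟩ := h' σ' hE.frame hP
  exact ⟨σ'', t + t', .seq hE hE', by omega, hQ⟩

lemma runs_skip (h : Q σ) : Runs G ω .skip σ 1 Q := ⟨σ, 1, .skip σ, le_rfl, h⟩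

lemma runs_iset {a : ℕ} {i j e : IExp} (h : Q (σ.setInt a (i.eval σ) (j.eval σ) (e.eval σ))) :
    Runs G ω (.iset a i j e) σ (i.cost + j.cost + e.cost + 1) Q :=
  ⟨_, _, .iset σ a i j e, le_rfl, h⟩

lemma runs_rset {a : ℕ} {i j : IExp} {e : RExp}
    (h : Q (σ.setReal a (i.eval σ) (j.eval σ) (e.eval G σ))) :
    Runs G ω (.rset a i j e) σ (i.cost + j.cost + e.cost + 1) Q :=
  ⟨_, _, .rset σ a i j e, le_rfl, h⟩

lemma runs_ite {u : BExp} (h : u.holds G σ → Runs G ω c σ T Q)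
    (h' : ¬ u.holds G σ → Runs G ω c' σ T' Q) :
    Runs G ω (.ite u c c') σ (u.cost + (T + T')) Q := by
  by_cases hu : u.holds G σ
  · obtain ⟨σ', t, hE, ht, hQ⟩ := h hu
    exact ⟨σ', _, .ite_true hu hE, by omega, hQ⟩
  · obtain ⟨σ', t, hE, ht, hQ⟩ := h' hu
    exact ⟨σ', _, .ite_false hu hE, by omega, hQ⟩

/-- The rule for loops, with an invariant indexed by the number of completed rounds. -/
lemma runs_loop {u : BExp} {Inv : ℕ → State → Prop} (N : ℕ) (T : ℕ → ℕ) (h0 : Inv 0 σ)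
    (hstep : ∀ k σ', Frame (.loop u c) σ σ' → Inv k σ' → u.holds G σ' →
      k < N ∧ Runs G ω c σ' (T k) (Inv (k + 1)))
    (hQ : ∀ k σ', Frame (.loop u c) σ σ' → k ≤ N → Inv k σ' → ¬ u.holds G σ' → Q σ') :
    Runs G ω (.loop u c) σ (∑ k ∈ Finset.range N, (T k + u.cost) + u.cost) Q := by
  have main : ∀ r k σ', k + r = N → Frame (.loop u c) σ σ' → Inv k σ' →
      Runs G ω (.loop u c) σ' (∑ i ∈ Finset.range r, (T (k + i) + u.cost) + u.cost) Q := by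
    intro r
    induction r with
    | zero =>
      intro k σ' hk hF hI
      have hu : ¬ u.holds G σ' := fun hu => by
        have := (hstep k σ' hF hI hu).1
        omega
      exact ⟨σ', _, .loop_done hu, by simp, hQ k σ' hF (by omega) hI hu⟩
    | succ r ih =>
      intro k σ' hk hF hI
      by_cases hu : u.holds G σ'
      · obtain ⟨σ'', t, hE, ht, hI'⟩ := (hstep k σ' hF hI hu).2
        obtain ⟨σ₃, t', hE', ht', hQ'⟩ := ih (k + 1) σ'' (by omega)
          (hF.trans hE.frame.loop) hI'
        refine ⟨σ₃, _, .loop_step hu hE hE', ?_, hQ'⟩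
        rw [Finset.sum_range_succ']
        have e : ∀ i, k + 1 + i = k + (i + 1) := fun i => by omega
        simp only [e] at ht'
        simp only [add_zero]
        omega
      · exact ⟨σ', _, .loop_done hu, by omega, hQ k σ' hF (by omega) hI hu⟩
  simpa using main N 0 σ (by omega) (Frame.refl _ _) h0

end rules

/-- The integer variable stored in the cell `(0, 0)` of the array `a`. -/
abbrev ivar (a : ℕ) : IExp := .get a (.lit 0) (.lit 0)

/-- The real variable stored in the cell `(0, 0)` of the array `a`. -/
abbrev rvar (a : ℕ) : RExp := .get a (.lit 0) (.lit 0)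

/-- A natural number as a real expression. -/
abbrev rlit (k : ℕ) : RExp := .ofInt (.lit k)

/-- `for v < bound do body`. -/
def forTo (v : ℕ) (bound : IExp) (body : Cmd) : Cmd :=
  .seq (.iset v (.lit 0) (.lit 0) (.lit 0))
    (.loop (.ilt (ivar v) bound)
      (.seq body (.iset v (.lit 0) (.lit 0) (.add (ivar v) (.lit 1)))))

/-- `acc := ∑ v < bound, e`, where the program `pre` is run before each evaluation of `e`. -/
def sumTo (v acc : ℕ) (bound : IExp) (pre : Cmd) (e : RExp) : Cmd :=
  .seq (.rset acc (.lit 0) (.lit 0) (rlit 0))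
    (forTo v bound (.seq pre (.rset acc (.lit 0) (.lit 0) (.add (rvar acc) e))))

/-- `for v < bound do a[ei, ej] := e`, where the program `pre` is run before each assignment. -/
def fillTo (v : ℕ) (bound : IExp) (pre : Cmd) (a : ℕ) (ei ej : IExp) (e : RExp) : Cmd :=
  forTo v bound (.seq pre (.rset a ei ej e))

/-- `for v < bound do a[ei, ej] := if u then e else e'`, where the test and the values may refer
to a fresh random number, which is stored in `a[ei, ej]`. -/
def randTo (v : ℕ) (bound : IExp) (a : ℕ) (ei ej : IExp) (u : BExp) (e e' : RExp) : Cmd :=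
  forTo v bound (.seq (.rand a ei ej) (.ite u (.rset a ei ej e) (.rset a ei ej e')))

section structured

variable {σ : State} {v : ℕ} {bound : IExp} {body pre : Cmd} {Q : State → Prop}

/-- The rule for counting loops; the invariant must not depend on the counter. -/
lemma runs_forTo {Inv : ℕ → State → Prop} (N : ℕ) (T : ℕ → ℕ) (hv : v ∉ body.intWrites)
    (hN : ∀ σ', Frame (forTo v bound body) σ σ' → bound.eval σ' = N)
    (hinv : ∀ k σ' x, Inv k σ' → Inv k (σ'.setInt v 0 0 x)) (h0 : Inv 0 σ)
    (hstep : ∀ k < N, ∀ σ', Frame (forTo v bound body) σ σ' → σ'.int v 0 0 = k → Inv k σ' →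
      Runs G ω body σ' (T k) (Inv (k + 1)))
    (hQ : ∀ σ', Frame (forTo v bound body) σ σ' → Inv N σ' → Q σ') :
    Runs G ω (forTo v bound body) σ
      (∑ k ∈ Finset.range N, (T k + bound.cost + 12) + bound.cost + 8) Q := by
  have hF0 : Frame (forTo v bound body) σ (σ.setInt v 0 0 0) :=
    (frame_setInt σ v 0 0 0 (.lit 0) (.lit 0) (.lit 0)).seq_left
  refine Runs.mono (T := 4 + (∑ k ∈ Finset.range N, ((T k + 8) + (bound.cost + 4)) +
    (bound.cost + 4))) (P := Q) ?_ ?_ fun _ _ h => h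
  swap
  · rw [Finset.sum_congr rfl fun k _ => show T k + 8 + (bound.cost + 4) = T k + bound.cost + 12 by
      omega]
    omega
  refine Runs.seq (P := fun σ' => σ' = σ.setInt v 0 0 0) (runs_iset rfl) ?_
  rintro _ - rfl
  have hcost : (BExp.ilt (ivar v) bound).cost = bound.cost + 4 := by
    simp only [BExp.cost, IExp.cost]; omega
  rw [← hcost]
  refine runs_loop (Inv := fun k σ' => Inv k σ' ∧ σ'.int v 0 0 = k ∧ k ≤ N) N
    (fun k => T k + 8) ⟨hinv _ _ _ h0, by simp [State.setInt], Nat.zero_le _⟩ ?_ ?_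
  · rintro k σ' hF ⟨hI, hk, hkN⟩ hu
    have hF' : Frame (forTo v bound body) σ σ' := hF0.trans hF.seq_right
    simp only [BExp.holds, IExp.eval, hN σ' hF', hk] at hu
    refine ⟨hu, ?_⟩
    refine Runs.seq (hstep k hu σ' hF' hk hI) fun σ'' hF'' hI'' => ?_
    refine Runs.mono (T := 8) (runs_iset (Q := fun σ₃ => σ₃ = σ''.setInt v 0 0 (k + 1)) ?_) le_rfl ?_
    · have : σ''.int v 0 0 = k := by rw [hF''.int v hv, hk]
      simp [IExp.eval, this]
    · rintro _ - rfl
      exact ⟨hinv _ _ _ hI'', by simp [State.setInt], hu⟩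
  · rintro k σ' hF hk ⟨hI, hkv, -⟩ hu
    have hF' : Frame (forTo v bound body) σ σ' := hF0.trans hF.seq_right
    simp only [BExp.holds, IExp.eval, hN σ' hF', hkv, not_lt] at hu
    have : k = N := by omega
    rw [this] at hI
    exact hQ σ' hF' hI

lemma runs_sumTo {acc : ℕ} {e : RExp} (N : ℕ) (f : ℕ → ℝ) (T : ℕ → ℕ) (hv : v ∉ pre.intWrites)
    (hacc : acc ∉ pre.realWrites)
    (hN : ∀ σ', Frame (sumTo v acc bound pre e) σ σ' → bound.eval σ' = N)
    (hpre : ∀ k < N, ∀ σ', Frame (sumTo v acc bound pre e) σ σ' → σ'.int v 0 0 = k →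
      Runs G ω pre σ' (T k) (fun σ'' => e.eval G σ'' = f k)) :
    Runs G ω (sumTo v acc bound pre e) σ
      (∑ k ∈ Finset.range N, (T k + e.cost + bound.cost + 19) + bound.cost + 13)
      (fun σ' => σ'.real acc 0 0 = ∑ k ∈ Finset.range N, f k) := by
  refine Runs.mono (T := 5 + (∑ k ∈ Finset.range N, ((T k + (e.cost + 7)) + bound.cost + 12) +
    bound.cost + 8)) (P := fun σ' => σ'.real acc 0 0 = ∑ k ∈ Finset.range N, f k) ?_ ?_
    fun _ _ h => h
  swap
  · rw [Finset.sum_congr rfl fun k _ => show T k + (e.cost + 7) + bound.cost + 12 =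
      T k + e.cost + bound.cost + 19 by omega]
    omega
  refine Runs.seq (P := fun σ' => σ' = σ.setReal acc 0 0 0)
    (runs_rset (by simp [IExp.eval, RExp.eval])) ?_
  intro σ₁ hF₁ hσ₁
  have hF₁' : Frame (sumTo v acc bound pre e) σ σ₁ := hF₁.seq_left
  refine runs_forTo (Inv := fun k σ' => σ'.real acc 0 0 = ∑ i ∈ Finset.range k, f i) N _
    (by simpa [Cmd.intWrites] using hv) (fun σ' hF => hN σ' (hF₁'.trans hF.seq_right))
    (fun _ _ _ h => h) (by rw [hσ₁]; simp [State.setReal]) ?_ (fun _ _ h => h)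
  intro k hk σ' hF hkv hI
  refine Runs.seq (hpre k hk σ' (hF₁'.trans hF.seq_right) hkv) fun σ'' hF'' he => ?_
  have hcost : (IExp.lit 0).cost + (IExp.lit 0).cost + (RExp.add (rvar acc) e).cost + 1 =
      e.cost + 7 := by
    simp only [IExp.cost, RExp.cost]; omega
  rw [← hcost]
  refine runs_rset ?_
  have : σ''.real acc 0 0 = σ'.real acc 0 0 := by rw [hF''.real acc hacc]
  simp [State.setReal, RExp.eval, IExp.eval, he, this, hI, Finset.sum_range_succ]

lemma runs_fillTo {a : ℕ} {ei ej : IExp} {e : RExp} (N : ℕ) (I J : ℕ → ℕ) (f : ℕ → ℝ) (T : ℕ → ℕ)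
    (hv : v ∉ pre.intWrites) (ha : a ∉ pre.realWrites)
    (hinj : ∀ k < N, ∀ k' < N, I k = I k' → J k = J k' → k = k')
    (hN : ∀ σ', Frame (fillTo v bound pre a ei ej e) σ σ' → bound.eval σ' = N)
    (hpre : ∀ k < N, ∀ σ', Frame (fillTo v bound pre a ei ej e) σ σ' → σ'.int v 0 0 = k →
      (∀ i j, (∀ k' < N, ¬ (I k' = i ∧ J k' = j)) → σ'.real a i j = σ.real a i j) →
      (∀ k', k ≤ k' → k' < N → σ'.real a (I k') (J k') = σ.real a (I k') (J k')) →
      Runs G ω pre σ' (T k) (fun σ'' => ei.eval σ'' = I k ∧ ej.eval σ'' = J k ∧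
        e.eval G σ'' = f k)) :
    Runs G ω (fillTo v bound pre a ei ej e) σ
      (∑ k ∈ Finset.range N, (T k + (ei.cost + ej.cost + e.cost + 1) + bound.cost + 12) +
        bound.cost + 8)
      (fun σ' => (∀ k < N, σ'.real a (I k) (J k) = f k) ∧
        ∀ i j, (∀ k < N, ¬ (I k = i ∧ J k = j)) → σ'.real a i j = σ.real a i j) := by
  refine runs_forTo (Inv := fun k σ' => (∀ k' < k, k' < N → σ'.real a (I k') (J k') = f k') ∧
    (∀ k', k ≤ k' → k' < N → σ'.real a (I k') (J k') = σ.real a (I k') (J k')) ∧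
    ∀ i j, (∀ k < N, ¬ (I k = i ∧ J k = j)) → σ'.real a i j = σ.real a i j) N _
    (by simpa [Cmd.intWrites] using hv) hN (fun _ _ _ h => h)
    ⟨fun k' h => absurd h (Nat.not_lt_zero _), fun _ _ _ => rfl, fun _ _ _ => rfl⟩ ?_
    (fun σ' _ h => ⟨fun k hk => h.1 k hk hk, h.2.2⟩)
  rintro k hk σ' hF hkv ⟨h1, h2, h3⟩
  refine Runs.seq (hpre k hk σ' hF hkv h3 h2) fun σ'' hF'' hev => ?_
  obtain ⟨hi, hj, he⟩ := hev
  refine runs_rset ?_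
  have hra : σ''.real a = σ'.real a := hF''.real a ha
  refine ⟨fun k' hk' hk'N => ?_, fun k' hk' hk'N => ?_, fun i j hij => ?_⟩
  · simp only [State.setReal, hi, hj, he, hra, true_and]
    split_ifs with heq
    · rw [hinj k' hk'N k hk heq.1 heq.2]
    · refine h1 k' ?_ hk'N
      rcases Nat.lt_succ_iff_lt_or_eq.1 hk' with h | h
      · exact h
      · exact absurd ⟨by rw [h], by rw [h]⟩ heq
  · simp only [State.setReal, hi, hj, he, hra, true_and]
    split_ifs with heq
    · have := hinj k' hk'N k hk heq.1 heq.2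
      omega
    · exact h2 k' (by omega) hk'N
  · simp only [State.setReal, hi, hj, he, hra, true_and]
    split_ifs with heq
    · exact absurd ⟨heq.1.symm, heq.2.symm⟩ (hij k hk)
    · exact h3 i j hij

lemma runs_randTo {a : ℕ} {ei ej : IExp} {u : BExp} {e e' : RExp} (N : ℕ) (I J : ℕ → ℕ)
    (f : ℕ → unitInterval → ℝ)
    (hinj : ∀ k < N, ∀ k' < N, I k = I k' → J k = J k' → k = k')
    (hN : ∀ σ', Frame (randTo v bound a ei ej u e e') σ σ' → bound.eval σ' = N)
    (hi : ∀ k < N, ∀ σ', Frame (randTo v bound a ei ej u e e') σ σ' → σ'.int v 0 0 = k →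
      ei.eval σ' = I k ∧ ej.eval σ' = J k)
    (he : ∀ k < N, ∀ σ' x, Frame (randTo v bound a ei ej u e e') σ σ' → σ'.int v 0 0 = k →
      σ'.real a (I k) (J k) = (x : unitInterval) →
      (u.holds G σ' → e.eval G σ' = f k x) ∧ (¬ u.holds G σ' → e'.eval G σ' = f k x)) :
    Runs G ω (randTo v bound a ei ej u e e') σ
      (N * (3 * ei.cost + 3 * ej.cost + u.cost + e.cost + e'.cost + bound.cost + 15) +
        bound.cost + 8)
      (fun σ' => σ'.pos = σ.pos + N ∧ (∀ k < N, σ'.real a (I k) (J k) = f k (ω (σ.pos + k))) ∧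
        ∀ i j, (∀ k < N, ¬ (I k = i ∧ J k = j)) → σ'.real a i j = σ.real a i j) := by
  refine Runs.mono (runs_forTo (Inv := fun k σ' => σ'.pos = σ.pos + k ∧
    (∀ k' < k, k' < N → σ'.real a (I k') (J k') = f k' (ω (σ.pos + k'))) ∧
    ∀ i j, (∀ k < N, ¬ (I k = i ∧ J k = j)) → σ'.real a i j = σ.real a i j)
    (Q := fun σ' => σ'.pos = σ.pos + N ∧
      (∀ k < N, σ'.real a (I k) (J k) = f k (ω (σ.pos + k))) ∧
        ∀ i j, (∀ k < N, ¬ (I k = i ∧ J k = j)) → σ'.real a i j = σ.real a i j) N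
    (fun _ => (ei.cost + ej.cost + 1) + (u.cost + ((ei.cost + ej.cost + e.cost + 1) +
      (ei.cost + ej.cost + e'.cost + 1))))
    (by simp [Cmd.intWrites]) hN (fun _ _ _ h => h)
    ⟨rfl, fun k' h => absurd h (Nat.not_lt_zero _), fun _ _ _ => rfl⟩ ?_
    (fun σ' _ h => ⟨h.1, fun k hk => h.2.1 k hk hk, h.2.2⟩)) ?_ fun _ _ h => h
  swap
  · rw [Finset.sum_const, Finset.card_range, smul_eq_mul]
    exact le_of_eq (by ring)
  rintro k hk σ' hF hkv ⟨h1, h2, h3⟩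
  obtain ⟨hi1, hj1⟩ := hi k hk σ' hF hkv
  set σ₁ : State := { σ'.setReal a (I k) (J k) (ω σ'.pos : ℝ) with pos := σ'.pos + 1 } with hσ₁
  refine Runs.seq (P := fun s => s = σ₁) ⟨_, _, .rand σ' a ei ej, le_rfl, ?_⟩ ?_
  · rw [hi1, hj1]
  rintro _ hF₁ rfl
  have hF₂ : Frame (randTo v bound a ei ej u e e') σ σ₁ := hF.trans
    (Frame.seq_right (Frame.loop (Frame.seq_left (Frame.seq_left hF₁))))
  have hkv₁ : σ₁.int v 0 0 = k := hkv
  obtain ⟨hi2, hj2⟩ := hi k hk σ₁ hF₂ hkv₁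
  obtain ⟨he1, he2⟩ := he k hk σ₁ (ω σ'.pos) hF₂ hkv₁ (by simp [hσ₁, State.setReal])
  have key : ∀ x : ℝ, x = f k (ω σ'.pos) →
      (σ₁.setReal a (I k) (J k) x).pos = σ.pos + (k + 1) ∧
      (∀ k' < k + 1, k' < N →
        (σ₁.setReal a (I k) (J k) x).real a (I k') (J k') = f k' (ω (σ.pos + k'))) ∧
      ∀ i j, (∀ k < N, ¬ (I k = i ∧ J k = j)) →
        (σ₁.setReal a (I k) (J k) x).real a i j = σ.real a i j := by
    rintro x rfl
    refine ⟨by simp [State.setReal, hσ₁, h1, add_assoc], fun k' hk' hk'N => ?_, fun i j hij => ?_⟩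
    · simp only [State.setReal, hσ₁, true_and]
      split_ifs with heq
      · rw [hinj k' hk'N k hk heq.1 heq.2, h1]
      · refine h2 k' ?_ hk'N
        rcases Nat.lt_succ_iff_lt_or_eq.1 hk' with h | h
        · exact h
        · exact absurd ⟨by rw [h], by rw [h]⟩ heq
    · simp only [State.setReal, hσ₁, true_and]
      split_ifs with heq
      · exact absurd ⟨heq.1.symm, heq.2.symm⟩ (hij k hk)
      · exact h3 i j hij
  refine runs_ite (fun hu => runs_rset ?_) (fun hu => runs_rset ?_)
  · rw [hi2, hj2]
    exact key _ (he1 hu)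
  · rw [hi2, hj2]
    exact key _ (he2 hu)

end structured

end RealRAM

/-! ### Sparse rows and inversion of the triangular factor

Memory of the programs: the integer arrays `10`–`13` hold loop variables, `14` the number of
columns of the sketch, `15` a power of two, and `16`, `17` the list of the sampled rows. The real arrays `10`
and `11` hold the inverse factor and an accumulator, `12` and `13` the signs and the sketch, `14`
further accumulators, and `20`–`33` the data of the descent. The remaining arrays are those of the
input and the output. All programs are fixed; constants enter as literals, and every array access
is to an explicitly known array, so that frame conditions can be decided by computation. -/

/-- The entries of a matrix, extended by zero to natural number indices. -/
def natEntry {a b : ℕ} (M : Matrix (Fin a) (Fin b) ℝ) (i j : ℕ) : ℝ :=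
  if h : i < a ∧ j < b then M ⟨i, h.1⟩ ⟨j, h.2⟩ else 0

lemma natEntry_apply {a b : ℕ} (M : Matrix (Fin a) (Fin b) ℝ) (i : Fin a) (j : Fin b) :
    natEntry M i j = M i j := by
  simp [natEntry]

lemma natEntry_of_lt {a b i j : ℕ} (M : Matrix (Fin a) (Fin b) ℝ) (hi : i < a) (hj : j < b) :
    natEntry M i j = M ⟨i, hi⟩ ⟨j, hj⟩ := by
  simp [natEntry, hi, hj]

/-- Back substitution computes the rows of the inverse of an upper triangular matrix. In truncated
subtraction, `1 - ((i - j) + (j - i))` is the Kronecker delta. -/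
lemma back_substitution {d : ℕ} {R : Matrix (Fin (d + 1)) (Fin (d + 1)) ℝ} (hdet : IsUnit R.det)
    (hup : ∀ i j, j < i → R i j = 0) (hdiag : ∀ i, R i i ≠ 0) {i j : ℕ} (hi : i < d + 1)
    (hj : j < d + 1) :
    (((1 - ((i - j) + (j - i)) : ℕ) : ℝ) -
      ∑ k ∈ Finset.range (d - i), natEntry R i (i + 1 + k) * natEntry R⁻¹ (i + 1 + k) j) /
        natEntry R i i = natEntry R⁻¹ i j := by
  have h1 : ∑ k ∈ Finset.range (i + 1 + (d - i)), natEntry R i k * natEntry R⁻¹ k j =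
      ((1 - ((i - j) + (j - i)) : ℕ) : ℝ) := by
    have h2 : (R * R⁻¹) ⟨i, hi⟩ ⟨j, hj⟩ = ((1 - ((i - j) + (j - i)) : ℕ) : ℝ) := by
      rw [Matrix.mul_nonsing_inv _ hdet, Matrix.one_apply]
      simp only [Fin.mk.injEq]
      split_ifs with h
      · simp [h]
      · have : 1 - ((i - j) + (j - i)) = 0 := by omega
        rw [this, Nat.cast_zero]
    rw [← h2, Matrix.mul_apply, show i + 1 + (d - i) = d + 1 by omega, Finset.sum_range]
    refine Finset.sum_congr rfl fun k _ => ?_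
    rw [natEntry_of_lt R hi k.2, natEntry_of_lt R⁻¹ k.2 hj]
  rw [Finset.sum_range_add, Finset.sum_range_succ, Finset.sum_eq_zero, zero_add] at h1
  · have hne : natEntry R i i ≠ 0 := by rw [natEntry_of_lt R hi hi]; exact hdiag _
    rw [div_eq_iff hne, ← h1]
    ring
  · intro k hk
    have hki := Finset.mem_range.1 hk
    rw [natEntry_of_lt R hi (by omega : k < d + 1), hup _ _ (Fin.mk_lt_mk.2 hki), zero_mul]

namespace RealRAM

section sparse

variable {σ : State} {n m : ℕ} {M : Matrix (Fin n) (Fin m) ℝ}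

/-- The number of stored entries of row `i`. -/
def rowLen (σ : State) (i : ℕ) : ℕ := σ.int 2 (i + 1) 0 - σ.int 2 i 0

open Classical in
/-- The set of columns of the non-zero entries of row `i`. -/
def rowSupport (M : Matrix (Fin n) (Fin m) ℝ) (i : Fin n) : Finset (Fin m) := {j | M i j ≠ 0}

/-- Sums over a row can be computed from its stored entries. -/
lemma StoresSparse.sum_row (h : StoresSparse σ M) (i : Fin n) (f : ℕ → ℝ) :
    ∑ k ∈ Finset.range (rowLen σ i), σ.real 0 (σ.int 2 i 0 + k) 0 *
      f (σ.int 3 (σ.int 2 i 0 + k) 0) = ∑ j, M i j * f j := by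
  have h1 := Finset.sum_Ico_eq_sum_range (fun k => σ.real 0 k 0 * f (σ.int 3 k 0)) (σ.int 2 i 0)
    (σ.int 2 ((i : ℕ) + 1) 0)
  rw [rowLen, ← h1]
  have h2 : ∑ j, M i j * f j = ∑ c ∈ (rowSupport M i).map Fin.valEmbedding,
      natEntry M i c * f c := by
    rw [Finset.sum_map]
    simp only [Fin.valEmbedding_apply, natEntry_apply]
    refine (Finset.sum_subset (Finset.subset_univ _) fun j _ hj => ?_).symm
    have : M i j = 0 := by
      by_contra h0
      exact hj (by simp [rowSupport, h0])
    rw [this, zero_mul]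
  rw [h2]
  have hb := h.cols i
  have hmem : ∀ c, c ∈ (rowSupport M i).map Fin.valEmbedding ↔
      c ∈ {c | ∃ j : Fin m, (j : ℕ) = c ∧ M i j ≠ 0} := by
    intro c
    simp only [Finset.mem_map, rowSupport, Finset.mem_filter, Finset.mem_univ, true_and,
      Fin.valEmbedding_apply, Set.mem_ofPred_eq]
    exact ⟨fun ⟨j, h1, h2⟩ => ⟨j, h2, h1⟩, fun ⟨j, h1, h2⟩ => ⟨j, h2, h1⟩⟩
  refine Finset.sum_nbij (fun k => σ.int 3 k 0) (fun k hk => ?_) ?_ ?_ (fun k hk => ?_)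
  · rw [hmem]
    exact hb.mapsTo (by simpa using hk)
  · rw [Finset.coe_Ico]
    exact hb.injOn
  · rw [Finset.coe_Ico]
    intro c hc
    exact hb.surjOn ((hmem c).1 hc)
  · have hk' : k ∈ Set.Ico (σ.int 2 i 0) (σ.int 2 ((i : ℕ) + 1) 0) := by simpa using hk
    obtain ⟨j, hj, -⟩ := hb.mapsTo hk'
    simp only at hj
    rw [h.vals i j k hk' hj.symm, ← hj, natEntry_apply]

lemma StoresSparse.rowLen_eq (h : StoresSparse σ M) (i : Fin n) :
    rowLen σ i = (rowSupport M i).card := by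
  have hb := h.cols i
  have h1 : (Set.Ico (σ.int 2 i 0) (σ.int 2 ((i : ℕ) + 1) 0)).ncard =
      {c | ∃ j : Fin m, (j : ℕ) = c ∧ M i j ≠ 0}.ncard := by
    rw [← hb.image_eq, hb.injOn.ncard_image]
  have h2 : {c | ∃ j : Fin m, (j : ℕ) = c ∧ M i j ≠ 0} =
      (((rowSupport M i).map Fin.valEmbedding : Finset ℕ) : Set ℕ) := by
    ext c
    simp only [Finset.coe_map, Set.mem_image, Finset.mem_coe, rowSupport, Finset.mem_filter,
      Finset.mem_univ, true_and, Fin.valEmbedding_apply, Set.mem_ofPred_eq]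
    exact ⟨fun ⟨j, h1, h2⟩ => ⟨j, h2, h1⟩, fun ⟨j, h1, h2⟩ => ⟨j, h2, h1⟩⟩
  rw [h2, Set.ncard_coe_finset, Finset.card_map, ← Finset.coe_Ico, Set.ncard_coe_finset,
    Nat.card_Ico] at h1
  exact h1

lemma StoresSparse.rowLen_le (h : StoresSparse σ M) (i : Fin n) : rowLen σ i ≤ m := by
  rw [h.rowLen_eq]
  exact (Finset.card_le_univ _).trans (by simp)

lemma nnz_eq_sum (M : Matrix (Fin n) (Fin m) ℝ) : nnz M = ∑ i, (rowSupport M i).card := by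
  classical
  have h1 : {ij : Fin n × Fin m | M ij.1 ij.2 ≠ 0} =
      (((Finset.univ : Finset (Fin n × Fin m)).filter fun ij => M ij.1 ij.2 ≠ 0 : Finset _) :
        Set (Fin n × Fin m)) := by
    ext; simp
  rw [nnz, h1, Set.ncard_coe_finset, Finset.card_filter, Fintype.sum_prod_type]
  refine Finset.sum_congr rfl fun i _ => ?_
  rw [rowSupport, Finset.card_filter]

lemma sum_rowLen_le {d : ℕ} {A : Matrix (Fin n) (Fin d) ℝ} {b : Fin n → ℝ}
    (h : StoresSparse σ (augment A b)) : ∑ i ∈ Finset.range n, rowLen σ i ≤ nnz A + n := by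
  classical
  rw [Finset.sum_range, nnz_eq_sum]
  have h1 : ∀ i : Fin n, rowLen σ i ≤ (rowSupport A i).card + 1 := by
    intro i
    rw [h.rowLen_eq]
    have : rowSupport (augment A b) i ⊆
        insert (Fin.last d) ((rowSupport A i).map Fin.castSuccEmb) := by
      intro j hj
      rw [Finset.mem_insert, Finset.mem_map]
      refine Fin.lastCases (fun _ => Or.inl rfl) (fun j hj => Or.inr ⟨j, ?_, rfl⟩) j hj
      have hj' : augment A b i j.castSucc ≠ 0 := (Finset.mem_filter.1 hj).2
      rw [augment, Matrix.of_apply, Fin.snoc_castSucc] at hj'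
      exact Finset.mem_filter.2 ⟨Finset.mem_univ _, hj'⟩
    refine (Finset.card_le_card this).trans ((Finset.card_insert_le _ _).trans ?_)
    rw [Finset.card_map]
  refine (Finset.sum_le_sum fun i _ => h1 i).trans ?_
  rw [Finset.sum_add_distrib]
  simp

end sparse

section invert

variable {G : ℝ → ℝ} {ω : Tape} {n d : ℕ} {A : Matrix (Fin n) (Fin d) ℝ} {b : Fin n → ℝ}
  {κ ε CG : ℝ} {R : Matrix (Fin (d + 1)) (Fin (d + 1)) ℝ} {σ σ' : State}

lemma Stores.of_frame {c : Cmd} (h : Stores σ A b κ ε CG R) (hF : Frame c σ σ')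
    (hi : ∀ a < 4, a ∉ c.intWrites) (hr : ∀ a < 5, a ∉ c.realWrites) :
    Stores σ' A b κ ε CG R := by
  have i0 := hF.int 0 (hi 0 (by norm_num))
  have i1 := hF.int 1 (hi 1 (by norm_num))
  have i2 := hF.int 2 (hi 2 (by norm_num))
  have i3 := hF.int 3 (hi 3 (by norm_num))
  have r0 := hF.real 0 (hr 0 (by norm_num))
  have r1 := hF.real 1 (hr 1 (by norm_num))
  have r2 := hF.real 2 (hr 2 (by norm_num))
  have r3 := hF.real 3 (hr 3 (by norm_num))
  have r4 := hF.real 4 (hr 4 (by norm_num))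
  refine ⟨by rw [i0, h.rows], by rw [i1, h.dim], ⟨?_, ?_, ?_, ?_⟩, by rw [r1, h.kappa],
    by rw [r2, h.eps], by rw [r3, h.growth], by rw [r4]; exact h.factor⟩
  · rw [i2]; exact h.data.start
  · rw [i2]; exact h.data.mono
  · rw [i2, i3]; exact h.data.cols
  · rw [i2, i3, r0]; exact h.data.vals

lemma Stores.factor_nat (h : Stores σ A b κ ε CG R) {i j : ℕ} (hi : i < d + 1) (hj : j < d + 1) :
    σ.real 4 i j = natEntry R i j := by
  rw [natEntry_of_lt R hi hj]
  exact h.factor ⟨i, hi⟩ ⟨j, hj⟩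

/-- The number `d + 1` of columns. -/
abbrev dimExp : IExp := .add (ivar 1) (.lit 1)

/-- The row computed in the current round of back substitution. -/
abbrev invRow : IExp := .sub (ivar 1) (ivar 10)

/-- Back substitution: the inverse of the triangular factor is stored in the real array `10`. -/
def invertCmd : Cmd :=
  forTo 10 dimExp
    (fillTo 11 dimExp
      (sumTo 13 11 (ivar 10) .skip
        (.mul (.get 4 invRow (.add (.add invRow (.lit 1)) (ivar 13)))
          (.get 10 (.add (.add invRow (.lit 1)) (ivar 13)) (ivar 11))))
      10 invRow (ivar 11)
      (.div (.sub (.ofInt (.sub (.lit 1) (.add (.sub invRow (ivar 11)) (.sub (ivar 11) invRow))))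
        (rvar 11)) (.get 4 invRow invRow)))

lemma runs_invertCmd (hS : Stores σ A b κ ε CG R) (hdet : IsUnit R.det)
    (hup : ∀ i j, j < i → R i j = 0) (hdiag : ∀ i, R i i ≠ 0) :
    Runs G ω invertCmd σ (300 * (d + 1) ^ 3)
      (fun σ' => ∀ i < d + 1, ∀ j < d + 1, σ'.real 10 i j = natEntry R⁻¹ i j) := by
  refine Runs.mono (runs_forTo (Inv := fun k σ' => ∀ i < d + 1, ∀ j < d + 1, d + 1 ≤ i + k →
    σ'.real 10 i j = natEntry R⁻¹ i j) (d + 1) (fun _ => 250 * (d + 1) ^ 2) (by decide)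
    (fun σ₁ hF => ?_) (fun _ _ _ h => h) (fun i hi j hj h => by omega) ?_
    (fun σ' _ h i hi j hj => h i hi j hj (by omega))) ?_ fun _ _ h => h
  · simp [IExp.eval, hF.int 1 (by decide), hS.dim]
  · intro k hk σ₁ hF₁ hk₁ hI
    have hS₁ : Stores σ₁ A b κ ε CG R := hS.of_frame hF₁ (by decide) (by decide)
    refine Runs.mono (runs_fillTo (d + 1) (fun _ => d - k) (fun j => j)
      (fun j => natEntry R⁻¹ (d - k) j) (fun _ => 100 * (d + 1)) (by decide) (by decide)
      (fun _ _ _ _ _ h => h) (fun σ₂ hF => ?_) ?_) ?_ ?_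
    · simp [IExp.eval, hF.int 1 (by decide), hS₁.dim]
    · intro j hj σ₂ hF₂ hj₂ hunch _
      have hS₂ : Stores σ₂ A b κ ε CG R := hS₁.of_frame hF₂ (by decide) (by decide)
      have hk₂ : σ₂.int 10 0 0 = k := by rw [hF₂.int 10 (by decide), hk₁]
      refine Runs.mono (runs_sumTo k (fun v => natEntry R (d - k) (d - k + 1 + v) *
        natEntry R⁻¹ (d - k + 1 + v) j) (fun _ => 1) (by decide) (by decide)
        (fun σ₃ hF => ?_) ?_) ?_ ?_
      · simp [IExp.eval, hF.int 10 (by decide), hk₂]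
      · intro v hv σ₃ hF₃ hv₃
        refine runs_skip ?_
        have e1 : σ₃.int 1 0 0 = d := by rw [hF₃.int 1 (by decide), hS₂.dim]
        have e2 : σ₃.int 10 0 0 = k := by rw [hF₃.int 10 (by decide), hk₂]
        have e3 : σ₃.int 11 0 0 = j := by rw [hF₃.int 11 (by decide), hj₂]
        have e4 : σ₃.real 10 (d - k + 1 + v) j = natEntry R⁻¹ (d - k + 1 + v) j := by
          rw [hF₃.real 10 (by decide), hunch _ _ fun k' _ h => by omega]
          exact hI _ (by omega) _ hj (by omega)
        have e5 : σ₃.real 4 (d - k) (d - k + 1 + v) = natEntry R (d - k) (d - k + 1 + v) := by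
          rw [hF₃.real 4 (by decide)]
          exact hS₂.factor_nat (by omega) (by omega)
        simp only [RExp.eval, IExp.eval, e1, e2, e3, hv₃, e4, e5]
      · rw [Finset.sum_const, Finset.card_range, smul_eq_mul]
        simp only [RExp.cost, IExp.cost]
        omega
      · intro σ₃ hF₃ hsum
        have e1 : σ₃.int 1 0 0 = d := by rw [hF₃.int 1 (by decide), hS₂.dim]
        have e2 : σ₃.int 10 0 0 = k := by rw [hF₃.int 10 (by decide), hk₂]
        have e3 : σ₃.int 11 0 0 = j := by rw [hF₃.int 11 (by decide), hj₂]
        have e5 : σ₃.real 4 (d - k) (d - k) = natEntry R (d - k) (d - k) := by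
          rw [hF₃.real 4 (by decide)]
          exact hS₂.factor_nat (by omega) (by omega)
        refine ⟨by simp only [IExp.eval, e1, e2], by simp only [IExp.eval, e3], ?_⟩
        simp only [RExp.eval, IExp.eval, e1, e2, e3, e5, hsum]
        have := back_substitution hdet hup hdiag (i := d - k) (j := j) (by omega) hj
        rwa [show d - (d - k) = k by omega] at this
    · rw [Finset.sum_const, Finset.card_range, smul_eq_mul]
      simp only [RExp.cost, IExp.cost]
      nlinarith
    · intro σ₂ hF₂ ⟨h1, h2⟩ i hi j hj hij
      rcases eq_or_ne i (d - k) with rfl | hne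
      · exact h1 j hj
      · rw [h2 i j fun k' _ h => hne h.1.symm]
        exact hI i hi j hj (by omega)
  · rw [Finset.sum_const, Finset.card_range, smul_eq_mul]
    simp only [IExp.cost]
    nlinarith [Nat.one_le_pow 2 (d + 1) (by omega), Nat.one_le_pow 3 (d + 1) (by omega)]

end invert

end RealRAM

/-! ### Leverage scores and probabilities -/

namespace RealRAM

section leverage

variable {G : ℝ → ℝ} {ω : Tape} {n d : ℕ} {A : Matrix (Fin n) (Fin d) ℝ} {b : Fin n → ℝ}
  {κ ε CG : ℝ} {R : Matrix (Fin (d + 1)) (Fin (d + 1)) ℝ} {σ σ' : State}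

/-- The number of columns of the sketch. -/
def sketchSize (n : ℕ) : ℕ := 16 * (Nat.clog 2 n + 5)

/-- The sketch size is computed by repeated doubling of the integer variable `15` until it reaches
`n`. The loop makes `n` rounds, more than enough, and the last ones are idle. -/
def sizeCmd : Cmd :=
  .seq (.iset 14 (.lit 0) (.lit 0) (.lit 80)) (.seq (.iset 15 (.lit 0) (.lit 0) (.lit 1))
    (forTo 10 (ivar 0) (.ite (.ilt (ivar 15) (ivar 0))
      (.seq (.iset 15 (.lit 0) (.lit 0) (.add (ivar 15) (ivar 15)))
        (.iset 14 (.lit 0) (.lit 0) (.add (ivar 14) (.lit 16)))) .skip)))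

lemma eq_clog {L : ℕ} (h : n ≤ 2 ^ L) (h' : 2 ^ L < 2 * n) : L = Nat.clog 2 n := by
  refine le_antisymm ?_ (Nat.clog_le_of_le_pow h)
  have h1 : n ≤ 2 ^ Nat.clog 2 n := Nat.le_pow_clog (by norm_num) n
  have h2 : 2 ^ L < 2 ^ (Nat.clog 2 n + 1) := by rw [pow_succ]; omega
  exact Nat.lt_succ_iff.1 ((Nat.pow_lt_pow_iff_right (by norm_num)).1 h2)

lemma runs_sizeCmd (hn : σ.int 0 0 0 = n) (hn1 : 1 ≤ n) :
    Runs G ω sizeCmd σ (70 * n + 30) (fun σ' => σ'.int 14 0 0 = sketchSize n) := by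
  refine Runs.mono (Runs.seq (P := fun s => s = σ.setInt 14 0 0 80)
    (runs_iset rfl) fun σ₁ hF₁ h₁ => Runs.seq (P := fun s => s = σ₁.setInt 15 0 0 1)
    (runs_iset rfl) fun σ₂ hF₂ h₂ => runs_forTo (Inv := fun k s => ∃ L, s.int 15 0 0 = 2 ^ L ∧
      s.int 14 0 0 = 16 * (L + 5) ∧ 2 ^ L < 2 * n ∧ (n ≤ 2 ^ L ∨ k + 1 ≤ 2 ^ L)) n
      (fun _ => 40) (by decide) (fun s hF => ?_) (fun k s x h => ?_) ?_ ?_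
      (Q := fun σ' => σ'.int 14 0 0 = sketchSize n) (fun s _ hI => ?_)) ?_ fun _ _ h => h
  · simp only [IExp.eval]
    rw [hF.int 0 (by decide), hF₂.int 0 (by decide), hF₁.int 0 (by decide), hn]
  · simpa [State.setInt] using h
  · refine ⟨0, ?_, ?_, by omega, Or.inr (by norm_num)⟩
    · rw [h₂]; simp [State.setInt]
    · rw [h₂, h₁]; simp [State.setInt]
  · rintro k hk s hF - ⟨L, h15, h14, hL, hkL⟩
    have h0 : s.int 0 0 0 = n := by
      rw [hF.int 0 (by decide), hF₂.int 0 (by decide), hF₁.int 0 (by decide), hn]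
    refine Runs.mono (runs_ite (T := 21) (T' := 1)
      (Q := fun s => ∃ L, s.int 15 0 0 = 2 ^ L ∧
      s.int 14 0 0 = 16 * (L + 5) ∧ 2 ^ L < 2 * n ∧ (n ≤ 2 ^ L ∨ k + 1 + 1 ≤ 2 ^ L))
      (fun hu => ?_) (fun hu => ?_)) ?_ fun _ _ h => h
    · simp only [BExp.holds, IExp.eval, h15, h0] at hu
      refine Runs.mono (Runs.seq (P := fun s' => s' = s.setInt 15 0 0 (2 ^ (L + 1)))
        (runs_iset ?_) fun s' hF' hs' => runs_iset (Q := fun s => ∃ L, s.int 15 0 0 = 2 ^ L ∧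
          s.int 14 0 0 = 16 * (L + 5) ∧ 2 ^ L < 2 * n ∧ (n ≤ 2 ^ L ∨ k + 1 + 1 ≤ 2 ^ L))
          ⟨L + 1, ?_, ?_, ?_, ?_⟩) ?_ fun _ _ h => h
      · simp only [IExp.eval, h15]
        rw [pow_succ, mul_two]
      · rw [hs']; simp [State.setInt]
      · rw [hs']; simp [State.setInt, IExp.eval, h14]; ring
      · rw [pow_succ]; omega
      · right
        rcases hkL with h | h
        · omega
        · rw [pow_succ]; omega
      · simp [IExp.cost]
    · simp only [BExp.holds, IExp.eval, h15, h0, not_lt] at hu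
      exact runs_skip ⟨L, h15, h14, hL, Or.inl hu⟩
    · simp [IExp.cost, BExp.cost]
  · obtain ⟨L, -, h14, hL, hnL⟩ := hI
    have : n ≤ 2 ^ L := by omega
    rw [h14, sketchSize, eq_clog this hL]
  · rw [Finset.sum_const, Finset.card_range, smul_eq_mul]
    simp only [IExp.cost]
    omega

/-- The signs of the sketch are drawn into the real array `12`. -/
def signCmd : Cmd :=
  forTo 12 (ivar 14) (randTo 13 dimExp 12 (ivar 12) (ivar 13)
    (.rlt (.get 12 (ivar 12) (ivar 13)) (.div (rlit 1) (rlit 2))) (rlit 1)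
    (.sub (rlit 0) (rlit 1)))

lemma runs_signCmd {m : ℕ} (hm : σ.int 14 0 0 = m) (hd : σ.int 1 0 0 = d) :
    Runs G ω signCmd σ (100 * (m + 1) * (d + 1))
      (fun σ' => σ'.pos = σ.pos + m * (d + 1) ∧ ∀ l < m, ∀ j < d + 1, σ'.real 12 l j =
        bitSign (decide ((ω (σ.pos + (l * (d + 1) + j)) : ℝ) < 1 / 2))) := by
  refine Runs.mono (runs_forTo (Inv := fun k s => s.pos = σ.pos + k * (d + 1) ∧ ∀ l < k,
    ∀ j < d + 1, s.real 12 l j =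
        bitSign (decide ((ω (σ.pos + (l * (d + 1) + j)) : ℝ) < 1 / 2)))
    (Q := fun s => s.pos = σ.pos + m * (d + 1) ∧ ∀ l < m,
    ∀ j < d + 1, s.real 12 l j =
        bitSign (decide ((ω (σ.pos + (l * (d + 1) + j)) : ℝ) < 1 / 2))) m
    (fun _ => 65 * (d + 1) + 13) (by decide) (fun s hF => ?_) (fun _ _ _ h => h)
    ⟨by simp, fun l hl => absurd hl (Nat.not_lt_zero _)⟩ ?_ (fun _ _ h => h)) ?_ fun _ _ h => h
  · simp only [IExp.eval]
    rw [hF.int 14 (by decide), hm]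
  · rintro k hk s hF hks ⟨hpos, hI⟩
    have hds : s.int 1 0 0 = d := by rw [hF.int 1 (by decide), hd]
    refine Runs.mono (runs_randTo (d + 1) (fun _ => k) (fun j => j)
      (fun j x => bitSign (decide ((x : ℝ) < 1 / 2))) (fun _ _ _ _ _ h => h) (fun s' hF' => ?_)
      (fun j hj s' hF' hj' => ?_) (fun j hj s' x hF' hj' hx => ?_)) ?_ ?_
    · simp only [IExp.eval]
      rw [hF'.int 1 (by decide), hds]
    · simp only [IExp.eval]
      rw [hF'.int 12 (by decide), hks, hj']
      exact ⟨rfl, rfl⟩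
    · have h12 : s'.int 12 0 0 = k := by rw [hF'.int 12 (by decide), hks]
      simp only [BExp.holds, RExp.eval, IExp.eval, h12, hj', hx, Nat.cast_one, Nat.cast_ofNat,
        Nat.cast_zero, bitSign]
      constructor
      · intro h; rw [if_pos (by simpa using h)]
      · intro h; rw [if_neg (by simpa using h)]; norm_num
    · simp only [RExp.cost, IExp.cost, BExp.cost]
      omega
    · rintro s' hF' ⟨hp, h1, h2⟩
      refine ⟨by rw [hp, hpos]; ring, fun l hl j hj => ?_⟩
      rcases Nat.lt_succ_iff_lt_or_eq.1 hl with h | rfl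
      · rw [h2 l j fun k' _ h' => by omega]
        exact hI l h j hj
      · rw [h1 j hj, hpos, add_assoc]
  · rw [Finset.sum_const, Finset.card_range, smul_eq_mul]
    simp only [IExp.cost]
    nlinarith

/-- The product of the inverse factor and the sketch is stored in the real array `13`. -/
def sketchCmd : Cmd :=
  forTo 12 (ivar 14) (fillTo 11 dimExp
    (sumTo 13 11 dimExp .skip
      (.mul (.get 10 (ivar 11) (ivar 13)) (.get 12 (ivar 12) (ivar 13))))
    13 (ivar 12) (ivar 11) (rvar 11))

lemma runs_sketchCmd {m : ℕ} (hm : σ.int 14 0 0 = m) (hd : σ.int 1 0 0 = d)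
    {V s : ℕ → ℕ → ℝ} (hV : ∀ i < d + 1, ∀ j < d + 1, σ.real 10 i j = V i j)
    (hs : ∀ l < m, ∀ j < d + 1, σ.real 12 l j = s l j) :
    Runs G ω sketchCmd σ (200 * (m + 1) * (d + 1) ^ 2)
      (fun σ' => ∀ l < m, ∀ j < d + 1, σ'.real 13 l j =
        ∑ v ∈ Finset.range (d + 1), V j v * s l v) := by
  refine Runs.mono (runs_forTo (Inv := fun k s' => ∀ l < k, ∀ j < d + 1, s'.real 13 l j =
        ∑ v ∈ Finset.range (d + 1), V j v * s l v) m
    (fun _ => 150 * (d + 1) ^ 2) (by decide) (fun s' hF => ?_) (fun _ _ _ h => h)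
    (fun l hl => absurd hl (Nat.not_lt_zero _)) ?_ (fun _ _ h => h)) ?_ fun _ _ h => h
  · simp only [IExp.eval]
    rw [hF.int 14 (by decide), hm]
  · intro k hk σ₁ hF₁ hk₁ hI
    have hd₁ : σ₁.int 1 0 0 = d := by rw [hF₁.int 1 (by decide), hd]
    refine Runs.mono (runs_fillTo (d + 1) (fun _ => k) (fun j => j)
      (fun j => ∑ v ∈ Finset.range (d + 1), V j v * s k v) (fun _ => 50 * (d + 1) + 16)
      (by decide) (by decide) (fun _ _ _ _ _ h => h) (fun s' hF => ?_) ?_) ?_ ?_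
    · simp only [IExp.eval]
      rw [hF.int 1 (by decide), hd₁]
    · intro j hj σ₂ hF₂ hj₂ _ _
      have hd₂ : σ₂.int 1 0 0 = d := by rw [hF₂.int 1 (by decide), hd₁]
      have hk₂ : σ₂.int 12 0 0 = k := by rw [hF₂.int 12 (by decide), hk₁]
      refine Runs.mono (runs_sumTo (d + 1) (fun v => V j v * s k v) (fun _ => 1) (by decide)
        (by decide) (fun s' hF => ?_) ?_) ?_ ?_
      · simp only [IExp.eval]
        rw [hF.int 1 (by decide), hd₂]
      · intro v hv σ₃ hF₃ hv₃
        refine runs_skip ?_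
        have e1 : σ₃.int 12 0 0 = k := by rw [hF₃.int 12 (by decide), hk₂]
        have e2 : σ₃.int 11 0 0 = j := by rw [hF₃.int 11 (by decide), hj₂]
        have e3 : σ₃.real 10 j v = V j v := by
          rw [hF₃.real 10 (by decide), hF₂.real 10 (by decide), hF₁.real 10 (by decide)]
          exact hV j hj v hv
        have e4 : σ₃.real 12 k v = s k v := by
          rw [hF₃.real 12 (by decide), hF₂.real 12 (by decide), hF₁.real 12 (by decide)]
          exact hs k hk v hv
        simp only [RExp.eval, IExp.eval, e1, e2, hv₃, e3, e4]
      · rw [Finset.sum_const, Finset.card_range, smul_eq_mul]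
        simp only [RExp.cost, IExp.cost]
        omega
      · intro σ₃ hF₃ hsum
        have e1 : σ₃.int 12 0 0 = k := by rw [hF₃.int 12 (by decide), hk₂]
        have e2 : σ₃.int 11 0 0 = j := by rw [hF₃.int 11 (by decide), hj₂]
        refine ⟨by simp only [IExp.eval, e1], by simp only [IExp.eval, e2], ?_⟩
        simp only [RExp.eval, IExp.eval, hsum]
    · rw [Finset.sum_const, Finset.card_range, smul_eq_mul]
      simp only [RExp.cost, IExp.cost]
      nlinarith
    · rintro σ₂ hF₂ ⟨h1, h2⟩ l hl j hj
      rcases Nat.lt_succ_iff_lt_or_eq.1 hl with h | rfl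
      · rw [h2 l j fun k' _ h' => by omega]
        exact hI l h j hj
      · exact h1 j hj
  · rw [Finset.sum_const, Finset.card_range, smul_eq_mul]
    simp only [IExp.cost]
    nlinarith [Nat.one_le_pow 2 (d + 1) (by omega)]

/-- Position of the first entry of the row with index `e`. -/
abbrev rowStartExp (e : IExp) : IExp := .get 2 e (.lit 0)

/-- Number of entries of the row with index `e`. -/
abbrev rowLenExp (e : IExp) : IExp := .sub (.get 2 (.add e (.lit 1)) (.lit 0)) (rowStartExp e)

/-- The estimates of the leverage scores, from the sketched rows. -/
def scoreCmd : Cmd :=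
  fillTo 10 (ivar 0)
    (sumTo 12 14 (ivar 14)
      (sumTo 13 11 (rowLenExp (ivar 10)) .skip
        (.mul (.get 0 (.add (rowStartExp (ivar 10)) (ivar 13)) (.lit 0))
          (.get 13 (ivar 12) (.get 3 (.add (rowStartExp (ivar 10)) (ivar 13)) (.lit 0)))))
      (.mul (rvar 11) (rvar 11)))
    5 (ivar 10) (.lit 0) (.evalG (.sqrt (.div (rvar 14) (.ofInt (ivar 14)))))

lemma runs_scoreCmd {m : ℕ} (hm : σ.int 14 0 0 = m) (hS : Stores σ A b κ ε CG R)
    {H : ℕ → ℕ → ℝ} (hH : ∀ l < m, ∀ j < d + 1, σ.real 13 l j = H l j) :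
    Runs G ω scoreCmd σ (200 * (m + 1) * (nnz A + n) + 20)
      (fun σ' => ∀ i : Fin n, σ'.real 5 i 0 = G (Real.sqrt ((∑ l ∈ Finset.range m,
        (∑ j : Fin (d + 1), augment A b i j * H l j) ^ 2) / m))) := by
  set F : ℕ → ℝ := fun i => G (Real.sqrt ((∑ l ∈ Finset.range m,
        (∑ k ∈ Finset.range (rowLen σ i), σ.real 0 (σ.int 2 i 0 + k) 0 *
          σ.real 13 l (σ.int 3 (σ.int 2 i 0 + k) 0)) ^ 2) / m)) with hF
  refine Runs.mono (runs_fillTo n (fun i => i) (fun _ => 0) F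
    (fun i => m * (75 * rowLen σ i + 60) + 20) (by decide) (by decide)
    (fun _ _ _ _ h _ => h) (fun s hF => ?_) ?_) ?_ ?_
  · simp only [IExp.eval]
    rw [hF.int 0 (by decide), hS.rows]
  · intro i hi σ₁ hF₁ hi₁ _ _
    have hm₁ : σ₁.int 14 0 0 = m := by rw [hF₁.int 14 (by decide), hm]
    refine Runs.mono (runs_sumTo m (fun l => (∑ k ∈ Finset.range (rowLen σ i),
      σ.real 0 (σ.int 2 i 0 + k) 0 * σ.real 13 l (σ.int 3 (σ.int 2 i 0 + k) 0)) ^ 2)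
      (fun _ => 75 * rowLen σ i + 30) (by decide) (by decide) (fun s hF => ?_) ?_) ?_ ?_
    · simp only [IExp.eval]
      rw [hF.int 14 (by decide), hm₁]
    · intro l hl σ₂ hF₂ hl₂
      have hi₂ : σ₂.int 10 0 0 = i := by rw [hF₂.int 10 (by decide), hi₁]
      have h2₂ : σ₂.int 2 = σ.int 2 := by rw [hF₂.int 2 (by decide), hF₁.int 2 (by decide)]
      refine Runs.mono (runs_sumTo (rowLen σ i) (fun k => σ.real 0 (σ.int 2 i 0 + k) 0 *
        σ.real 13 l (σ.int 3 (σ.int 2 i 0 + k) 0)) (fun _ => 1) (by decide) (by decide)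
        (fun s hF => ?_) ?_) ?_ ?_
      · simp only [IExp.eval]
        rw [hF.int 2 (by decide), hF.int 10 (by decide), h2₂, hi₂, rowLen]
      · intro k hk σ₃ hF₃ hk₃
        refine runs_skip ?_
        simp only [RExp.eval, IExp.eval, hk₃]
        rw [hF₃.int 2 (by decide), hF₃.int 10 (by decide), hF₃.int 3 (by decide),
          hF₃.int 12 (by decide), hF₃.real 0 (by decide), hF₃.real 13 (by decide), h2₂, hi₂, hl₂,
          hF₂.int 3 (by decide), hF₂.real 0 (by decide), hF₂.real 13 (by decide),
          hF₁.int 3 (by decide), hF₁.real 0 (by decide), hF₁.real 13 (by decide)]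
      · rw [Finset.sum_const, Finset.card_range, smul_eq_mul]
        simp only [RExp.cost, IExp.cost]
        omega
      · intro σ₃ hF₃ hsum
        simp only [RExp.eval, IExp.eval, hsum]
        ring
    · rw [Finset.sum_const, Finset.card_range, smul_eq_mul]
      simp only [RExp.cost, IExp.cost]
      nlinarith
    · intro σ₂ hF₂ hsum
      simp only [RExp.eval, IExp.eval, hsum]
      rw [hF₂.int 10 (by decide), hi₁, hF₂.int 14 (by decide), hm₁]
      exact ⟨rfl, trivial, rfl⟩
  · have hlen := sum_rowLen_le hS.data
    have e : ∑ k ∈ Finset.range n, (m * (75 * rowLen σ k + 60) + 50) =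
        75 * m * ∑ k ∈ Finset.range n, rowLen σ k + n * (60 * m + 50) := by
      rw [Finset.mul_sum, Finset.sum_congr rfl fun k _ =>
        show m * (75 * rowLen σ k + 60) + 50 = 75 * m * rowLen σ k + (60 * m + 50) by ring,
        Finset.sum_add_distrib, Finset.sum_const, Finset.card_range, smul_eq_mul]
    have e' : ∑ k ∈ Finset.range n, (m * (75 * rowLen σ k + 60) + 50) ≤
        200 * (m + 1) * (nnz A + n) := by
      rw [e]
      nlinarith [Nat.mul_le_mul_left m hlen, Nat.zero_le (m * nnz A), Nat.zero_le (m * n)]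
    refine le_trans (Nat.add_le_add_right (Nat.add_le_add_right (Finset.sum_le_sum
      (g := fun k => m * (75 * rowLen σ k + 60) + 50) fun k _ => ?_) _) _) ?_
    · simp only [RExp.cost, IExp.cost]; omega
    · simp only [IExp.cost]; omega
  · rintro σ₁ hF₁ ⟨h1, -⟩ i
    rw [h1 i i.2, hF]
    simp only
    congr 3
    refine Finset.sum_congr rfl fun l hl => ?_
    rw [hS.data.sum_row i (fun c => σ.real 13 l c)]
    congr 1
    refine Finset.sum_congr rfl fun j _ => ?_
    rw [hH l (Finset.mem_range.1 hl) j j.2]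

/-- The sampling probabilities, from the estimates of the leverage scores. The minimum with `1` is
computed by means of a square root. -/
def probCmd (N : ℕ) : Cmd :=
  fillTo 10 (ivar 0)
    (.rset 14 (.lit 0) (.lit 0) (.div
      (.mul (.mul (.mul (rlit N) (.ofInt (ivar 1))) (rvar 3)) (.get 5 (ivar 10) (.lit 0)))
      (.mul (.mul (rvar 2) (rvar 2)) (rvar 2))))
    6 (ivar 10) (.lit 0)
    (.div (.sub (.add (rlit 1) (rvar 14))
      (.sqrt (.mul (.sub (rlit 1) (rvar 14)) (.sub (rlit 1) (rvar 14))))) (rlit 2))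

lemma runs_probCmd {N : ℕ} (hS : Stores σ A b κ ε CG R) :
    Runs G ω (probCmd N) σ (100 * n + 20)
      (fun σ' => ∀ i < n, σ'.real 6 i 0 =
        min 1 (N * d * CG * σ.real 5 i 0 / (ε * ε * ε))) := by
  refine Runs.mono (runs_fillTo n (fun i => i) (fun _ => 0)
    (fun i => min 1 (N * d * CG * σ.real 5 i 0 / (ε * ε * ε)))
    (fun i => 35) (by simp [Cmd.intWrites]) (by simp [Cmd.realWrites])
    (fun _ _ _ _ h _ => h) (fun s hF => ?_) ?_) ?_ ?_
  · simp only [IExp.eval]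
    rw [hF.int 0 (by simp [Cmd.intWrites, fillTo, forTo]), hS.rows]
  · intro i hi s hF hi₁ _ _
    have hS' := hS.of_frame hF (by simp [Cmd.intWrites, fillTo, forTo]; omega)
      (by simp [Cmd.realWrites, fillTo, forTo]; omega)
    have h5 : s.real 5 = σ.real 5 := hF.real 5 (by simp [Cmd.realWrites, fillTo, forTo])
    refine Runs.mono (runs_rset (Q := fun s' => ∃ x, s' = s.setReal 14 0 0 x ∧
      x = N * d * CG * σ.real 5 i 0 / (ε * ε * ε)) ⟨_, rfl, ?_⟩) ?_ ?_
    · simp only [RExp.eval, IExp.eval, hS'.dim, hS'.growth, hS'.eps, h5, hi₁]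
    · simp only [RExp.cost, IExp.cost]; omega
    · rintro _ - ⟨x, rfl, hx⟩
      refine ⟨hi₁, rfl, ?_⟩
      have e : (s.setReal 14 0 0 x).real 14 0 0 = x := by simp [State.setReal]
      simp only [RExp.eval, IExp.eval, e, Nat.cast_one, Nat.cast_ofNat]
      rw [← hx, Real.sqrt_mul_self_eq_abs]
      rcases le_total 1 x with h | h
      · rw [min_eq_left h, abs_of_nonpos (by linarith)]; ring
      · rw [min_eq_right h, abs_of_nonneg (by linarith)]; ring
  · rw [Finset.sum_const, Finset.card_range, smul_eq_mul]
    simp only [RExp.cost, IExp.cost]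
    omega
  · rintro s hF ⟨h1, -⟩ i hi
    exact h1 i hi

/-- The estimate of the leverage score of row `i` obtained from the sketch with signs `s`. -/
def sketchScore (G : ℝ → ℝ) (A : Matrix (Fin n) (Fin d) ℝ) (b : Fin n → ℝ)
    (R : Matrix (Fin (d + 1)) (Fin (d + 1)) ℝ) {m : ℕ} (s : Fin m → Fin (d + 1) → Bool)
    (i : Fin n) : ℝ :=
  G (Real.sqrt (sketchSq (whitened A b R i) s / m))

/-- The sampling probabilities obtained from the sketch with signs `s`, with constant `N`. -/
def sketchProb (G : ℝ → ℝ) (A : Matrix (Fin n) (Fin d) ℝ) (b : Fin n → ℝ)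
    (R : Matrix (Fin (d + 1)) (Fin (d + 1)) ℝ) (N : ℕ) (CG ε : ℝ) {m : ℕ}
    (s : Fin m → Fin (d + 1) → Bool) (i : Fin n) : ℝ :=
  min 1 (N * d * CG * sketchScore G A b R s i / (ε * ε * ε))

/-- The program for the leverage scores and the sampling probabilities. -/
def levCmd (N : ℕ) : Cmd :=
  .seq invertCmd (.seq sizeCmd (.seq signCmd (.seq sketchCmd (.seq scoreCmd (probCmd N)))))

/-- The frame of `probCmd N` does not depend on the literal `N`, which would block the decision
procedure. -/
lemma probCmd_intWrites (N : ℕ) : (probCmd N).intWrites = (probCmd 0).intWrites := rfl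

lemma probCmd_realWrites (N : ℕ) : (probCmd N).realWrites = (probCmd 0).realWrites := rfl

lemma runs_levCmd {N : ℕ} (hn : 1 ≤ n) (hS : Stores σ A b κ ε CG R) (hdet : IsUnit R.det)
    (hup : ∀ i j, j < i → R i j = 0) (hdiag : ∀ i, R i i ≠ 0) :
    Runs G ω (levCmd N) σ
      (300 * (d + 1) ^ 3 + 1000 * (sketchSize n + 1) * ((d + 1) ^ 2 + (nnz A + n)))
      (fun σ' => Stores σ' A b κ ε CG R ∧ σ'.pos = σ.pos + sketchSize n * (d + 1) ∧
        σ'.vec 5 n = sketchScore G A b R (tapeBits ω σ.pos (sketchSize n) (d + 1)) ∧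
        σ'.vec 6 n = sketchProb G A b R N CG ε (tapeBits ω σ.pos (sketchSize n) (d + 1)) ∧
        ∀ i < d + 1, ∀ j < d + 1, σ'.real 10 i j = natEntry R⁻¹ i j) := by
  set m := sketchSize n with hm
  set s := tapeBits ω σ.pos m (d + 1) with hs
  refine Runs.mono (Runs.seq (runs_invertCmd hS hdet hup hdiag) fun σ₁ hF₁ h₁ =>
    Runs.seq (runs_sizeCmd (n := n) ?_ hn) fun σ₂ hF₂ h₂ =>
    Runs.seq (runs_signCmd (m := m) (d := d) h₂ ?_) fun σ₃ hF₃ h₃ =>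
    Runs.seq (runs_sketchCmd (m := m) (d := d) (V := natEntry R⁻¹)
      (s := fun l j => bitSign (decide ((ω (σ.pos + (l * (d + 1) + j)) : ℝ) < 1 / 2)))
      ?_ ?_ ?_ ?_) fun σ₄ hF₄ h₄ =>
    Runs.seq (runs_scoreCmd (m := m) (A := A) (b := b) (κ := κ) (ε := ε) (CG := CG) (R := R)
      ?_ ?_ h₄) fun σ₅ hF₅ h₅ =>
    Runs.mono (runs_probCmd (A := A) (b := b) (κ := κ) (ε := ε) (CG := CG) (R := R) ?_)
      le_rfl fun σ₆ hF₆ h₆ => ?_) ?_ fun _ _ h => h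
  all_goals try have S₁ := hS.of_frame hF₁ (by decide) (by decide)
  all_goals try have S₂ := S₁.of_frame hF₂ (by decide) (by decide)
  all_goals try have S₃ := S₂.of_frame hF₃ (by decide) (by decide)
  all_goals try have S₄ := S₃.of_frame hF₄ (by decide) (by decide)
  all_goals try have S₅ := S₄.of_frame hF₅ (by decide) (by decide)
  · exact S₁.rows
  · exact S₂.dim
  · rw [hF₃.int 14 (by decide), h₂]
  · exact S₃.dim
  · intro i hi j hj
    rw [hF₃.real 10 (by decide), hF₂.real 10 (by decide)]
    exact h₁ i hi j hj
  · intro l hl j hj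
    rw [h₃.2 l hl j hj, hF₂.pos (by decide), hF₁.pos (by decide)]
  · rw [hF₄.int 14 (by decide), hF₃.int 14 (by decide), h₂]
  · exact S₄
  · exact S₅
  · have S₆ : Stores σ₆ A b κ ε CG R := S₅.of_frame hF₆
      (by rw [probCmd_intWrites]; decide) (by rw [probCmd_realWrites]; decide)
    have h5 : σ₆.real 5 = σ₅.real 5 :=
      hF₆.real 5 (by rw [probCmd_realWrites]; decide)
    have hsc : ∀ i : Fin n, σ₅.real 5 i 0 = sketchScore G A b R s i := by
      intro i
      rw [h₅ i, sketchScore, sketchSq, Finset.sum_range]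
      congr 3
      refine Finset.sum_congr rfl fun l _ => ?_
      congr 1
      simp only [whitened, Matrix.mul_apply, Finset.sum_mul]
      rw [Finset.sum_comm]
      refine Finset.sum_congr rfl fun j _ => ?_
      rw [Finset.sum_range, Finset.mul_sum]
      refine Finset.sum_congr rfl fun v _ => ?_
      rw [natEntry_apply, hs, tapeBits, mul_assoc]
    refine ⟨S₆, ?_, ?_, ?_, ?_⟩
    · rw [hF₆.pos (by rfl), hF₅.pos (by decide), hF₄.pos (by decide), h₃.1, hF₂.pos (by decide),
        hF₁.pos (by decide)]
    · funext i
      rw [State.vec, h5, hsc]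
    · funext i
      rw [State.vec, h₆ i i.2, hsc, sketchProb]
    · intro i hi j hj
      rw [hF₆.real 10 (by rw [probCmd_realWrites]; decide), hF₅.real 10 (by decide),
        hF₄.real 10 (by decide), hF₃.real 10 (by decide), hF₂.real 10 (by decide)]
      exact h₁ i hi j hj
  · have h1 : 1 ≤ (d + 1) ^ 2 := Nat.one_le_pow _ _ (by omega)
    have h2 : d + 1 ≤ (d + 1) ^ 2 := Nat.le_self_pow (by norm_num) _
    have h3 := Nat.mul_le_mul_left (m + 1) h2
    have h4 := Nat.mul_le_mul_left (m + 1) h1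
    have h5 : n ≤ (m + 1) * (nnz A + n) := by nlinarith [Nat.zero_le (m * (nnz A + n))]
    nlinarith

end leverage

end RealRAM

/-! ### Sampling and collecting rows -/

namespace RealRAM

section solve

variable {G : ℝ → ℝ} {ω : Tape} {n d : ℕ} {A : Matrix (Fin n) (Fin d) ℝ} {b : Fin n → ℝ}
  {κ ε CG : ℝ} {R : Matrix (Fin (d + 1)) (Fin (d + 1)) ℝ} {σ σ' : State}

/-- The program for drawing the weights. -/
def sampCmd : Cmd :=
  randTo 10 (ivar 0) 7 (ivar 10) (.lit 0)
    (.rlt (.get 7 (ivar 10) (.lit 0)) (.get 6 (ivar 10) (.lit 0)))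
    (.div (rlit 1) (.get 6 (ivar 10) (.lit 0))) (rlit 0)

lemma runs_sampCmd (hn : σ.int 0 0 0 = n) :
    Runs G ω sampCmd σ (100 * n + 20)
      (fun σ' => σ'.vec 7 n = drawWeights ω σ.pos (σ.vec 6 n)) := by
  refine Runs.mono (runs_randTo n (fun i => i) (fun _ => 0)
    (fun i x => if (x : ℝ) < σ.real 6 i 0 then 1 / σ.real 6 i 0 else 0) (fun _ _ _ _ h _ => h)
    (fun s hF => ?_) (fun i hi s hF hi₁ => ⟨hi₁, rfl⟩) (fun i hi s x hF hi₁ hx => ?_)) ?_ ?_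
  · simp only [IExp.eval]
    rw [hF.int 0 (by decide), hn]
  · have h6 : s.real 6 = σ.real 6 := hF.real 6 (by decide)
    simp only [BExp.holds, RExp.eval, IExp.eval, hi₁, hx, h6, Nat.cast_one, Nat.cast_zero]
    exact ⟨fun h => (if_pos h).symm, fun h => (if_neg h).symm⟩
  · simp only [RExp.cost, IExp.cost, BExp.cost]
    omega
  · rintro s hF ⟨-, h, -⟩
    funext i
    exact h i i.2

/-- The rows with positive weight are listed in the integer array `17`; their number is stored in
the integer array `16`. -/
def gatherCmd : Cmd :=
  .seq (.iset 16 (.lit 0) (.lit 0) (.lit 0))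
    (forTo 10 (ivar 0) (.ite (.rlt (rlit 0) (.get 7 (ivar 10) (.lit 0)))
      (.seq (.iset 17 (ivar 16) (.lit 0) (ivar 10))
        (.iset 16 (.lit 0) (.lit 0) (.add (ivar 16) (.lit 1)))) .skip))

lemma runs_gatherCmd (hn : σ.int 0 0 0 = n) :
    Runs G ω gatherCmd σ (100 * n + 20) (fun σ' =>
      (∀ q < σ'.int 16 0 0, σ'.int 17 q 0 < n) ∧
      ∀ f : ℕ → ℝ, ∑ q ∈ Finset.range (σ'.int 16 0 0), f (σ'.int 17 q 0) =
        ∑ i ∈ Finset.range n, Set.indicator (Set.Ioi 0) (fun _ => f i) (σ.real 7 i 0)) := by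
  refine Runs.mono (Runs.seq (P := fun s => s = σ.setInt 16 0 0 0) (runs_iset rfl) fun σ₁ hF₁ h₁ =>
    runs_forTo (Inv := fun k s => (∀ q < s.int 16 0 0, s.int 17 q 0 < n) ∧
      ∀ f : ℕ → ℝ, ∑ q ∈ Finset.range (s.int 16 0 0), f (s.int 17 q 0) =
        ∑ i ∈ Finset.range k, Set.indicator (Set.Ioi 0) (fun _ => f i) (σ.real 7 i 0)) n
      (fun _ => 30) (by decide) (fun s hF => ?_) (fun k s x h => ?_) ?_ ?_ fun s _ h => h) ?_
      fun _ _ h => h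
  · simp only [IExp.eval]
    rw [hF.int 0 (by decide), hF₁.int 0 (by decide), hn]
  · simpa [State.setInt] using h
  · rw [h₁]; simp [State.setInt]
  · rintro k hk s hF hks ⟨hI, hI'⟩
    have h7 : s.real 7 = σ.real 7 := by rw [hF.real 7 (by decide), hF₁.real 7 (by decide)]
    refine Runs.mono (runs_ite (T := 20) (T' := 1)
      (Q := fun s => (∀ q < s.int 16 0 0, s.int 17 q 0 < n) ∧
      ∀ f : ℕ → ℝ, ∑ q ∈ Finset.range (s.int 16 0 0), f (s.int 17 q 0) =
        ∑ i ∈ Finset.range (k + 1), Set.indicator (Set.Ioi 0) (fun _ => f i) (σ.real 7 i 0))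
      (fun hu => ?_) (fun hu => ?_)) ?_ fun _ _ h => h
    · simp only [BExp.holds, RExp.eval, IExp.eval, hks, h7, Nat.cast_zero] at hu
      refine Runs.mono (Runs.seq (P := fun s' => s' = s.setInt 17 (s.int 16 0 0) 0 k)
        (runs_iset ?_) fun s' hF' hs' => runs_iset (Q := fun s' => s' =
          (s.setInt 17 (s.int 16 0 0) 0 k).setInt 16 0 0 (s.int 16 0 0 + 1)) ?_)
        ?_ ?_
      · simp only [IExp.eval, hks]
      · rw [hs']; simp [IExp.eval, State.setInt]
      · simp [IExp.cost]
      · rintro _ - rfl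
        have e16 : ((s.setInt 17 (s.int 16 0 0) 0 k).setInt 16 0 0 (s.int 16 0 0 + 1)).int 16 0 0 =
          s.int 16 0 0 + 1 := by simp [State.setInt]
        have e17 : ∀ q, ((s.setInt 17 (s.int 16 0 0) 0 k).setInt 16 0 0
            (s.int 16 0 0 + 1)).int 17 q 0 = if q = s.int 16 0 0 then k else s.int 17 q 0 := by
          intro q; simp [State.setInt]
        simp only [e16, e17]
        refine ⟨fun q hq => ?_, fun f => ?_⟩
        · split_ifs with h
          · exact hk
          · exact hI q (by omega)
        · rw [Finset.sum_range_succ, Finset.sum_range_succ, if_pos rfl,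
            Set.indicator_of_mem (Set.mem_Ioi.2 hu), ← hI']
          congr 1
          refine Finset.sum_congr rfl fun q hq => ?_
          rw [if_neg (Finset.mem_range.1 hq).ne]
    · simp only [BExp.holds, RExp.eval, IExp.eval, hks, h7, Nat.cast_zero] at hu
      refine runs_skip ⟨hI, fun f => ?_⟩
      rw [Finset.sum_range_succ, Set.indicator_of_notMem (by simpa using hu), add_zero, hI']
    · simp [IExp.cost, BExp.cost, RExp.cost]
  · rw [Finset.sum_const, Finset.card_range, smul_eq_mul]
    simp only [IExp.cost]
    omega

/-- Index of the listed row with position `ivar 12`. -/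
abbrev listExp : IExp := .get 17 (ivar 12) (.lit 0)

/-- The listed rows of the conditioned matrix are stored in the real array `20`. -/
def rowsCmd : Cmd :=
  forTo 12 (ivar 16) (fillTo 11 dimExp
    (sumTo 13 11 (rowLenExp listExp) .skip
      (.mul (.get 0 (.add (rowStartExp listExp) (ivar 13)) (.lit 0))
        (.get 10 (.get 3 (.add (rowStartExp listExp) (ivar 13)) (.lit 0)) (ivar 11))))
    20 (ivar 12) (ivar 11) (rvar 11))

lemma runs_rowsCmd {N : ℕ} (hN : σ.int 16 0 0 = N) (hS : Stores σ A b κ ε CG R)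
    (hL : ∀ q < N, σ.int 17 q 0 < n)
    (hV : ∀ i < d + 1, ∀ j < d + 1, σ.real 10 i j = natEntry R⁻¹ i j) :
    Runs G ω rowsCmd σ (300 * (N + 1) * (d + 1) ^ 2) (fun σ' => ∀ q < N, ∀ j < d + 1,
      σ'.real 20 q j = natEntry (whitened A b R) (σ.int 17 q 0) j) := by
  refine Runs.mono (runs_forTo (Inv := fun k s => ∀ q < k, ∀ j < d + 1,
      s.real 20 q j = natEntry (whitened A b R) (σ.int 17 q 0) j) N
    (fun _ => 200 * (d + 1) ^ 2) (by decide) (fun s' hF => ?_) (fun _ _ _ h => h)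
    (fun l hl => absurd hl (Nat.not_lt_zero _)) ?_ (fun _ _ h => h)) ?_ fun _ _ h => h
  · simp only [IExp.eval]
    rw [hF.int 16 (by decide), hN]
  · intro k hk σ₁ hF₁ hk₁ hI
    have S₁ := hS.of_frame hF₁ (by decide) (by decide)
    have h17 : σ₁.int 17 = σ.int 17 := hF₁.int 17 (by decide)
    set i := σ.int 17 k 0 with hi
    have hin : i < n := hL k hk
    refine Runs.mono (runs_fillTo (d + 1) (fun _ => k) (fun j => j)
      (fun j => natEntry (whitened A b R) i j) (fun _ => 100 * (d + 1) + 30)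
      (by decide) (by decide) (fun _ _ _ _ _ h => h) (fun s' hF => ?_) ?_) ?_ ?_
    · simp only [IExp.eval]
      rw [hF.int 1 (by decide), S₁.dim]
    · intro j hj σ₂ hF₂ hj₂ _ _
      have S₂ := S₁.of_frame hF₂ (by decide) (by decide)
      have hk₂ : σ₂.int 12 0 0 = k := by rw [hF₂.int 12 (by decide), hk₁]
      have hi₂ : σ₂.int 17 k 0 = i := by rw [hF₂.int 17 (by decide), h17]
      refine Runs.mono (runs_sumTo (rowLen σ₂ i) (fun v => σ₂.real 0 (σ₂.int 2 i 0 + v) 0 *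
        natEntry R⁻¹ (σ₂.int 3 (σ₂.int 2 i 0 + v) 0) j) (fun _ => 1) (by decide)
        (by decide) (fun s' hF => ?_) ?_) ?_ ?_
      · simp only [IExp.eval]
        rw [hF.int 17 (by decide), hF.int 12 (by decide), hF.int 2 (by decide), hk₂, hi₂, rowLen]
      · intro v hv σ₃ hF₃ hv₃
        refine runs_skip ?_
        have hcol : σ₂.int 3 (σ₂.int 2 i 0 + v) 0 < d + 1 := by
          obtain ⟨c, hc, -⟩ := (S₂.data.cols ⟨i, hin⟩).mapsTo
            (x := σ₂.int 2 i 0 + v) ⟨Nat.le_add_right _ _, by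
              have : v < σ₂.int 2 (i + 1) 0 - σ₂.int 2 i 0 := hv
              show σ₂.int 2 i 0 + v < σ₂.int 2 (i + 1) 0
              omega⟩
          exact lt_of_eq_of_lt hc.symm c.2
        have e1 : σ₃.int 12 0 0 = k := by rw [hF₃.int 12 (by decide), hk₂]
        have e2 : σ₃.int 11 0 0 = j := by rw [hF₃.int 11 (by decide), hj₂]
        have e3 : σ₃.int 17 k 0 = i := by rw [hF₃.int 17 (by decide), hi₂]
        have e4 : σ₃.int 2 = σ₂.int 2 := hF₃.int 2 (by decide)
        have e5 : σ₃.int 3 = σ₂.int 3 := hF₃.int 3 (by decide)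
        have e6 : σ₃.real 0 = σ₂.real 0 := hF₃.real 0 (by decide)
        have e7 : σ₃.real 10 = σ.real 10 := by
          rw [hF₃.real 10 (by decide), hF₂.real 10 (by decide), hF₁.real 10 (by decide)]
        simp only [RExp.eval, IExp.eval, e1, e2, e3, e4, e5, e6, e7, hv₃, hV _ hcol _ hj]
      · have := S₂.data.rowLen_le ⟨i, hin⟩
        rw [Finset.sum_const, Finset.card_range, smul_eq_mul]
        simp only [RExp.cost, IExp.cost]
        simp only at this
        omega
      · intro σ₃ hF₃ hsum
        have e1 : σ₃.int 12 0 0 = k := by rw [hF₃.int 12 (by decide), hk₂]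
        have e2 : σ₃.int 11 0 0 = j := by rw [hF₃.int 11 (by decide), hj₂]
        refine ⟨by simp only [IExp.eval, e1], by simp only [IExp.eval, e2], ?_⟩
        simp only [RExp.eval, IExp.eval, hsum]
        rw [S₂.data.sum_row ⟨i, hin⟩ (fun c => natEntry R⁻¹ c j), natEntry_of_lt _ hin hj,
          whitened, Matrix.mul_apply]
        refine Finset.sum_congr rfl fun v _ => ?_
        rw [natEntry_of_lt _ v.2 hj]
    · rw [Finset.sum_const, Finset.card_range, smul_eq_mul]
      simp only [RExp.cost, IExp.cost]
      nlinarith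
    · rintro σ₂ hF₂ ⟨h1, h2⟩ q hq j hj
      rcases Nat.lt_succ_iff_lt_or_eq.1 hq with h | rfl
      · rw [h2 q j fun k' _ h' => by omega]
        exact hI q h j hj
      · exact h1 j hj
  · rw [Finset.sum_const, Finset.card_range, smul_eq_mul]
    simp only [IExp.cost]
    nlinarith [Nat.one_le_pow 2 (d + 1) (by omega)]

end solve

end RealRAM

/-! ### One step of the descent -/

/-- The entries of a vector, extended by zero to natural number indices. -/
def natVec {m : ℕ} (v : Fin m → ℝ) (j : ℕ) : ℝ := if h : j < m then v ⟨j, h⟩ else 0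

lemma natVec_apply {m : ℕ} (v : Fin m → ℝ) (j : Fin m) : natVec v j = v j := by simp [natVec]

lemma natVec_of_lt {m j : ℕ} (v : Fin m → ℝ) (hj : j < m) : natVec v j = v ⟨j, hj⟩ := by
  simp [natVec, hj]

lemma natVec_affPoint_of_lt {d j : ℕ} (r : ℝ) (z : Fin d → ℝ) (hj : j < d) :
    natVec (affPoint r z) j = z ⟨j, hj⟩ := by
  rw [natVec_of_lt _ (by omega : j < d + 1), affPoint]
  exact Fin.snoc_castSucc (α := fun _ => ℝ) (-r) z ⟨j, hj⟩

lemma natVec_affPoint_last {d : ℕ} (r : ℝ) (z : Fin d → ℝ) : natVec (affPoint r z) d = -r := by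
  rw [natVec_of_lt _ (by omega : d < d + 1), affPoint]
  exact Fin.snoc_last (α := fun _ => ℝ) (-r) z

namespace RealRAM

section descent

variable {G : ℝ → ℝ} {ω : Tape} {n d : ℕ} {P : DescentParams n d} {L : ℕ → ℕ} {N : ℕ}
  {σ σ' : State}

/-- The data of the descent, as stored in memory: only the `N` rows with non-zero weight are
used, and `L` lists their indices. -/
structure StoresParams (σ : State) (P : DescentParams n d) (L : ℕ → ℕ) (N : ℕ) : Prop where
  dim : σ.int 1 0 0 = d
  count : σ.int 16 0 0 = N
  list : ∀ q < N, σ.int 17 q 0 = L q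
  list_lt : ∀ q < N, L q < n
  weight : ∀ q < N, σ.real 7 (L q) 0 = natVec P.w (L q)
  matrix : ∀ q < N, ∀ j < d + 1, σ.real 20 q j = natEntry P.U (L q) j
  eps : σ.real 2 0 0 = P.ε
  stepLength : σ.real 29 0 0 = P.ρ
  increment : σ.real 30 0 0 = P.η
  sum_eq : ∀ f : ℕ → ℝ, ∑ q ∈ Finset.range N, natVec P.w (L q) * f (L q) = ∑ i, P.w i * f i

lemma StoresParams.of_frame {c : Cmd} (h : StoresParams σ P L N) (hF : Frame c σ σ')
    (hi : ∀ a ∈ [1, 16, 17], a ∉ c.intWrites) (hr : ∀ a ∈ [2, 7, 20, 29, 30], a ∉ c.realWrites) :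
    StoresParams σ' P L N where
  dim := by rw [hF.int 1 (hi 1 (by simp)), h.dim]
  count := by rw [hF.int 16 (hi 16 (by simp)), h.count]
  list := by rw [hF.int 17 (hi 17 (by simp))]; exact h.list
  list_lt := h.list_lt
  weight := by rw [hF.real 7 (hr 7 (by simp))]; exact h.weight
  matrix := by rw [hF.real 20 (hr 20 (by simp))]; exact h.matrix
  eps := by rw [hF.real 2 (hr 2 (by simp)), h.eps]
  stepLength := by rw [hF.real 29 (hr 29 (by simp)), h.stepLength]
  increment := by rw [hF.real 30 (hr 30 (by simp)), h.increment]
  sum_eq := h.sum_eq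

/-- The state of the descent, as stored in memory. -/
structure StoresDescent (σ : State) (P : DescentParams n d) (s : Descent d) : Prop where
  point : ∀ j < d + 1, σ.real 21 j 0 = natVec (affPoint P.r s.z) j
  best : ∀ j < d + 1, σ.real 22 j 0 = natVec (affPoint P.r s.best) j
  scale : σ.real 25 0 0 = s.scale

lemma StoresDescent.of_frame {c : Cmd} {s : Descent d} (h : StoresDescent σ P s)
    (hF : Frame c σ σ') (hr : ∀ a ∈ [21, 22, 25], a ∉ c.realWrites) : StoresDescent σ' P s where
  point := by rw [hF.real 21 (hr 21 (by simp))]; exact h.point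
  best := by rw [hF.real 22 (hr 22 (by simp))]; exact h.best
  scale := by rw [hF.real 25 (hr 25 (by simp)), h.scale]

/-- The relative coordinates of the current point are stored in the real array `23`. -/
def coordCmd : Cmd :=
  fillTo 12 (ivar 16) (sumTo 13 11 dimExp .skip
    (.mul (.get 20 (ivar 12) (ivar 13)) (.get 21 (ivar 13) (.lit 0))))
    23 (ivar 12) (.lit 0) (.div (rvar 11) (rvar 25))

lemma runs_coordCmd {s : Descent d} (hP : StoresParams σ P L N) (hs : StoresDescent σ P s) :
    Runs G ω coordCmd σ (200 * (N + 1) * (d + 1)) (fun σ' => ∀ q < N,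
      σ'.real 23 q 0 = natVec (P.coord s.z s.scale) (L q)) := by
  refine Runs.mono (runs_fillTo N (fun q => q) (fun _ => 0)
    (fun q => natVec (P.coord s.z s.scale) (L q)) (fun _ => 100 * (d + 1)) (by decide) (by decide)
    (fun _ _ _ _ h _ => h) (fun s hF => ?_) ?_) ?_ fun _ _ h => h.1
  · simp only [IExp.eval]
    rw [hF.int 16 (by decide), hP.count]
  · intro q hq σ₁ hF₁ hq₁ _ _
    have hP₁ := hP.of_frame hF₁ (by decide) (by decide)
    have hs₁ := hs.of_frame hF₁ (by decide)
    refine Runs.mono (runs_sumTo (d + 1) (fun v => natEntry P.U (L q) v *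
      natVec (affPoint P.r s.z) v) (fun _ => 1) (by decide) (by decide) (fun s' hF => ?_) ?_) ?_ ?_
    · simp only [IExp.eval]
      rw [hF.int 1 (by decide), hP₁.dim]
    · intro v hv σ₂ hF₂ hv₂
      have hP₂ := hP₁.of_frame hF₂ (by decide) (by decide)
      have hs₂ := hs₁.of_frame hF₂ (by decide)
      have hq₂ : σ₂.int 12 0 0 = q := by rw [hF₂.int 12 (by decide), hq₁]
      refine runs_skip ?_
      simp only [RExp.eval, IExp.eval, hq₂, hv₂, hP₂.matrix q hq v hv, hs₂.point v hv]
    · rw [Finset.sum_const, Finset.card_range, smul_eq_mul]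
      simp only [RExp.cost, IExp.cost]
      omega
    · intro σ₂ hF₂ hsum
      have hs₂ := hs₁.of_frame hF₂ (by decide)
      have hq₂ : σ₂.int 12 0 0 = q := by rw [hF₂.int 12 (by decide), hq₁]
      refine ⟨by simp only [IExp.eval, hq₂], rfl, ?_⟩
      simp only [RExp.eval, IExp.eval, hsum, hs₂.scale]
      rw [natVec_of_lt _ (hP.list_lt q hq), DescentParams.coord, Matrix.mulVec, dotProduct,
        Finset.sum_range]
      congr 1
      refine Finset.sum_congr rfl fun v _ => ?_
      rw [natEntry_of_lt _ (hP.list_lt q hq) v.2, natVec_apply]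
  · rw [Finset.sum_const, Finset.card_range, smul_eq_mul]
    simp only [RExp.cost, IExp.cost]
    nlinarith

/-- The weight of the listed row with position `ivar 12`. -/
abbrev weightExp : RExp := .get 7 listExp (.lit 0)

/-- The relative coordinate of the listed row with position `ivar 12`. -/
abbrev coordExp : RExp := .get 23 (ivar 12) (.lit 0)

/-- The weighted sum that decides whether the current level is attained is stored in the real
variable `33`. -/
def levelCmd : Cmd := sumTo 12 33 (ivar 16) .skip (.mul weightExp (.evalG coordExp))

lemma runs_levelCmd {c : Fin n → ℝ} (hP : StoresParams σ P L N)
    (hc : ∀ q < N, σ.real 23 q 0 = natVec c (L q)) :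
    Runs G ω levelCmd σ (100 * (N + 1))
      (fun σ' => σ'.real 33 0 0 = ∑ i, P.w i * G (c i)) := by
  refine Runs.mono (runs_sumTo N (fun q => natVec P.w (L q) * G (natVec c (L q)))
    (fun _ => 1) (by decide) (by decide) (fun s' hF => ?_) ?_) ?_ ?_
  · simp only [IExp.eval]
    rw [hF.int 16 (by decide), hP.count]
  · intro q hq σ₁ hF₁ hq₁
    have hP₁ := hP.of_frame hF₁ (by decide) (by decide)
    have h23 : σ₁.real 23 = σ.real 23 := hF₁.real 23 (by decide)
    refine runs_skip ?_
    simp only [RExp.eval, IExp.eval, hq₁, hP₁.list q hq, hP₁.weight q hq, h23, hc q hq]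
  · rw [Finset.sum_const, Finset.card_range, smul_eq_mul]
    simp only [RExp.cost, IExp.cost]
    omega
  · intro σ₁ _ hsum
    rw [hsum, hP.sum_eq fun i => G (natVec c i)]
    simp only [natVec_apply]

/-- The weighted difference quotients are stored in the real array `27`. -/
def slopeCmd : Cmd :=
  fillTo 12 (ivar 16) .skip 27 (ivar 12) (.lit 0)
    (.mul weightExp (.div (.sub (.evalG (.mul (.add (rlit 1) (rvar 30)) coordExp))
      (.evalG coordExp)) (.mul (rvar 30) coordExp)))

lemma runs_slopeCmd {c : Fin n → ℝ} (hP : StoresParams σ P L N)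
    (hc : ∀ q < N, σ.real 23 q 0 = natVec c (L q)) :
    Runs G ω slopeCmd σ (100 * (N + 1))
      (fun σ' => ∀ q < N, σ'.real 27 q 0 =
        natVec P.w (L q) * relSlope G P.η (natVec c (L q))) := by
  refine Runs.mono (runs_fillTo N (fun q => q) (fun _ => 0)
    (fun q => natVec P.w (L q) * relSlope G P.η (natVec c (L q))) (fun _ => 1)
    (by decide) (by decide)
    (fun _ _ _ _ h _ => h) (fun s hF => ?_) ?_) ?_ fun _ _ h => h.1
  · simp only [IExp.eval]
    rw [hF.int 16 (by decide), hP.count]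
  · intro q hq σ₁ hF₁ hq₁ _ _
    have hP₁ := hP.of_frame hF₁ (by decide) (by decide)
    have h23 : σ₁.real 23 = σ.real 23 := hF₁.real 23 (by decide)
    refine runs_skip ⟨hq₁, rfl, ?_⟩
    simp only [RExp.eval, IExp.eval, hq₁, hP₁.list q hq, hP₁.weight q hq, h23, hc q hq,
      hP₁.increment, Nat.cast_one, relSlope]
  · rw [Finset.sum_const, Finset.card_range, smul_eq_mul]
    simp only [RExp.cost, IExp.cost]
    omega

/-- The approximate subgradient is stored in the real array `24`. -/
def gradCmd : Cmd :=
  fillTo 11 (ivar 1) (sumTo 12 11 (ivar 16) .skip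
    (.mul (.get 27 (ivar 12) (.lit 0)) (.get 20 (ivar 12) (ivar 11))))
    24 (ivar 11) (.lit 0) (rvar 11)

lemma runs_gradCmd {s : Descent d} (hP : StoresParams σ P L N)
    (hF : ∀ q < N, σ.real 27 q 0 =
      natVec P.w (L q) * relSlope G P.η (natVec (P.coord s.z s.scale) (L q))) :
    Runs G ω gradCmd σ (200 * (N + 1) * (d + 1))
      (fun σ' => ∀ j : Fin d, σ'.real 24 j 0 = P.grad G s.z s.scale j) := by
  refine Runs.mono (runs_fillTo d (fun q => q) (fun _ => 0)
    (natVec (P.grad G s.z s.scale)) (fun _ => 100 * (N + 1)) (by decide) (by decide)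
    (fun _ _ _ _ h _ => h) (fun s hF => ?_) ?_) ?_
    fun σ' _ h j => by rw [h.1 j j.2, natVec_apply]
  · simp only [IExp.eval]
    rw [hF.int 1 (by decide), hP.dim]
  · intro j hj σ₁ hF₁ hj₁ _ _
    have hP₁ := hP.of_frame hF₁ (by decide) (by decide)
    have h27 : σ₁.real 27 = σ.real 27 := hF₁.real 27 (by decide)
    refine Runs.mono (runs_sumTo N (fun q => natVec P.w (L q) * (relSlope G P.η
      (natVec (P.coord s.z s.scale) (L q)) * natEntry P.U (L q) j))
      (fun _ => 1) (by decide) (by decide) (fun s' hF => ?_) ?_) ?_ ?_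
    · simp only [IExp.eval]
      rw [hF.int 16 (by decide), hP₁.count]
    · intro q hq σ₂ hF₂ hq₂
      have hP₂ := hP₁.of_frame hF₂ (by decide) (by decide)
      have hj₂ : σ₂.int 11 0 0 = j := by rw [hF₂.int 11 (by decide), hj₁]
      have h27' : σ₂.real 27 = σ.real 27 := by rw [hF₂.real 27 (by decide), h27]
      refine runs_skip ?_
      simp only [RExp.eval, IExp.eval, hq₂, hj₂, hP₂.matrix q hq j (by omega), h27', hF q hq]
      ring
    · rw [Finset.sum_const, Finset.card_range, smul_eq_mul]
      simp only [RExp.cost, IExp.cost]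
      omega
    · intro σ₂ hF₂ hsum
      have hj₂ : σ₂.int 11 0 0 = j := by rw [hF₂.int 11 (by decide), hj₁]
      refine ⟨by simp only [IExp.eval, hj₂], rfl, ?_⟩
      simp only [RExp.eval, IExp.eval, hsum]
      rw [hP.sum_eq fun i => relSlope G P.η (natVec (P.coord s.z s.scale) i) * natEntry P.U i j,
        natVec_of_lt _ hj, DescentParams.grad]
      refine Finset.sum_congr rfl fun i _ => ?_
      rw [natVec_apply, natEntry_of_lt _ i.2 (by omega : j < d + 1), ← mul_assoc]
      rfl
  · rw [Finset.sum_const, Finset.card_range, smul_eq_mul]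
    simp only [RExp.cost, IExp.cost]
    nlinarith

/-- A step of fixed length against the approximate subgradient. -/
def moveCmd : Cmd :=
  .seq (sumTo 11 28 (ivar 1) .skip
    (.mul (.get 24 (ivar 11) (.lit 0)) (.get 24 (ivar 11) (.lit 0))))
    (fillTo 11 (ivar 1) .skip 21 (ivar 11) (.lit 0)
      (.sub (.get 21 (ivar 11) (.lit 0))
        (.div (.mul (rvar 29) (.get 24 (ivar 11) (.lit 0))) (.sqrt (rvar 28)))))

lemma runs_moveCmd {s : Descent d} (hP : StoresParams σ P L N) (hs : StoresDescent σ P s)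
    (hg : ∀ j : Fin d, σ.real 24 j 0 = P.grad G s.z s.scale j) :
    Runs G ω moveCmd σ (200 * (d + 1)) (fun σ' => StoresDescent σ' P { s with
      z := fun j => s.z j - P.ρ * P.grad G s.z s.scale j / P.gradNorm G s.z s.scale }) := by
  refine Runs.mono (Runs.seq (runs_sumTo (pre := .skip) (v := 11) (acc := 28) d
    (fun j => natVec (P.grad G s.z s.scale) j ^ 2)
    (fun _ => 1) (by decide) (by decide) (fun s' hF => ?_) ?_) fun σ₁ hF₁ h₁ =>
    Runs.mono (runs_fillTo (pre := .skip) (v := 11) (a := 21) d (fun j => j) (fun _ => 0)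
      (natVec fun j => s.z j - P.ρ *
      P.grad G s.z s.scale j / P.gradNorm G s.z s.scale) (fun _ => 1) (by decide) (by decide)
      (fun _ _ _ _ h _ => h) (fun s' hF => ?_) ?_) le_rfl
      (Q := fun σ' => StoresDescent σ' P { s with
      z := fun j => s.z j - P.ρ * P.grad G s.z s.scale j / P.gradNorm G s.z s.scale }) ?_) ?_
      fun _ _ h => h
  · simp only [IExp.eval]
    rw [hF.int 1 (by decide), hP.dim]
  · intro j hj σ₁ hF₁ hj₁
    have h24 : σ₁.real 24 = σ.real 24 := hF₁.real 24 (by decide)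
    refine runs_skip ?_
    simp only [RExp.eval, IExp.eval, hj₁, h24, hg ⟨j, hj⟩, natVec_of_lt _ hj]
    ring
  · simp only [IExp.eval]
    rw [hF.int 1 (by decide), hF₁.int 1 (by decide), hP.dim]
  · intro j hj σ₂ hF₂ hj₂ _ hunch
    have h24 : σ₂.real 24 = σ.real 24 := by rw [hF₂.real 24 (by decide), hF₁.real 24 (by decide)]
    have h28 : σ₂.real 28 = σ₁.real 28 := hF₂.real 28 (by decide)
    have h29 : σ₂.real 29 0 0 = P.ρ := by
      rw [hF₂.real 29 (by decide), hF₁.real 29 (by decide), hP.stepLength]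
    have h21 : σ₂.real 21 j 0 = s.z ⟨j, hj⟩ := by
      rw [hunch j le_rfl hj, hF₁.real 21 (by decide), hs.point j (by omega),
        natVec_affPoint_of_lt _ _ hj]
    refine runs_skip ⟨hj₂, rfl, ?_⟩
    simp only [RExp.eval, IExp.eval, hj₂, h21, h24, h28, h29, h₁, hg ⟨j, hj⟩, natVec_of_lt _ hj]
    rw [DescentParams.gradNorm, Finset.sum_range]
    simp only [natVec_apply]
  · rintro σ₂ hF₂ ⟨h1, h2⟩
    refine ⟨fun j hj => ?_, ?_, ?_⟩
    · rcases Nat.lt_succ_iff_lt_or_eq.1 hj with h | rfl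
      · rw [h1 j h, natVec_of_lt _ h, natVec_affPoint_of_lt _ _ h]
      · rw [h2 j 0 fun k hk h => by omega, hF₁.real 21 (by decide), hs.point j hj,
          natVec_affPoint_last, natVec_affPoint_last]
    · rw [hF₂.real 22 (by decide), hF₁.real 22 (by decide)]; exact hs.best
    · rw [hF₂.real 25 (by decide), hF₁.real 25 (by decide)]; exact hs.scale
  · rw [Finset.sum_const, Finset.card_range, smul_eq_mul, Finset.sum_const, Finset.card_range,
      smul_eq_mul]
    simp only [RExp.cost, IExp.cost]
    omega

/-- The current point is recorded as the best point. -/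
def copyCmd : Cmd := fillTo 11 dimExp .skip 22 (ivar 11) (.lit 0) (.get 21 (ivar 11) (.lit 0))

lemma runs_copyCmd {v : ℕ → ℝ} (hd : σ.int 1 0 0 = d) (hv : ∀ j < d + 1, σ.real 21 j 0 = v j) :
    Runs G ω copyCmd σ (100 * (d + 1)) (fun σ' => ∀ j < d + 1, σ'.real 22 j 0 = v j) := by
  refine Runs.mono (runs_fillTo (d + 1) (fun j => j) (fun _ => 0) v (fun _ => 1) (by decide)
    (by decide) (fun _ _ _ _ h _ => h) (fun s' hF => ?_) ?_) ?_ fun _ _ h => h.1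
  · simp only [IExp.eval]
    rw [hF.int 1 (by decide), hd]
  · intro j hj σ₁ hF₁ hj₁ _ _
    refine runs_skip ⟨hj₁, rfl, ?_⟩
    have h21 : σ₁.real 21 = σ.real 21 := hF₁.real 21 (by decide)
    simp only [RExp.eval, IExp.eval, hj₁, h21, hv j hj]
  · rw [Finset.sum_const, Finset.card_range, smul_eq_mul]
    simp only [RExp.cost, IExp.cost]
    omega

/-- One step of the descent. -/
def stepCmd : Cmd :=
  .seq coordCmd (.seq levelCmd (.ite (.rlt (rlit 1) (rvar 33))
    (.seq slopeCmd (.seq gradCmd moveCmd))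
    (.seq copyCmd (.rset 25 (.lit 0) (.lit 0)
      (.mul (rvar 25) (.sub (rlit 1) (.div (rvar 2) (rlit 16))))))))

lemma runs_stepCmd {s : Descent d} (hP : StoresParams σ P L N) (hs : StoresDescent σ P s) :
    Runs G ω stepCmd σ (2000 * (N + 1) * (d + 1))
      (fun σ' => StoresDescent σ' P (P.step G s)) := by
  refine Runs.mono (Runs.seq (runs_coordCmd hP hs) fun σ₁ hF₁ h₁ =>
    Runs.seq (runs_levelCmd (hP.of_frame hF₁ (by decide) (by decide)) h₁) fun σ₂ hF₂ h₂ => ?_)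
    (T := 200 * (N + 1) * (d + 1) + (100 * (N + 1) + (7 + ((100 * (N + 1) + (200 * (N + 1) * (d + 1)
      + 200 * (d + 1))) + (100 * (d + 1) + 30))))) ?_ fun _ _ h => h
  · have hP₂ := (hP.of_frame hF₁ (by decide) (by decide)).of_frame hF₂ (by decide) (by decide)
    have hs₂ := (hs.of_frame hF₁ (by decide)).of_frame hF₂ (by decide)
    have hc₂ : ∀ q < N, σ₂.real 23 q 0 = natVec (P.coord s.z s.scale) (L q) := by
      rw [hF₂.real 23 (by decide)]; exact h₁
    refine Runs.mono (runs_ite (fun hu => Runs.seq (runs_slopeCmd hP₂ hc₂) fun σ₃ hF₃ h₃ =>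
      Runs.seq (runs_gradCmd (hP₂.of_frame hF₃ (by decide) (by decide)) h₃) fun σ₄ hF₄ h₄ =>
      Runs.mono (runs_moveCmd ((hP₂.of_frame hF₃ (by decide) (by decide)).of_frame hF₄
        (by decide) (by decide)) ((hs₂.of_frame hF₃ (by decide)).of_frame hF₄ (by decide)) h₄)
        le_rfl (Q := fun σ' => StoresDescent σ' P (P.step G s)) fun σ₅ _ h₅ => ?_)
      fun hu => Runs.seq (runs_copyCmd hP₂.dim hs₂.point) fun σ₃ hF₃ h₃ =>
        Runs.mono (T' := 30)
          (P := fun s' => s' = σ₃.setReal 25 0 0 (s.scale * (1 - P.ε / 16)))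
          (Q := fun σ' => StoresDescent σ' P (P.step G s)) (runs_rset ?_) ?_ ?_) ?_ fun _ _ h => h
    · simp only [BExp.holds, RExp.eval, IExp.eval, h₂, Nat.cast_one] at hu
      rw [DescentParams.step, if_pos hu]
      exact h₅
    · have h25 : σ₃.real 25 0 0 = s.scale := by rw [hF₃.real 25 (by decide), hs₂.scale]
      have h2 : σ₃.real 2 0 0 = P.ε := by rw [hF₃.real 2 (by decide), hP₂.eps]
      simp only [RExp.eval, IExp.eval, h25, h2, Nat.cast_one, Nat.cast_ofNat]
    · simp [RExp.cost, IExp.cost]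
    · rintro _ - rfl
      simp only [BExp.holds, RExp.eval, IExp.eval, h₂, Nat.cast_one] at hu
      rw [DescentParams.step, if_neg hu]
      refine ⟨fun j hj => ?_, fun j hj => ?_, ?_⟩
      · have : σ₃.real 21 j 0 = natVec (affPoint P.r s.z) j := by
          rw [hF₃.real 21 (by decide), hs₂.point j hj]
        simpa [State.setReal] using this
      · simpa [State.setReal] using h₃ j hj
      · simp [State.setReal]
    · simp only [BExp.cost, RExp.cost, IExp.cost]
      omega
  · nlinarith

end descent

end RealRAM

/-! ### The solver -/

namespace RealRAM

section solve

variable {G : ℝ → ℝ} {ω : Tape} {n d : ℕ} {A : Matrix (Fin n) (Fin d) ℝ} {b : Fin n → ℝ}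
  {κ ε CG : ℝ} {R : Matrix (Fin (d + 1)) (Fin (d + 1)) ℝ} {σ σ' : State}

/-- The parameters of the descent for the weights `w`. -/
def descentParams (A : Matrix (Fin n) (Fin d) ℝ) (b : Fin n → ℝ)
    (R : Matrix (Fin (d + 1)) (Fin (d + 1)) ℝ) (κ ε CG : ℝ) (w : Fin n → ℝ) :
    DescentParams n d where
  w := w
  U := whitened A b R
  r := R (Fin.last d) (Fin.last d)
  ε := ε
  ρ := ε * |R (Fin.last d) (Fin.last d)| / (256 * κ)
  η := ε / (256 * CG)

/-- The start of the descent. -/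
def descentStart (R : Matrix (Fin (d + 1)) (Fin (d + 1)) ℝ) (κ : ℝ) : Descent d :=
  ⟨0, 0, 2 * κ * |R (Fin.last d) (Fin.last d)|⟩

/-- The last diagonal entry of the triangular factor. -/
abbrev lastExp : RExp := .get 4 (ivar 1) (ivar 1)

/-- The initial scale. -/
abbrev scaleExp : RExp := .mul (.mul (rlit 2) (rvar 1)) (.sqrt (.mul lastExp lastExp))

/-- The step length. -/
abbrev lengthExp : RExp :=
  .div (.mul (rvar 2) (.sqrt (.mul lastExp lastExp))) (.mul (rlit 256) (rvar 1))

/-- The increment of the difference quotients. -/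
abbrev incrementExp : RExp := .div (rvar 2) (.mul (rlit 256) (rvar 3))

/-- The number of steps, multiplied by the square of the accuracy. -/
abbrev budgetExp : RExp :=
  .mul (rlit 2097152) (.mul (.mul (rvar 1) (rvar 1)) (.mul (rvar 1) (rvar 1)))

/-- Initialization of the real variables of the descent. -/
def scalarsCmd : Cmd :=
  .seq (.rset 25 (.lit 0) (.lit 0) scaleExp) (.seq (.rset 29 (.lit 0) (.lit 0) lengthExp)
    (.seq (.rset 30 (.lit 0) (.lit 0) incrementExp) (.seq (.rset 32 (.lit 0) (.lit 0) budgetExp)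
      (.rset 26 (.lit 0) (.lit 0) (rlit 0)))))

lemma runs_rset_var {a : ℕ} {e : RExp} :
    Runs G ω (.rset a (.lit 0) (.lit 0) e) σ (e.cost + 3)
      (fun σ' => σ'.real a 0 0 = e.eval G σ) :=
  Runs.mono (runs_rset (Q := fun σ' => σ'.real a 0 0 = e.eval G σ)
    (by simp [State.setReal, IExp.eval])) (by simp only [IExp.cost]; omega) fun _ _ h => h

lemma Stores.last (hS : Stores σ A b κ ε CG R) :
    σ.real 4 d d = R (Fin.last d) (Fin.last d) := hS.factor (Fin.last d) (Fin.last d)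

lemma runs_scalarsCmd (hS : Stores σ A b κ ε CG R) :
    Runs G ω scalarsCmd σ 200 (fun σ' =>
      σ'.real 25 0 0 = 2 * κ * |R (Fin.last d) (Fin.last d)| ∧
      σ'.real 29 0 0 = ε * |R (Fin.last d) (Fin.last d)| / (256 * κ) ∧
      σ'.real 30 0 0 = ε / (256 * CG) ∧ σ'.real 32 0 0 = 2 ^ 21 * κ ^ 4 ∧
      σ'.real 26 0 0 = 0) := by
  refine Runs.mono (Runs.seq runs_rset_var fun σ₁ hF₁ h₁ => Runs.seq runs_rset_var fun σ₂ hF₂ h₂ =>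
    Runs.seq runs_rset_var fun σ₃ hF₃ h₃ => Runs.seq runs_rset_var fun σ₄ hF₄ h₄ =>
    Runs.mono runs_rset_var le_rfl fun σ₅ hF₅ h₅ => ?_) ?_ fun _ _ h => h
  · have S₁ := hS.of_frame hF₁ (by decide) (by decide)
    have S₂ := S₁.of_frame hF₂ (by decide) (by decide)
    have S₃ := S₂.of_frame hF₃ (by decide) (by decide)
    refine ⟨?_, ?_, ?_, ?_, ?_⟩
    · rw [hF₅.real 25 (by decide), hF₄.real 25 (by decide), hF₃.real 25 (by decide),
        hF₂.real 25 (by decide), h₁]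
      simp only [RExp.eval, IExp.eval, hS.dim, hS.last, hS.kappa, Real.sqrt_mul_self_eq_abs,
        Nat.cast_ofNat]
    · rw [hF₅.real 29 (by decide), hF₄.real 29 (by decide), hF₃.real 29 (by decide), h₂]
      simp only [RExp.eval, IExp.eval, S₁.dim, S₁.last, S₁.kappa, S₁.eps,
        Real.sqrt_mul_self_eq_abs, Nat.cast_ofNat]
    · rw [hF₅.real 30 (by decide), hF₄.real 30 (by decide), h₃]
      simp only [RExp.eval, IExp.eval, S₂.growth, S₂.eps, Nat.cast_ofNat]
    · rw [hF₅.real 32 (by decide), h₄]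
      simp only [RExp.eval, IExp.eval, S₃.kappa, Nat.cast_ofNat]
      ring
    · rw [h₅]
      simp only [RExp.eval, IExp.eval, Nat.cast_zero]
  · simp [RExp.cost, IExp.cost]

/-- Initialization of the current point. In truncated subtraction, `(j + 1) - d` is `0` for `j < d`
and `1` for `j = d`. -/
def pointCmd : Cmd :=
  fillTo 11 dimExp .skip 21 (ivar 11) (.lit 0)
    (.mul (.sub (rlit 0) lastExp) (.ofInt (.sub (.add (ivar 11) (.lit 1)) (ivar 1))))

lemma runs_pointCmd (hS : Stores σ A b κ ε CG R) :
    Runs G ω pointCmd σ (100 * (d + 1)) (fun σ' => ∀ j < d + 1,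
      σ'.real 21 j 0 = natVec (affPoint (R (Fin.last d) (Fin.last d)) (0 : Fin d → ℝ)) j) := by
  refine Runs.mono (runs_fillTo (d + 1) (fun j => j) (fun _ => 0)
    (natVec (affPoint (R (Fin.last d) (Fin.last d)) (0 : Fin d → ℝ))) (fun _ => 1) (by decide)
    (by decide) (fun _ _ _ _ h _ => h) (fun s' hF => ?_) ?_) ?_ fun _ _ h => h.1
  · simp only [IExp.eval]
    rw [hF.int 1 (by decide), hS.dim]
  · intro j hj σ₁ hF₁ hj₁ _ _
    have S₁ := hS.of_frame hF₁ (by decide) (by decide)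
    refine runs_skip ⟨hj₁, rfl, ?_⟩
    simp only [RExp.eval, IExp.eval, hj₁, S₁.dim, S₁.last]
    rcases Nat.lt_succ_iff_lt_or_eq.1 hj with h | rfl
    · rw [natVec_affPoint_of_lt _ _ h, show j + 1 - d = 0 by omega]
      simp
    · rw [natVec_affPoint_last, show j + 1 - j = 1 by omega]
      simp
  · rw [Finset.sum_const, Finset.card_range, smul_eq_mul]
    simp only [RExp.cost, IExp.cost]
    omega

/-- The descent. There is no rounding operation, so the counter `k` is a real variable, and the loop
runs while `k ε ^ 2 < 2 ^ 21 κ ^ 4`. -/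
def descentCmd : Cmd :=
  .loop (.rlt (.mul (rvar 26) (.mul (rvar 2) (rvar 2))) (rvar 32))
    (.seq stepCmd (.rset 26 (.lit 0) (.lit 0) (.add (rvar 26) (rlit 1))))

lemma runs_descentCmd {P : DescentParams n d} {L : ℕ → ℕ} {N M : ℕ} {s : Descent d} {B : ℝ}
    (hP : StoresParams σ P L N) (hs : StoresDescent σ P s) (h26 : σ.real 26 0 0 = 0)
    (h32 : σ.real 32 0 0 = B) (hM : B ≤ M * P.ε ^ 2) :
    Runs G ω descentCmd σ (M * (3000 * (N + 1) * (d + 1)) + 15) (fun σ' => ∃ k : ℕ,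
      B ≤ k * P.ε ^ 2 ∧ StoresDescent σ' P ((P.step G)^[k] s)) := by
  refine Runs.mono (runs_loop (Inv := fun k σ' => StoresDescent σ' P ((P.step G)^[k] s) ∧
    σ'.real 26 0 0 = k) M (fun _ => 2000 * (N + 1) * (d + 1) + 9)
    (Q := fun σ' => ∃ k : ℕ, B ≤ k * P.ε ^ 2 ∧ StoresDescent σ' P ((P.step G)^[k] s))
    ⟨hs, by rw [h26, Nat.cast_zero]⟩ ?_ ?_) ?_ fun _ _ h => h
  · rintro k σ₁ hF₁ ⟨hI, hk⟩ hu
    have hP₁ := hP.of_frame hF₁ (by decide) (by decide)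
    have h32' : σ₁.real 32 0 0 = B := by rw [hF₁.real 32 (by decide), h32]
    simp only [BExp.holds, RExp.eval, IExp.eval, hk, h32', hP₁.eps] at hu
    refine ⟨?_, ?_⟩
    · by_contra hkM
      have h1 : (M : ℝ) ≤ k := by exact_mod_cast not_lt.1 hkM
      have h2 := mul_le_mul_of_nonneg_right h1 (sq_nonneg P.ε)
      nlinarith
    · refine Runs.mono (Runs.seq (runs_stepCmd hP₁ hI) fun σ₂ hF₂ h₂ =>
        Runs.mono (T' := 9) (Q := fun σ' => StoresDescent σ' P ((P.step G)^[k + 1] s) ∧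
          σ'.real 26 0 0 = (k + 1 : ℕ)) runs_rset_var ?_ fun σ₃ hF₃ h₃ => ⟨?_, ?_⟩) le_rfl
        fun _ _ h => h
      · simp [RExp.cost, IExp.cost]
      · rw [Function.iterate_succ_apply']
        exact h₂.of_frame hF₃ (by decide)
      · have : σ₂.real 26 0 0 = k := by rw [hF₂.real 26 (by decide), hk]
        rw [h₃]
        simp only [RExp.eval, IExp.eval, this, Nat.cast_one, Nat.cast_add]
  · rintro k σ₁ hF₁ - ⟨hI, hk⟩ hu
    have hP₁ := hP.of_frame hF₁ (by decide) (by decide)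
    have h32' : σ₁.real 32 0 0 = B := by rw [hF₁.real 32 (by decide), h32]
    simp only [BExp.holds, RExp.eval, IExp.eval, hk, h32', hP₁.eps, not_lt] at hu
    exact ⟨k, by rw [sq]; exact hu, hI⟩
  · rw [Finset.sum_const, Finset.card_range, smul_eq_mul]
    simp only [BExp.cost, RExp.cost, IExp.cost]
    have h1 : 1 ≤ (N + 1) * (d + 1) := Nat.mul_pos (by omega) (by omega)
    refine Nat.add_le_add (Nat.mul_le_mul_left _ ?_) (by norm_num)
    rw [mul_assoc, mul_assoc]
    omega

/-- The output is computed from the best point. -/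
def outputCmd : Cmd :=
  fillTo 11 (ivar 1) (sumTo 13 11 dimExp .skip
    (.mul (.get 10 (ivar 11) (ivar 13)) (.get 22 (ivar 13) (.lit 0))))
    8 (ivar 11) (.lit 0) (rvar 11)

lemma runs_outputCmd {V : Matrix (Fin (d + 1)) (Fin (d + 1)) ℝ} {v : Fin (d + 1) → ℝ}
    (hd : σ.int 1 0 0 = d) (hV : ∀ i < d + 1, ∀ j < d + 1, σ.real 10 i j = natEntry V i j)
    (hv : ∀ j < d + 1, σ.real 22 j 0 = natVec v j) :
    Runs G ω outputCmd σ (200 * (d + 1) ^ 2) (fun σ' => σ'.vec 8 d =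
      fun j : Fin d => (V *ᵥ v) j.castSucc) := by
  refine Runs.mono (runs_fillTo d (fun q => q) (fun _ => 0)
    (natVec (V *ᵥ v)) (fun _ => 100 * (d + 1)) (by decide) (by decide)
    (fun _ _ _ _ h _ => h) (fun s hF => ?_) ?_) ?_ ?_
  · simp only [IExp.eval]
    rw [hF.int 1 (by decide), hd]
  · intro j hj σ₁ hF₁ hj₁ _ _
    refine Runs.mono (runs_sumTo (d + 1) (fun i => natEntry V j i * natVec v i)
      (fun _ => 1) (by decide) (by decide) (fun s' hF => ?_) ?_) ?_ ?_
    · simp only [IExp.eval]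
      rw [hF.int 1 (by decide), hF₁.int 1 (by decide), hd]
    · intro q hq σ₂ hF₂ hq₂
      have hj₂ : σ₂.int 11 0 0 = j := by rw [hF₂.int 11 (by decide), hj₁]
      have h10 : σ₂.real 10 = σ.real 10 := by rw [hF₂.real 10 (by decide), hF₁.real 10 (by decide)]
      have h22 : σ₂.real 22 = σ.real 22 := by rw [hF₂.real 22 (by decide), hF₁.real 22 (by decide)]
      refine runs_skip ?_
      simp only [RExp.eval, IExp.eval, hq₂, hj₂, h10, h22, hv q hq, hV j (by omega) q hq]
    · rw [Finset.sum_const, Finset.card_range, smul_eq_mul]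
      simp only [RExp.cost, IExp.cost]
      omega
    · intro σ₂ hF₂ hsum
      have hj₂ : σ₂.int 11 0 0 = j := by rw [hF₂.int 11 (by decide), hj₁]
      refine ⟨by simp only [IExp.eval, hj₂], rfl, ?_⟩
      simp only [RExp.eval, IExp.eval, hsum]
      rw [natVec_of_lt _ (by omega : j < d + 1), Matrix.mulVec, dotProduct, Finset.sum_range]
      refine Finset.sum_congr rfl fun i _ => ?_
      rw [natVec_apply, natEntry_of_lt _ (by omega : j < d + 1) i.2]
  · rw [Finset.sum_const, Finset.card_range, smul_eq_mul]
    simp only [RExp.cost, IExp.cost]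
    nlinarith
  · rintro σ₁ _ ⟨h1, -⟩
    funext j
    rw [State.vec, h1 j j.2, natVec_of_lt _ (by omega : (j : ℕ) < d + 1)]
    rfl

/-- The program for the weighted problem. -/
def solveCmd : Cmd :=
  .seq gatherCmd (.seq rowsCmd (.seq scalarsCmd (.seq pointCmd (.seq copyCmd
    (.seq descentCmd outputCmd)))))

lemma runs_solveCmd {N M : ℕ} (hS : Stores σ A b κ ε CG R)
    (hV : ∀ i < d + 1, ∀ j < d + 1, σ.real 10 i j = natEntry R⁻¹ i j)
    (hw : 0 ≤ σ.vec 7 n)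
    (hN : ∑ i, Set.indicator {0}ᶜ (fun _ => (1 : ℝ)) (σ.vec 7 n i) ≤ N)
    (hM : 2 ^ 21 * κ ^ 4 ≤ M * ε ^ 2) :
    Runs G ω solveCmd σ (100 * n + 4000 * (M + 1) * (N + 1) * (d + 1) ^ 2) (fun σ' => ∃ k : ℕ,
      2 ^ 21 * κ ^ 4 ≤ k * ε ^ 2 ∧ σ'.vec 8 d = fun j : Fin d => (R⁻¹ *ᵥ affPoint
        (R (Fin.last d) (Fin.last d)) (((descentParams A b R κ ε CG (σ.vec 7 n)).step G)^[k]
          (descentStart R κ)).best) j.castSucc) := by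
  set w := σ.vec 7 n with hw_def
  set P := descentParams A b R κ ε CG w with hP_def
  refine Runs.mono (Runs.seq (runs_gatherCmd hS.rows) (T' := 300 * (N + 1) * (d + 1) ^ 2 + (200 +
    (100 * (d + 1) + (100 * (d + 1) + ((M * (3000 * (N + 1) * (d + 1)) + 15) +
      200 * (d + 1) ^ 2))))) fun σ₁ hF₁ h₁ => ?_) ?_ fun _ _ h => h
  · obtain ⟨hlt, hsum⟩ := h₁
    set c := σ₁.int 16 0 0 with hc
    have hind : ∀ i : Fin n, ∀ f : ℝ, Set.indicator (Set.Ioi 0) (fun _ => f) (σ.real 7 i 0) =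
        Set.indicator {0}ᶜ (fun _ => f) (w i) := by
      intro i f
      have hwi : w i = σ.real 7 i 0 := rfl
      rcases (hw i).eq_or_lt with h | h
      · rw [Set.indicator_of_notMem, Set.indicator_of_notMem]
        · simpa using h.symm
        · rw [← hwi, ← h]; simp
      · rw [Set.indicator_of_mem, Set.indicator_of_mem]
        · simpa using (show w i ≠ 0 from h.ne')
        · rw [← hwi]; exact h
    have hcN : c ≤ N := by
      have h1 := hsum fun _ => 1
      rw [Finset.sum_const, Finset.card_range, nsmul_eq_mul, mul_one, Finset.sum_range] at h1
      simp only [hind] at h1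
      exact_mod_cast h1.le.trans hN
    have hS₁ := hS.of_frame hF₁ (by decide) (by decide)
    have hV₁ : ∀ i < d + 1, ∀ j < d + 1, σ₁.real 10 i j = natEntry R⁻¹ i j := by
      rw [hF₁.real 10 (by decide)]; exact hV
    refine Runs.mono (Runs.seq (runs_rowsCmd (N := c) rfl hS₁ hlt hV₁) fun σ₂ hF₂ h₂ =>
      Runs.seq (runs_scalarsCmd (hS₁.of_frame hF₂ (by decide) (by decide))) fun σ₃ hF₃ h₃ =>
      Runs.seq (runs_pointCmd ((hS₁.of_frame hF₂ (by decide) (by decide)).of_frame hF₃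
        (by decide) (by decide))) fun σ₄ hF₄ h₄ =>
      Runs.seq (runs_copyCmd (((hS₁.of_frame hF₂ (by decide) (by decide)).of_frame hF₃
        (by decide) (by decide)).of_frame hF₄ (by decide) (by decide)).dim h₄)
        fun σ₅ hF₅ h₅ => Runs.seq (T' := 200 * (d + 1) ^ 2)
          (runs_descentCmd (P := P) (L := fun q => σ₁.int 17 q 0) (N := c)
          (M := M) (s := descentStart R κ) (B := 2 ^ 21 * κ ^ 4) ?_ ?_ ?_ ?_ hM)
        fun σ₆ hF₆ h₆ => ?_) ?_ fun _ _ h => h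
    all_goals try have S₂ := hS₁.of_frame hF₂ (by decide) (by decide)
    all_goals try have S₃ := S₂.of_frame hF₃ (by decide) (by decide)
    all_goals try have S₄ := S₃.of_frame hF₄ (by decide) (by decide)
    all_goals try have S₅ := S₄.of_frame hF₅ (by decide) (by decide)
    · refine ⟨S₅.dim, ?_, ?_, hlt, ?_, ?_, S₅.eps, ?_, ?_, ?_⟩
      · rw [hF₅.int 16 (by decide), hF₄.int 16 (by decide), hF₃.int 16 (by decide),
          hF₂.int 16 (by decide)]
      · intro q _
        rw [hF₅.int 17 (by decide), hF₄.int 17 (by decide), hF₃.int 17 (by decide),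
          hF₂.int 17 (by decide)]
      · intro q hq
        rw [hF₅.real 7 (by decide), hF₄.real 7 (by decide), hF₃.real 7 (by decide),
          hF₂.real 7 (by decide), hF₁.real 7 (by decide), natVec_of_lt _ (hlt q hq)]
        rfl
      · rw [hF₅.real 20 (by decide), hF₄.real 20 (by decide), hF₃.real 20 (by decide)]
        exact h₂
      · rw [hF₅.real 29 (by decide), hF₄.real 29 (by decide)]
        exact h₃.2.1
      · rw [hF₅.real 30 (by decide), hF₄.real 30 (by decide)]
        exact h₃.2.2.1
      · intro f
        rw [hsum fun i => natVec P.w i * f i, Finset.sum_range]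
        refine Finset.sum_congr rfl fun i _ => ?_
        rw [hind, natVec_apply]
        by_cases h0 : w i = 0
        · rw [Set.indicator_of_notMem (by simpa using h0), show P.w i = 0 from h0, zero_mul]
        · rw [Set.indicator_of_mem (by simpa using h0)]
    · refine ⟨?_, h₅, ?_⟩
      · rw [hF₅.real 21 (by decide)]
        exact h₄
      · rw [hF₅.real 25 (by decide), hF₄.real 25 (by decide)]
        exact h₃.1
    · rw [hF₅.real 26 (by decide), hF₄.real 26 (by decide)]
      exact h₃.2.2.2.2
    · rw [hF₅.real 32 (by decide), hF₄.real 32 (by decide)]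
      exact h₃.2.2.2.1
    · obtain ⟨k, hk, h₆⟩ := h₆
      refine Runs.mono (runs_outputCmd (S₅.of_frame hF₆ (by decide) (by decide)).dim
        (V := R⁻¹) ?_ h₆.best) le_rfl fun σ₇ _ h₇ => ⟨k, hk, h₇⟩
      rw [hF₆.real 10 (by decide), hF₅.real 10 (by decide), hF₄.real 10 (by decide),
        hF₃.real 10 (by decide), hF₂.real 10 (by decide)]
      exact hV₁
    · have h1 := Nat.mul_le_mul_left 300 (Nat.add_le_add_right hcN 1)
      have h2 := Nat.mul_le_mul_left 3000 (Nat.add_le_add_right hcN 1)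
      have h3 := Nat.mul_le_mul_right ((d + 1) ^ 2) h1
      have h4 := Nat.mul_le_mul_left M (Nat.mul_le_mul_right (d + 1) h2)
      omega
  · have h1 : 1 ≤ (d + 1) ^ 2 := Nat.one_le_pow _ _ (by omega)
    have h2 : d + 1 ≤ (d + 1) ^ 2 := Nat.le_self_pow (by norm_num) _
    have h4 : (d + 1) ^ 2 ≤ (N + 1) * (d + 1) ^ 2 := Nat.le_mul_of_pos_left _ (by omega)
    have h5 := Nat.mul_le_mul_left M (Nat.mul_le_mul_left (3000 * (N + 1)) h2)
    rw [show M * (3000 * (N + 1) * (d + 1) ^ 2) = 3000 * (M * ((N + 1) * (d + 1) ^ 2)) by ring] at h5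
    rw [show 300 * (N + 1) * (d + 1) ^ 2 = 300 * ((N + 1) * (d + 1) ^ 2) by ring,
      show 4000 * (M + 1) * (N + 1) * (d + 1) ^ 2 = 4000 * (M * ((N + 1) * (d + 1) ^ 2)) +
        4000 * ((N + 1) * (d + 1) ^ 2) by ring]
    omega

end solve

end RealRAM

/-! ### Analysis of the scores and of the running time -/

namespace RealRAM

section scores

variable {G : ℝ → ℝ} {CG : ℝ} {n d m : ℕ} {A : Matrix (Fin n) (Fin d) ℝ} {b : Fin n → ℝ}
  {ε : ℝ} {R : Matrix (Fin (d + 1)) (Fin (d + 1)) ℝ} {s : Fin m → Fin (d + 1) → Bool} {i : Fin n}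

lemma sqrt_sketchSq_le (hm : 0 < m) {v : Fin (d + 1) → ℝ} (h : SketchGood v s) :
    Real.sqrt (sketchSq v s / m) ≤ 2 * l2 v := by
  have hm' : (0 : ℝ) < m := by exact_mod_cast hm
  rw [Real.sqrt_le_left (by linarith [l2_nonneg v]), div_le_iff₀ hm', mul_pow, l2_sq]
  linarith [h.2]

lemma le_sqrt_sketchSq (hm : 0 < m) {v : Fin (d + 1) → ℝ} (h : SketchGood v s) :
    l2 v ≤ 2 * Real.sqrt (sketchSq v s / m) := by
  have hm' : (0 : ℝ) < m := by exact_mod_cast hm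
  rw [← div_le_iff₀' two_pos]
  refine Real.le_sqrt_of_sq_le ?_
  rw [le_div_iff₀ hm', div_pow, l2_sq]
  linarith [h.1]

lemma sketchScore_le (hG : IsOrliczFunction G CG) (hm : 0 < m)
    (h : SketchGood (whitened A b R i) s) :
    sketchScore G A b R s i ≤ 4 * CG * leverage G A b R i := by
  have h1 := hG.map_mul_le_sq one_le_two (l2 (whitened A b R i))
  have h2 := hG.mono (Real.sqrt_nonneg _) (sqrt_sketchSq_le hm h)
  have e : leverage G A b R i = G (l2 (whitened A b R i)) := rfl
  rw [sketchScore, e]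
  linarith

lemma leverage_le (hG : IsOrliczFunction G CG) (hm : 0 < m)
    (h : SketchGood (whitened A b R i) s) :
    leverage G A b R i ≤ 4 * CG * sketchScore G A b R s i := by
  have h1 := hG.map_mul_le_sq one_le_two (Real.sqrt (sketchSq (whitened A b R i) s / m))
  have h2 := hG.mono (l2_nonneg _) (le_sqrt_sketchSq hm h)
  have e : leverage G A b R i = G (l2 (whitened A b R i)) := rfl
  rw [sketchScore, e]
  linarith

lemma sketchProb_mem (hG : IsOrliczFunction G CG) (hε : 0 < ε) (N : ℕ)
    (s : Fin m → Fin (d + 1) → Bool) (i : Fin n) :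
    0 ≤ sketchProb G A b R N CG ε s i ∧ sketchProb G A b R N CG ε s i ≤ 1 := by
  refine ⟨le_min zero_le_one ?_, min_le_left _ _⟩
  have := hG.const_pos
  have := hG.nonneg (Real.sqrt (sketchSq (whitened A b R i) s / m))
  unfold sketchScore
  positivity

/-- The probabilities computed from the estimates are admissible: the logarithm is replaced by the
larger `1 / ε`, and the constant makes up for the error of the estimates. -/
lemma admissible_sketchProb (hG : IsOrliczFunction G CG) (hm : 0 < m) (hε : 0 < ε)
    (hε1 : ε ≤ 1 / 2) {C : ℝ} (hC : 0 ≤ C) {N : ℕ} (hN : 4 * C ≤ N)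
    (h : ∀ i, SketchGood (whitened A b R i) s) :
    Admissible C d ε (leverage G A b R) (sketchProb G A b R N CG ε s) := by
  intro i
  have h01 := sketchProb_mem (A := A) (b := b) (R := R) hG hε N s i
  refine ⟨h01.1, h01.2, min_le_min le_rfl ?_⟩
  have hCG := hG.const_pos
  have hl := leverage_le hG hm (h i)
  have hl0 : 0 ≤ leverage G A b R i := hG.nonneg _
  have hu0 : 0 ≤ sketchScore G A b R s i := hG.nonneg _
  have hlog : Real.log (1 / ε) ≤ 1 / ε := (Real.log_le_sub_one_of_pos (by positivity)).trans
    (by linarith)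
  calc C * d * (ε ^ 2)⁻¹ * Real.log (1 / ε) * leverage G A b R i
      ≤ C * d * (ε ^ 2)⁻¹ * (1 / ε) * (4 * CG * sketchScore G A b R s i) := by gcongr
    _ = (4 * C) * (d * CG * sketchScore G A b R s i / (ε * ε * ε)) := by
        field_simp
    _ ≤ N * (d * CG * sketchScore G A b R s i / (ε * ε * ε)) := by gcongr
    _ = _ := by ring

end scores

section instances

variable {G : ℝ → ℝ} {CG : ℝ} {n d s : ℕ} {A : Matrix (Fin n) (Fin d) ℝ} {b : Fin n → ℝ}
  {S : Matrix (Fin s) (Fin n) ℝ} {κ ε : ℝ} {Q : Matrix (Fin s) (Fin (d + 1)) ℝ}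
  {R : Matrix (Fin (d + 1)) (Fin (d + 1)) ℝ}

/-- The expected number of non-zero weights is polynomial in the parameters. -/
lemma sum_sketchProb_le (h : IsInstance G CG A b S κ ε Q R) {m N : ℕ} (hm : 0 < m)
    {t : Fin m → Fin (d + 1) → Bool} (ht : ∀ i, SketchGood (whitened A b R i) t) :
    ∑ i, sketchProb G A b R N CG ε t i ≤ 32 * N * (CG * d * κ / ε) ^ 4 := by
  have hε := h.eps_pos
  have hκ := h.one_le_kappa
  have hCG := h.orlicz.one_le_const
  have hd : (1 : ℝ) ≤ d := by exact_mod_cast h.one_le_d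
  have hε' : 1 ≤ ε⁻¹ := (one_le_inv₀ hε).2 (by linarith [h.eps_le])
  have hκ0 : 0 < κ := by linarith
  calc ∑ i, sketchProb G A b R N CG ε t i
      ≤ ∑ i, N * d * CG * (4 * CG * leverage G A b R i) / (ε * ε * ε) := by
        refine Finset.sum_le_sum fun i _ => (min_le_right _ _).trans ?_
        have := sketchScore_le h.orlicz hm (ht i)
        gcongr
    _ = 4 * N * d * CG ^ 2 / (ε * ε * ε) * ∑ i, G (l2 (whitened A b R i)) := by
        rw [Finset.mul_sum]
        refine Finset.sum_congr rfl fun i _ => ?_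
        rw [show leverage G A b R i = G (l2 (whitened A b R i)) from rfl]
        ring
    _ ≤ 4 * N * d * CG ^ 2 / (ε * ε * ε) * (CG * (d + 1 : ℕ) ^ 3 * κ ^ 2) := by
        gcongr
        exact sum_score_le h.orlicz _ hκ h.whitened_upper
    _ ≤ 4 * N * d * CG ^ 2 / (ε * ε * ε) * (CG * (2 * d) ^ 3 * κ ^ 2) := by
        gcongr
        push_cast
        linarith
    _ = 32 * N * (CG ^ 3 * d ^ 4 * κ ^ 2 * ε⁻¹ ^ 3) := by
        field_simp
        ring
    _ ≤ 32 * N * (CG ^ 4 * d ^ 4 * κ ^ 4 * ε⁻¹ ^ 4) := by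
        gcongr <;> norm_num
    _ = _ := by
        rw [div_eq_mul_inv]
        ring

lemma valid_descentParams (h : IsInstance G CG A b S κ ε Q R) {w : Fin n → ℝ} (hw : 0 ≤ w)
    (hemb : IsEmbedding G (whitened A b R) w (ε / 16)) :
    (descentParams A b R κ ε CG w).Valid G CG κ where
  orlicz := h.orlicz
  w_nonneg := hw
  kappa := h.one_le_kappa
  lower y := by
    have h1 := (hemb y).1
    have h2 := h.whitened_lower y
    have h3 := h.eps_le
    have h4 := l2_nonneg y
    have h5 := h.eps_pos
    show 1 / 2 * l2 y ≤ weightedOrliczNorm G w (whitened A b R *ᵥ y)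
    nlinarith
  upper y := by
    have h1 := (hemb y).2
    have h2 := h.whitened_upper y
    have h3 := h.eps_le
    have h4 : 0 ≤ orliczNorm G (whitened A b R *ᵥ y) := weightedOrliczNorm_nonneg
    have h5 := h.eps_pos
    show weightedOrliczNorm G w (whitened A b R *ᵥ y) ≤ 2 * κ * l2 y
    nlinarith
  r_ne := h.diag_ne_zero _
  eps_pos := h.eps_pos
  eps_le := h.eps_le
  rho := rfl
  eta := rfl

lemma mulVec_last (h : IsInstance G CG A b S κ ε Q R) (y : Fin (d + 1) → ℝ) :
    (R *ᵥ y) (Fin.last d) = R (Fin.last d) (Fin.last d) * y (Fin.last d) := by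
  rw [Matrix.mulVec, dotProduct, Finset.sum_eq_single (Fin.last d)]
  · intro j _ hj
    rw [h.qr.upper _ _ (lt_of_le_of_ne (Fin.le_last j) hj), zero_mul]
  · simp

/-- The affine change of variables: the points `R (x, -1)` are the points with last coordinate
`-r`. -/
lemma mulVec_snoc_eq_affPoint (h : IsInstance G CG A b S κ ε Q R) (x : Fin d → ℝ) :
    R *ᵥ (Fin.snoc x (-1) : Fin (d + 1) → ℝ) = affPoint (R (Fin.last d) (Fin.last d))
      fun j => (R *ᵥ (Fin.snoc x (-1) : Fin (d + 1) → ℝ)) j.castSucc := by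
  funext j
  refine Fin.lastCases ?_ (fun j => ?_) j
  · rw [mulVec_last h, affPoint, Fin.snoc_last, Fin.snoc_last, mul_neg_one]
  · rw [affPoint, Fin.snoc_castSucc]

lemma mulVec_snoc_inv (h : IsInstance G CG A b S κ ε Q R) (z : Fin d → ℝ) :
    R *ᵥ (Fin.snoc (fun j : Fin d => (R⁻¹ *ᵥ affPoint (R (Fin.last d) (Fin.last d)) z) j.castSucc)
      (-1) : Fin (d + 1) → ℝ) = affPoint (R (Fin.last d) (Fin.last d)) z := by
  set v := R⁻¹ *ᵥ affPoint (R (Fin.last d) (Fin.last d)) z with hv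
  have hRv : R *ᵥ v = affPoint (R (Fin.last d) (Fin.last d)) z := by
    rw [hv, Matrix.mulVec_mulVec, Matrix.mul_nonsing_inv _ h.isUnit_det, Matrix.one_mulVec]
  have hlast : v (Fin.last d) = -1 := by
    have h1 := congrFun hRv (Fin.last d)
    rw [mulVec_last h, affPoint, Fin.snoc_last, ← mul_neg_one] at h1
    exact mul_left_cancel₀ (h.diag_ne_zero _) h1
  rw [← hRv]
  congr 1
  funext j
  refine Fin.lastCases ?_ (fun j => ?_) j
  · rw [Fin.snoc_last, hlast]
  · rw [Fin.snoc_castSucc]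

/-- The point computed by the descent is an approximate minimizer. -/
lemma isMinimizer_descent (h : IsInstance G CG A b S κ ε Q R) {w : Fin n → ℝ} (hw : 0 ≤ w)
    (hemb : IsEmbedding G (whitened A b R) w (ε / 16)) {k : ℕ}
    (hk : 2 ^ 21 * κ ^ 4 ≤ k * ε ^ 2) :
    IsMinimizer G A b w (1 + ε / 4) fun j : Fin d => (R⁻¹ *ᵥ affPoint
        (R (Fin.last d) (Fin.last d)) (((descentParams A b R κ ε CG w).step G)^[k]
          (descentStart R κ)).best) j.castSucc := by
  intro x
  rw [h.residual_eq, h.residual_eq, mulVec_snoc_inv h, mulVec_snoc_eq_affPoint h x]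
  exact (valid_descentParams h hw hemb).objective_best_le hk _

end instances

section time

lemma sketchSize_add_one_le {n W : ℕ} (hn : 1 ≤ n) (hW : n ≤ W) :
    ((sketchSize n + 1 : ℕ) : ℝ) ≤ 113 * (1 + Real.log W) := by
  have hn' : (1 : ℝ) ≤ n := by exact_mod_cast hn
  have hW' : (n : ℝ) ≤ W := by exact_mod_cast hW
  have hlog : Real.log n ≤ Real.log W := Real.log_le_log (by linarith) hW'
  have hlog0 : 0 ≤ Real.log n := Real.log_nonneg hn'
  have h2 := Real.log_two_gt_d9
  have hclog : (Nat.clog 2 n : ℝ) ≤ 1 + 2 * Real.log n := by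
    rcases hn.eq_or_lt with rfl | hn1
    · simp
    · have h1 : 2 ^ (Nat.clog 2 n - 1) < n := Nat.pow_pred_clog_lt_self (by norm_num) hn1
      have h3 : Real.log ((2 : ℝ) ^ (Nat.clog 2 n - 1)) ≤ Real.log n :=
        Real.log_le_log (by positivity) (by exact_mod_cast h1.le)
      rw [Real.log_pow] at h3
      have h4 : 0 < Nat.clog 2 n := Nat.clog_pos (by norm_num) hn1
      have h5 : ((Nat.clog 2 n - 1 : ℕ) : ℝ) = Nat.clog 2 n - 1 := by
        rw [Nat.cast_sub h4, Nat.cast_one]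
      rw [h5] at h3
      have h6 : (0 : ℝ) ≤ Nat.clog 2 n - 1 := by rw [← h5]; positivity
      nlinarith
  rw [sketchSize]
  push_cast
  linarith

/-- The bound on the total number of steps. -/
lemma time_bound_le {n W d M P N t T : ℕ} {Y : ℝ} (hn : 1 ≤ n) (hW : n ≤ W) (hN : 1 ≤ N)
    (hY : 2 ≤ Y) (hd : ((d + 1 : ℕ) : ℝ) ≤ 2 * Y) (hM : ((M + 1 : ℕ) : ℝ) ≤ 2 ^ 22 * Y ^ 4)
    (hP : ((P + 1 : ℕ) : ℝ) ≤ 2 ^ 12 * N * Y ^ 4)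
    (ht : t ≤ T + ((300 * (d + 1) ^ 3 + 1000 * (sketchSize n + 1) * ((d + 1) ^ 2 + W)) +
      ((100 * n + 20) + (100 * n + 4000 * (M + 1) * (P + 1) * (d + 1) ^ 2)))) :
    (t : ℝ) ≤ T + 2 ^ 60 * N * W * (1 + Real.log W) ^ 10 + 2 ^ 60 * N * Y ^ 10 := by
  have hW1 : (1 : ℝ) ≤ W := by exact_mod_cast hn.trans hW
  have hnW : (n : ℝ) ≤ W := by exact_mod_cast hW
  have hN1 : (1 : ℝ) ≤ N := by exact_mod_cast hN
  set ℓ := 1 + Real.log W with hℓ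
  have hℓ1 : 1 ≤ ℓ := by linarith [Real.log_nonneg hW1]
  have hm := sketchSize_add_one_le hn hW
  rw [← hℓ] at hm
  have ht' : (t : ℝ) ≤ T + ((300 * ((d + 1 : ℕ) : ℝ) ^ 3 + 1000 * ((sketchSize n + 1 : ℕ) : ℝ) *
      (((d + 1 : ℕ) : ℝ) ^ 2 + W)) + ((100 * n + 20) + (100 * n + 4000 * ((M + 1 : ℕ) : ℝ) *
        ((P + 1 : ℕ) : ℝ) * ((d + 1 : ℕ) : ℝ) ^ 2))) := by
    exact_mod_cast ht
  have hℓ10 : ∀ k ≤ 10, ℓ ^ k ≤ ℓ ^ 10 := fun k hk => pow_le_pow_right₀ hℓ1 hk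
  have hY10 : ∀ k ≤ 10, Y ^ k ≤ Y ^ 10 := fun k hk => pow_le_pow_right₀ (by linarith) hk
  have hY0 : 0 < Y := by linarith
  have hX1 : 1 ≤ W * ℓ ^ 10 := one_le_mul_of_one_le_of_one_le hW1 (one_le_pow₀ hℓ1)
  have a1 : 300 * ((d + 1 : ℕ) : ℝ) ^ 3 ≤ 2400 * Y ^ 10 := by
    calc 300 * ((d + 1 : ℕ) : ℝ) ^ 3 ≤ 300 * (2 * Y) ^ 3 := by gcongr
      _ = 2400 * Y ^ 3 := by ring
      _ ≤ _ := by linarith [hY10 3 (by norm_num)]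
  have a2 : 1000 * ((sketchSize n + 1 : ℕ) : ℝ) * (((d + 1 : ℕ) : ℝ) ^ 2 + W) ≤
      113000 * (16 * Y ^ 10 + 2 * (W * ℓ ^ 10)) := by
    calc 1000 * ((sketchSize n + 1 : ℕ) : ℝ) * (((d + 1 : ℕ) : ℝ) ^ 2 + W)
        ≤ 1000 * (113 * ℓ) * ((2 * Y) ^ 2 + W) := by gcongr
      _ = 113000 * (ℓ * (4 * Y ^ 2) + W * ℓ) := by ring
      _ ≤ 113000 * ((16 * Y ^ 4 + ℓ ^ 2) + W * ℓ ^ 10) := by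
          have h1 : ℓ * (4 * Y ^ 2) ≤ 16 * Y ^ 4 + ℓ ^ 2 := by
            nlinarith [sq_nonneg (ℓ - 4 * Y ^ 2), sq_nonneg (ℓ + 4 * Y ^ 2)]
          have h2 := mul_le_mul_of_nonneg_left (hℓ10 1 (by norm_num)) (by linarith : (0 : ℝ) ≤ W)
          rw [pow_one] at h2
          linarith
      _ ≤ _ := by
          have h1 : ℓ ^ 2 ≤ W * ℓ ^ 10 := (hℓ10 2 (by norm_num)).trans
            (le_mul_of_one_le_left (by positivity) hW1)
          linarith [hY10 4 (by norm_num)]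
  have a3 : (n : ℝ) ≤ W * ℓ ^ 10 := hnW.trans
    (le_mul_of_one_le_right (by linarith) (one_le_pow₀ hℓ1))
  have a4 : 4000 * ((M + 1 : ℕ) : ℝ) * ((P + 1 : ℕ) : ℝ) * ((d + 1 : ℕ) : ℝ) ^ 2 ≤
      2 ^ 48 * (N * Y ^ 10) := by
    calc 4000 * ((M + 1 : ℕ) : ℝ) * ((P + 1 : ℕ) : ℝ) * ((d + 1 : ℕ) : ℝ) ^ 2
        ≤ 4000 * (2 ^ 22 * Y ^ 4) * (2 ^ 12 * N * Y ^ 4) * (2 * Y) ^ 2 := by gcongr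
      _ = (4000 * 2 ^ 22 * 2 ^ 12 * 4) * (N * Y ^ 10) := by ring
      _ ≤ _ := by
          apply mul_le_mul_of_nonneg_right _ (by positivity)
          norm_num
  have a5 : Y ^ 10 ≤ N * Y ^ 10 := le_mul_of_one_le_left (by positivity) hN1
  have a6 : W * ℓ ^ 10 ≤ N * (W * ℓ ^ 10) := le_mul_of_one_le_left (by positivity) hN1
  have e1 : 2 ^ 60 * (N : ℝ) * W * ℓ ^ 10 = 2 ^ 60 * (N * (W * ℓ ^ 10)) := by ring
  have e2 : 2 ^ 60 * (N : ℝ) * Y ^ 10 = 2 ^ 60 * (N * Y ^ 10) := by ring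
  have a7 : 0 < Y ^ 10 := by positivity
  rw [e1, e2]
  linarith

end time

end RealRAM

/-! ### Success probability -/

namespace RealRAM

section main

variable {G : ℝ → ℝ} {CG : ℝ} {n d s : ℕ} {A : Matrix (Fin n) (Fin d) ℝ} {b : Fin n → ℝ}
  {S : Matrix (Fin s) (Fin n) ℝ} {κ ε : ℝ} {Q : Matrix (Fin s) (Fin (d + 1)) ℝ}
  {R : Matrix (Fin (d + 1)) (Fin (d + 1)) ℝ}

lemma one_le_rows (h : IsInstance G CG A b S κ ε Q R) : 1 ≤ n := by
  have := h.fullRank.fintype_card_le_finrank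
  rw [Fintype.card_fin, Module.finrank_fin_fun] at this
  omega

/-- The parameter on which the second part of the running time depends is at least `2`. -/
lemma two_le_param (h : IsInstance G CG A b S κ ε Q R) :
    2 ≤ CG * d * κ / ε ∧ ((d + 1 : ℕ) : ℝ) ≤ 2 * (CG * d * κ / ε) ∧ κ / ε ≤ CG * d * κ / ε := by
  have hε := h.eps_pos
  have hκ := h.one_le_kappa
  have hCG := h.orlicz.one_le_const
  have hd : (1 : ℝ) ≤ d := by exact_mod_cast h.one_le_d
  have hκ0 : 0 < κ := by linarith
  have h1 : 1 ≤ CG * d := one_le_mul_of_one_le_of_one_le hCG hd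
  have h2 : 2 ≤ κ / ε := by rw [le_div_iff₀ hε]; linarith [h.eps_le]
  have h3 : κ / ε ≤ CG * d * κ / ε := by
    rw [mul_div_assoc]
    exact le_mul_of_one_le_left (by positivity) h1
  have h4 : (d : ℝ) ≤ CG * d * κ / ε := by
    rw [mul_div_assoc]
    calc (d : ℝ) ≤ CG * d := le_mul_of_one_le_left (by linarith) hCG
      _ ≤ CG * d * (κ / ε) := le_mul_of_one_le_right (by linarith) (by linarith)
  refine ⟨h2.trans h3, ?_, h3⟩
  push_cast
  linarith

/-- The run succeeds whenever the sketch preserves all row norms, the sampled weights give an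
embedding, and not too many weights are non-zero. -/
lemma successfulRun_of_good (h : IsInstance G CG A b S κ ε Q R) {C : ℝ} (hC : 0 ≤ C) {N : ℕ}
    (hN1 : 1 ≤ N) (hN : 4 * C ≤ N) {qr : Cmd} {σ₀ σ₁ : State} {T : ℕ} {ω : Tape}
    (hqr : Exec G ω qr σ₀ σ₁ T) (hS : Stores σ₁ A b κ ε CG R)
    (hgood : ∀ i, SketchGood (whitened A b R i) (tapeBits ω σ₁.pos (sketchSize n) (d + 1)))
    (hemb : ∀ w, w = drawWeights ω (σ₁.pos + sketchSize n * (d + 1))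
      (sketchProb G A b R N CG ε (tapeBits ω σ₁.pos (sketchSize n) (d + 1))) → 0 ≤ w →
      IsEmbedding G (whitened A b R) w (ε / 16) ∧
      ∑ i, Set.indicator {0}ᶜ (fun _ => (1 : ℝ)) (w i) ≤
        100 * (32 * N * (CG * d * κ / ε) ^ 4)) :
    SuccessfulRun G CG A b R κ ε C (2 ^ 60 * N) 10 qr (levCmd N) sampCmd solveCmd σ₀ σ₁ T ω := by
  have hε := h.eps_pos
  have hκ := h.one_le_kappa
  have hn := one_le_rows h
  have hm : 0 < sketchSize n := by unfold sketchSize; omega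
  have hN1' : (1 : ℝ) ≤ N := by exact_mod_cast hN1
  have hCG := h.orlicz.const_pos
  obtain ⟨hY, hdY, hκY⟩ := two_le_param h
  set Y := CG * d * κ / ε with hYdef
  have hκ0 : 0 < κ := by linarith
  have hY4 : 16 ≤ Y ^ 4 := by
    calc (16 : ℝ) = 2 ^ 4 := by norm_num
      _ ≤ Y ^ 4 := by gcongr
  have hNY : 16 ≤ N * Y ^ 4 := hY4.trans (le_mul_of_one_le_left (by linarith) hN1')
  obtain ⟨σ₂, t₂, hE₂, ht₂, hS₂, hpos₂, hu₂, hp₂, hV₂⟩ := runs_levCmd (G := G) (ω := ω) (N := N) hn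
    hS h.isUnit_det h.qr.upper h.diag_ne_zero
  obtain ⟨σ₃, t₃, hE₃, ht₃, hw₃⟩ := runs_sampCmd (G := G) (ω := ω) hS₂.rows
  have hF₃ := hE₃.frame
  have hS₃ := hS₂.of_frame hF₃ (by decide) (by decide)
  have hV₃ : ∀ i < d + 1, ∀ j < d + 1, σ₃.real 10 i j = natEntry R⁻¹ i j := by
    rw [hF₃.real 10 (by decide)]; exact hV₂
  have hadm : Admissible C d ε (leverage G A b R) (σ₂.vec 6 n) := by
    rw [hp₂]
    exact admissible_sketchProb h.orlicz hm hε h.eps_le hC hN hgood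
  have hw0 : 0 ≤ σ₃.vec 7 n := by
    intro i
    rw [hw₃]
    show (0 : ℝ) ≤ if _ then _ else _
    split_ifs
    · exact one_div_nonneg.2 (hadm i).1
    · exact le_rfl
  obtain ⟨hembed, hcount⟩ := hemb (σ₃.vec 7 n) (by rw [hw₃, hpos₂, hp₂]) hw0
  set M : ℕ := ⌈2 ^ 21 * κ ^ 4 / ε ^ 2⌉₊ with hMdef
  have hM : 2 ^ 21 * κ ^ 4 ≤ M * ε ^ 2 := by
    rw [← div_le_iff₀ (by positivity)]
    exact Nat.le_ceil _
  set P : ℕ := ⌈100 * (32 * N * Y ^ 4)⌉₊ with hPdef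
  obtain ⟨σ₄, t₄, hE₄, ht₄, k, hk, hx⟩ := runs_solveCmd (G := G) (ω := ω) (N := P) (M := M) hS₃ hV₃
    hw0 (hcount.trans (Nat.le_ceil _)) hM
  have hmin : IsMinimizer G A b (σ₃.vec 7 n) (1 + ε / 4) (σ₄.vec 8 d) := by
    rw [hx]
    exact isMinimizer_descent h hw0 hembed hk
  have hK : 4 ≤ 2 ^ 60 * (N : ℝ) := by linarith
  refine ⟨σ₂, σ₃, σ₄, t₂, t₃, t₄, T + (t₂ + (t₃ + t₄)), .seq hqr (.seq hE₂ (.seq hE₃ hE₄)), hE₂,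
    fun i => ?_, hadm, hE₃, hw₃, hE₄, hmin,
    h.isApproxSolution hembed (by linarith) le_rfl hmin, ?_⟩
  · have h1 := leverage_le h.orlicz hm (hgood i)
    have h2 := sketchScore_le h.orlicz hm (hgood i)
    have h3 : 0 ≤ leverage G A b R i := h.orlicz.nonneg _
    have h4 : 0 ≤ sketchScore G A b R (tapeBits ω σ₁.pos (sketchSize n) (d + 1)) i :=
      h.orlicz.nonneg _
    rw [hu₂]
    exact ⟨h1.trans (by gcongr), h2.trans (by gcongr)⟩
  · refine time_bound_le (M := M) (P := P) hn (Nat.le_add_left n (nnz A)) hN1 hY hdY ?_ ?_ ?_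
    · have h1 : (M : ℝ) ≤ 2 ^ 21 * κ ^ 4 / ε ^ 2 + 1 := (Nat.ceil_lt_add_one (by positivity)).le
      have h2 : κ ^ 4 / ε ^ 2 ≤ Y ^ 4 := by
        calc κ ^ 4 / ε ^ 2 ≤ κ ^ 4 / ε ^ 4 := by
              refine div_le_div_of_nonneg_left (by positivity) (by positivity) ?_
              exact pow_le_pow_of_le_one hε.le (by linarith [h.eps_le]) (by norm_num)
          _ = (κ / ε) ^ 4 := by rw [div_pow]
          _ ≤ Y ^ 4 := by gcongr
      rw [mul_div_assoc] at h1
      push_cast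
      linarith
    · have h1 : (P : ℝ) ≤ 100 * (32 * N * Y ^ 4) + 1 := (Nat.ceil_lt_add_one (by positivity)).le
      push_cast
      linarith
    · omega

/-- The algorithm succeeds with probability at least `0.9`. -/
theorem tapeLaw_not_successfulRun_le (h : IsInstance G CG A b S κ ε Q R) {C : ℝ}
    (hC : 9216 * 24 ≤ C) {N : ℕ} (hN : 4 * C ≤ N) {qr : Cmd} {σ₀ σ₁ : State} {T : ℕ}
    (hqr : ∀ ω, Exec G ω qr σ₀ σ₁ T) (hS : Stores σ₁ A b κ ε CG R) :
    tapeLaw {ω | ¬ SuccessfulRun G CG A b R κ ε C (2 ^ 60 * N) 10 qr (levCmd N) sampCmd solveCmd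
      σ₀ σ₁ T ω} ≤ 1 / 10 := by
  have hε := h.eps_pos
  have hC0 : 0 ≤ C := by linarith
  have hN1 : 1 ≤ N := by
    have : (1 : ℝ) ≤ N := by linarith
    exact_mod_cast this
  have hm : 0 < sketchSize n := by unfold sketchSize; omega
  obtain ⟨hY, -, -⟩ := two_le_param h
  obtain ⟨Z, hZ, hZp⟩ := exists_embedding_net h.orlicz (whitened A b R) h.whitened_lower h.one_le_d
    h.eps_pos h.eps_le
  set B := 32 * N * (CG * d * κ / ε) ^ 4 with hB
  have hB0 : 0 < B := by
    have : 0 < CG * d * κ / ε := by linarith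
    have : (0 : ℝ) < N := by exact_mod_cast hN1
    positivity
  set bad : Set (Fin n → ℝ) := deviationSet G (whitened A b R) Z ε ∪
    {w | 100 * B < ∑ i, Set.indicator {0}ᶜ (fun _ => (1 : ℝ)) (w i)} with hbad
  have hbad_meas : MeasurableSet bad := by
    refine (measurableSet_deviationSet _ _ _).union (measurableSet_lt measurable_const ?_)
    refine Finset.measurable_sum _ fun i _ => ?_
    exact (measurable_const.indicator (measurableSet_singleton (0 : ℝ)).compl).comp
      (measurable_pi_apply i)
  have key := tapeLaw_two_phase σ₁.pos (m := sketchSize n) (D := d + 1)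
    (fun t => ∀ i, SketchGood (whitened A b R i) t) (sketchProb G A b R N CG ε) bad hbad_meas
    (fun t i => sketchProb_mem h.orlicz hε N t i) (γ := 1 / 50) (δ := 1 / 32 + 1 / 100)
    (by norm_num) (by norm_num)
    (by
      convert card_not_forall_sketchGood_le (m := sketchSize n) (whitened A b R)
        (Nat.le_pow_clog (by norm_num : 1 < 2) n) rfl)
    (fun t ht => by
      rw [ENNReal.ofReal_add (by norm_num) (by norm_num)]
      refine (measure_union_le _ _).trans (add_le_add ?_ ?_)
      · exact hZp C hC _ (admissible_sketchProb h.orlicz hm hε h.eps_le hC0 hN ht)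
      · exact weightLaw_card_le (fun i => sketchProb_mem h.orlicz hε N t i) hB0
          (sum_sketchProb_le h hm ht))
  refine (measure_mono ?_).trans (key.trans ?_)
  · intro ω hω hgood
    refine hω (successfulRun_of_good h hC0 hN1 hN (hqr ω) hS hgood.1 ?_)
    rintro w rfl hw0
    have h1 := hgood.2
    rw [hbad, Set.mem_union, not_or] at h1
    exact ⟨hZ _ hw0 h1.1, not_lt.1 h1.2⟩
  · rw [← ENNReal.ofReal_one, show (10 : ℝ≥0∞) = ENNReal.ofReal 10 by simp,
      ← ENNReal.ofReal_div_of_pos (by norm_num)]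
    exact ENNReal.ofReal_le_ofReal (by norm_num)

end main

end RealRAM

end

theorem theorem4 :
    ∃ C₀ : ℝ, 0 < C₀ ∧ ∀ C : ℝ, C₀ ≤ C →
      -- correctness of the algorithm for any admissible choice of sampling probabilities
      (∀ (G : ℝ → ℝ) (CG : ℝ) (n d s : ℕ) (A : Matrix (Fin n) (Fin d) ℝ) (b : Fin n → ℝ)
          (S : Matrix (Fin s) (Fin n) ℝ) (κ ε : ℝ) (Q : Matrix (Fin s) (Fin (d + 1)) ℝ)
          (R : Matrix (Fin (d + 1)) (Fin (d + 1)) ℝ),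
        IsInstance G CG A b S κ ε Q R →
        ∀ p : Fin n → ℝ, Admissible C d ε (leverage G A b R) p →
          weightLaw p {w | ¬ ((∃ x, IsMinimizer G A b w 1 x) ∧
            ∀ x, IsMinimizer G A b w 1 x → IsApproxSolution G A b ε x)} ≤ 1 / 10) ∧
      -- implementation with the claimed running time; `qr` is any program for Step 1, and `T` is
      -- its running time
      (∃ (lev samp solve : RealRAM.Cmd) (K : ℝ) (k : ℕ), 0 < K ∧
        ∀ (G : ℝ → ℝ) (CG : ℝ) (n d s : ℕ) (A : Matrix (Fin n) (Fin d) ℝ) (b : Fin n → ℝ)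
          (S : Matrix (Fin s) (Fin n) ℝ) (κ ε : ℝ) (Q : Matrix (Fin s) (Fin (d + 1)) ℝ)
          (R : Matrix (Fin (d + 1)) (Fin (d + 1)) ℝ),
        IsInstance G CG A b S κ ε Q R →
        ∀ (qr : RealRAM.Cmd) (σ₀ σ₁ : RealRAM.State) (T : ℕ),
          (∀ ω, RealRAM.Exec G ω qr σ₀ σ₁ T) →
          RealRAM.Stores σ₁ A b κ ε CG R →
          RealRAM.tapeLaw {ω | ¬ RealRAM.SuccessfulRun G CG A b R κ ε C K k
            qr lev samp solve σ₀ σ₁ T ω} ≤ 1 / 10) := by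
  refine ⟨9216 * 24, by norm_num, fun C hC => ⟨?_, ?_⟩⟩
  · intro G CG n d s A b S κ ε Q R h p hp
    exact h.correctness hC hp
  · obtain ⟨N, hN⟩ := exists_nat_ge (4 * C)
    have hN0 : (0 : ℝ) < N := by linarith
    refine ⟨RealRAM.levCmd N, RealRAM.sampCmd, RealRAM.solveCmd, 2 ^ 60 * N, 10, by positivity, ?_⟩
    intro G CG n d s A b S κ ε Q R h qr σ₀ σ₁ T hqr hS
    exact RealRAM.tapeLaw_not_successfulRun_le h hC hN hqr hS
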